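/- Let $n\ge 1$, $0\le k,\ell\le n$. Let $\Lambda^k$ be the space of complex-valued alternating $k$-forms on $\mathbb R^n$, $\varepsilon_x$ and $\iota_x$ exterior and interior multiplication by $x\in\mathbb R^n$, $\varepsilon_j=\varepsilon_{e_j}$, $\iota_j=\iota_{e_j}$, $d=\sum_m\varepsilon_m\partial_m$, $\delta=-\sum_m\iota_m\partial_m$. Let $\mathcal S\mathcal E^{k,\ell}$ (resp. $\mathcal E^{k,\ell}$) be the space of Schwartz (resp. smooth) functions on $\mathbb R^n\times\mathbb R^n$ with values in $\Lambda^k\otimes\Lambda^\ell$; in $S\otimes T$ the operator $S$ acts in $x$ on $\Lambda^k$ and $T$ in $y$ on $\Lambda^\ell$. The Riesz distribution $\mathcal R^k_s$ on $k$-forms is defined for $-n<\operatorname{Re}s<0$ by $$\langle\mathcal R^k_s,\omega\rangle=\pi^{-n/2}2^{-s-n+1}\frac{\Gamma(-\frac s2+1)}{\Gamma(\frac{s+n}2)}\int_{\mathbb R^n}\|x\|^{s-2}(\iota_x\varepsilon_x-\varepsilon_x\iota_x)\,\omega(x)\,dx$$ and for other $s\in\mathbb C$ by meromorphic continuation (with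 poles at most at $s=2,4,6,\dots$). Let $J^k_s\omega=\mathcal R^k_s*\omega$, and let $J^k_s\otimes J^\ell_t$ be convolution with $\mathcal R^k_s\otimes\mathcal R^\ell_t$. Put $$\alpha_{k,s}=(s+n-2k)(s-n+2k-2),\quad \beta_{k,s}=(s-n+2k)(s+n-2k-2),$$ $$\gamma_{k,s}=2s(s-n+2k-2),\quad \delta_{k,s}=2s(s+n-2k-2),\quad \kappa_{k,s}=(s-n+2k-2)(s+n-2k-2),$$ $$\Box_{k,s}=\alpha_{k,s}\,\delta d+\beta_{k,s}\,d\delta,\qquad P_{k,s,j}=s\kappa_{k,s}\partial_j-\gamma_{k,s}\,\delta\varepsilon_j+\delta_{k,s}\,d\iota_j,$$ $$\begin{aligned}E^{k,\ell}_{s,t}=&-(\Box_{k,s}\otimes\Box_{\ell,t})\circ\|x-y\|^2-2\sum_{j=1}^n(P_{k,s,j}\otimes\Box_{\ell,t})\circ(x_j-y_j)+2\sum_{j=1}^n(\Box_{k,s}\otimes P_{\ell,t,j})\circ(x_j-y_j)\\&+2\sum_{j=1}^nP_{k,s,j}\otimes P_{\ell,t,j}+s(s+n)\kappa_{k,s}\,\mathrm{Id}\otimes\Box_{\ell,t}+t(t+n)\kappa_{\ell,t}\,\Box_{k,s}\otimes\mathrm{Id}.\end{aligned}$$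 (1) Let $s,t\in\mathbb C$ with $s,t\notin\{-n-2m: m=0,1,2,\dots\}$. Then $E^{k,\ell}_{s,t}$ maps $\mathcal S\mathcal E^{k,\ell}$ to itself, the operators below are defined (no poles occur), and on $\mathcal S\mathcal E^{k,\ell}$ $$-\kappa_{k,s}\kappa_{\ell,t}\,\|x-y\|^2\,\big(J^k_{-s-n}\otimes J^\ell_{-t-n}\big)=\big(J^k_{-s-n+2}\otimes J^\ell_{-t-n+2}\big)\circ E^{k,\ell}_{s,t}.$$ (2) For $\lambda,\mu\in\mathbb C$ put $\widetilde\Box_{k,\lambda}=(\lambda-n+k)(\lambda-k+1)\,\delta d+(\lambda-n+k+1)(\lambda-k)\,d\delta$, $\widetilde\nabla_{k,\lambda,j}=(\lambda-n+k)(\lambda-k+1)\partial_j-(\lambda-k)\,\varepsilon_j\delta-(\lambda-n+k)\,d\iota_j$ and $$\begin{aligned}F^{k,\ell}_{\lambda,\mu}=&\;16\|x-y\|^2\,\widetilde\Box_{k,\lambda}\otimes\widetilde\Box_{\ell,\mu}-32\sum_{j=1}^n(x_j-y_j)\Big\{(2\lambda-n+2)\widetilde\nabla_{k,\lambda,j}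\otimes\widetilde\Box_{\ell,\mu}-(2\mu-n+2)\widetilde\Box_{k,\lambda}\otimes\widetilde\nabla_{\ell,\mu,j}\Big\}\\&-32(2\lambda-n+2)(2\mu-n+2)\sum_{j=1}^n\widetilde\nabla_{k,\lambda,j}\otimes\widetilde\nabla_{\ell,\mu,j}-32(2\mu-n+2)(\mu+1)(\mu-\ell)(\mu-n+\ell)\,\widetilde\Box_{k,\lambda}\otimes\mathrm{Id}\\&-32(2\lambda-n+2)(\lambda+1)(\lambda-k)(\lambda-n+k)\,\mathrm{Id}\otimes\widetilde\Box_{\ell,\mu}.\end{aligned}$$ Then $F^{k,\ell}_{\lambda,\mu}$ acts on $\mathcal E^{k,\ell}$, and $F^{k,\ell}_{\lambda,\mu}=-E^{k,\ell}_{n-2\lambda,n-2\mu}$ there. (3) Let $I^k_\lambda=J^k_{-2n+2\lambda}$ be the Knapp–Stein operators, $M$ multiplication by $\|x-y\|^2$, and $\kappa^{k,\ell}_{\lambda,\mu}=16(\lambda-k+1)(\lambda-n+k+1)(\mu-\ell+1)(\mu-n+\ell+1)$. If $\lambda,\mu\notin\{n,n+1,n+2,\dots\}$, then $F^{k,\ell}_{\lambda,\mu}$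 maps $\mathcal S\mathcal E^{k,\ell}$ to itself, the operators below are defined (no poles occur), and on $\mathcal S\mathcal E^{k,\ell}$ $$\kappa^{k,\ell}_{\lambda,\mu}\,M\circ(I^k_\lambda\otimes I^\ell_\mu)=(I^k_{\lambda+1}\otimes I^\ell_{\mu+1})\circ F^{k,\ell}_{\lambda,\mu}.$$ -/

import Mathlib

open scoped SchwartzMap

noncomputable section

/-- Euclidean space of dimension `n`. -/
abbrev Euc (n : ℕ) := EuclideanSpace ℝ (Fin n)

/-- The complex exterior algebra `Λ = ⨁ Λ^k` of the dual of Euclidean space, in the standard basis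
`e_I = e_{i_1} ∧ ⋯ ∧ e_{i_k}`, `I = {i_1 < ⋯ < i_k}`: the element `∑ w_I e_I` is the family of its
coefficients `w_I`. The summand `Λ^k` consists of the families supported on the `I` with
`k` elements. -/
abbrev ExtAlg (n : ℕ) := Finset (Fin n) → ℂ

/-- The tensor product `Λ ⊗ Λ`, in the basis `e_I ⊗ e_J`. -/
abbrev BiExtAlg (n : ℕ) := Finset (Fin n) → Finset (Fin n) → ℂ

namespace Forms

variable {n : ℕ}

/-- The sign `(-1)^r`, where `r` is the number of elements of `I` that are smaller than `j`. -/
def sgn (j : Fin n) (I : Finset (Fin n)) : ℂ := (-1) ^ (I.filter (fun i => i < j)).card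

/-- Exterior multiplication with the covector `e_j`: `e_I` goes to `e_j ∧ e_I`, which is
`sgn j I • e_{I ∪ {j}}` if `j ∉ I`, and `0` otherwise. -/
def extMul (j : Fin n) (w : ExtAlg n) : ExtAlg n :=
  fun I => if j ∈ I then sgn j I * w (I.erase j) else 0

/-- Interior multiplication with the vector `e_j`: `e_I` goes to `sgn j I • e_{I \ {j}}` if
`j ∈ I`, and to `0` otherwise. -/
def intMul (j : Fin n) (w : ExtAlg n) : ExtAlg n :=
  fun I => if j ∈ I then 0 else sgn j I * w (insert j I)

/-- Exterior multiplication with the covector dual to `x`. -/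
def extMulVec (x : Euc n) (w : ExtAlg n) : ExtAlg n := ∑ j, (x j : ℂ) • extMul j w

/-- Interior multiplication with the vector `x`. -/
def intMulVec (x : Euc n) (w : ExtAlg n) : ExtAlg n := ∑ j, (x j : ℂ) • intMul j w

/-! ### Operators on differential forms on `ℝⁿ` -/

/-- The partial derivative in the direction of the basis vector `e_j`. -/
def pd (j : Fin n) (w : Euc n → ExtAlg n) : Euc n → ExtAlg n :=
  fun x => fderiv ℝ w x (EuclideanSpace.single j 1)

/-- Pointwise exterior multiplication with `e_j`. -/
def eps (j : Fin n) (w : Euc n → ExtAlg n) : Euc n → ExtAlg n := fun x => extMul j (w x)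

/-- Pointwise interior multiplication with `e_j`. -/
def iot (j : Fin n) (w : Euc n → ExtAlg n) : Euc n → ExtAlg n := fun x => intMul j (w x)

/-- The exterior differential `d = ∑ ε_m ∂_m`. -/
def d (w : Euc n → ExtAlg n) : Euc n → ExtAlg n := ∑ m, eps m (pd m w)

/-- The co-differential `δ = - ∑ ι_m ∂_m`. -/
def codiff (w : Euc n → ExtAlg n) : Euc n → ExtAlg n := -∑ m, iot m (pd m w)

/-! ### Operators on forms on `ℝⁿ × ℝⁿ` -/

/-- `T ⊗ Id`: the operator `T` acts in the variable `x` and on the first factor of `Λ ⊗ Λ`. -/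
def onFst (T : (Euc n → ExtAlg n) → Euc n → ExtAlg n) (w : Euc n × Euc n → BiExtAlg n) :
    Euc n × Euc n → BiExtAlg n :=
  fun p I J => T (fun x I' => w (x, p.2) I' J) p.1 I

/-- `Id ⊗ T`: the operator `T` acts in the variable `y` and on the second factor of `Λ ⊗ Λ`. -/
def onSnd (T : (Euc n → ExtAlg n) → Euc n → ExtAlg n) (w : Euc n × Euc n → BiExtAlg n) :
    Euc n × Euc n → BiExtAlg n :=
  fun p I J => T (fun y J' => w (p.1, y) I J') p.2 J

/-- `S ⊗ T = (S ⊗ Id) ∘ (Id ⊗ T)`. -/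
def tensor (S T : (Euc n → ExtAlg n) → Euc n → ExtAlg n) (w : Euc n × Euc n → BiExtAlg n) :
    Euc n × Euc n → BiExtAlg n :=
  onFst S (onSnd T w)

/-- Multiplication by `‖x - y‖²`. -/
def mulDistSq (w : Euc n × Euc n → BiExtAlg n) : Euc n × Euc n → BiExtAlg n :=
  fun p => ((‖p.1 - p.2‖ ^ 2 : ℝ) : ℂ) • w p

/-- Multiplication by `x_j - y_j`. -/
def mulDiff (j : Fin n) (w : Euc n × Euc n → BiExtAlg n) : Euc n × Euc n → BiExtAlg n :=
  fun p => ((p.1 j - p.2 j : ℝ) : ℂ) • w p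

/-- All values of `w` lie in `Λ^k ⊗ Λ^l`. -/
def HasBidegree (k l : ℕ) (w : Euc n × Euc n → BiExtAlg n) : Prop :=
  ∀ p I J, ¬(I.card = k ∧ J.card = l) → w p I J = 0

/-! ### Riesz distributions on differential forms and their convolution operators -/

/-- The integral that defines the Riesz distribution on forms for `-n < Re s < 0`:
`π^{-n/2} 2^{-s-n+1} Γ(-s/2+1) / Γ((s+n)/2) ∫ ‖x‖^{s-2} (ι_x ε_x - ε_x ι_x) φ(x) dx`.
The formula does not involve the degree; the distribution on `k`-forms is obtained by letting
`φ` range over `k`-forms. -/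
def rieszIntegral (s : ℂ) (φ : Euc n → ExtAlg n) : ExtAlg n :=
  ((Real.pi : ℂ) ^ (-(n : ℂ) / 2) * (2 : ℂ) ^ (-s - n + 1) *
      (Complex.Gamma (-s / 2 + 1) / Complex.Gamma ((s + n) / 2))) •
    ∫ x : Euc n, ((‖x‖ : ℂ) ^ (s - 2)) •
      (intMulVec x (extMulVec x (φ x)) - extMulVec x (intMulVec x (φ x)))

/-- `g` is the meromorphic continuation to `ℂ` of `s ↦ rieszIntegral s φ`, `-n < Re s < 0`.
(Normal form means that `g` takes the value `0` at its poles and has no removable singularity,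
which makes `g` unique for `n ≥ 1`, by the identity theorem.) -/
def IsRieszContinuation (φ : Euc n → ExtAlg n) (g : ℂ → ExtAlg n) : Prop :=
  MeromorphicNFOn g Set.univ ∧
    ∀ s : ℂ, -(n : ℝ) < s.re → s.re < 0 → g s = rieszIntegral s φ

/-- The continuation is unique. -/
theorem IsRieszContinuation.unique (hn : 1 ≤ n) {φ : Euc n → ExtAlg n} {g h : ℂ → ExtAlg n}
    (hg : IsRieszContinuation φ g)
    (hh : IsRieszContinuation φ h) : g = h := by
  have hm : MeromorphicOn (g - h) Set.univ := hg.1.meromorphicOn.sub hh.1.meromorphicOn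
  have hopen : IsOpen {s : ℂ | -(n:ℝ) < s.re ∧ s.re < 0} :=
    (isOpen_lt continuous_const Complex.continuous_re).inter (isOpen_lt Complex.continuous_re continuous_const)
  have h0 : (-(1/2) : ℂ) ∈ {s : ℂ | -(n:ℝ) < s.re ∧ s.re < 0} := by
    have : (1:ℝ) ≤ n := by exact_mod_cast hn
    constructor
    · norm_num; linarith
    · norm_num
  have hz : meromorphicOrderAt (g - h) (-(1/2)) = ⊤ := by
    rw [meromorphicOrderAt_eq_top_iff]
    refine Filter.Eventually.filter_mono nhdsWithin_le_nhds ?_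
    filter_upwards [hopen.mem_nhds h0] with s hs
    simp [hg.2 s hs.1 hs.2, hh.2 s hs.1 hs.2]
  funext z
  have hz2 : meromorphicOrderAt (g - h) z = ⊤ := by
    by_contra hne
    exact (hm.meromorphicOrderAt_ne_top_of_isPreconnected (x := z) isPreconnected_univ (Set.mem_univ _) (Set.mem_univ (-(1/2))) hne) hz
  rw [meromorphicOrderAt_eq_top_iff] at hz2
  have e : g =ᶠ[nhdsWithin z {z}ᶜ] h := by
    filter_upwards [hz2] with s hs; exact sub_eq_zero.mp hs
  have := (MeromorphicNFAt.eventuallyEq_nhdsNE_iff_eventuallyEq_nhds (hg.1 (Set.mem_univ z)) (hh.1 (Set.mem_univ z))).1 e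
  exact this.eq_of_nhds

open Classical in
/-- The value `⟨R_s, φ⟩` of the Riesz distribution on forms: the meromorphic continuation of
`rieszIntegral`, evaluated at `s`. -/
def rieszPairing (s : ℂ) (φ : Euc n → ExtAlg n) : ExtAlg n :=
  if h : ∃ g, IsRieszContinuation φ g then h.choose s else 0

/-- The meromorphic continuation exists, and `s` is not a pole of it. -/
def RieszDefined (s : ℂ) (φ : Euc n → ExtAlg n) : Prop :=
  ∃ g, IsRieszContinuation φ g ∧ AnalyticAt ℂ g s

/-- The operator `J_s` of convolution with the Riesz distribution on forms,
`(J_s w)(x) = ⟨R_s, w(x - ·)⟩`. -/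
def rieszConv (s : ℂ) (w : Euc n → ExtAlg n) : Euc n → ExtAlg n :=
  fun x => rieszPairing s (fun u => w (x - u))

/-- All the pairings that occur in `(J_s ⊗ J_t) w`, that is in
`⟨R_s(u), ⟨R_t(v), w(x - u, y - v)⟩⟩`, are defined, without poles. -/
def TensorRieszDefined (s t : ℂ) (w : Euc n × Euc n → BiExtAlg n) : Prop :=
  (∀ x y I, RieszDefined t (fun v => w (x, y - v) I)) ∧
    ∀ x y J, RieszDefined s (fun u I => onSnd (rieszConv t) w (x - u, y) I J)

/-- The Knapp-Stein operator `I_lam`, which is convolution with the Riesz distribution of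
parameter `-2n + 2 lam`. -/
def knappStein (lam : ℂ) (w : Euc n → ExtAlg n) : Euc n → ExtAlg n :=
  rieszConv (-2 * n + 2 * lam) w

/-! ### The differential operator `E` -/

/-- `α_{k,s}`, on `ℝⁿ`. -/
def alpha (n k : ℕ) (s : ℂ) : ℂ := (s + n - 2 * k) * (s - n + 2 * k - 2)

/-- `β_{k,s}`, on `ℝⁿ`. -/
def beta (n k : ℕ) (s : ℂ) : ℂ := (s - n + 2 * k) * (s + n - 2 * k - 2)

/-- `γ_{k,s}`, on `ℝⁿ`. -/
def gam (n k : ℕ) (s : ℂ) : ℂ := 2 * s * (s - n + 2 * k - 2)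

/-- `δ_{k,s}`, on `ℝⁿ`. -/
def del (n k : ℕ) (s : ℂ) : ℂ := 2 * s * (s + n - 2 * k - 2)

/-- `κ_{k,s}`, on `ℝⁿ`. -/
def kap (n k : ℕ) (s : ℂ) : ℂ := (s - n + 2 * k - 2) * (s + n - 2 * k - 2)

/-- `α_{k,s} δ d + β_{k,s} d δ`. -/
def box (k : ℕ) (s : ℂ) (w : Euc n → ExtAlg n) : Euc n → ExtAlg n :=
  alpha n k s • codiff (d w) + beta n k s • d (codiff w)

/-- `s κ_{k,s} ∂_j - γ_{k,s} δ ε_j + δ_{k,s} d ι_j`. -/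
def grad (k : ℕ) (s : ℂ) (j : Fin n) (w : Euc n → ExtAlg n) : Euc n → ExtAlg n :=
  (s * kap n k s) • pd j w - gam n k s • codiff (eps j w) + del n k s • d (iot j w)

/-- The differential operator `E_{s,t}^{k,l}`. -/
def opE (k l : ℕ) (s t : ℂ) (w : Euc n × Euc n → BiExtAlg n) : Euc n × Euc n → BiExtAlg n :=
  -tensor (box k s) (box l t) (mulDistSq w)
  - (2 : ℂ) • ∑ j, tensor (grad k s j) (box l t) (mulDiff j w)
  + (2 : ℂ) • ∑ j, tensor (box k s) (grad l t j) (mulDiff j w)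
  + (2 : ℂ) • ∑ j, tensor (grad k s j) (grad l t j) w
  + (s * (s + n) * kap n k s) • tensor id (box l t) w
  + (t * (t + n) * kap n l t) • tensor (box k s) id w

/-! ### The source operator `F` -/

/-- `(lam - n + k)(lam - k + 1) δ d + (lam - n + k + 1)(lam - k) d δ`. -/
def boxT (k : ℕ) (lam : ℂ) (w : Euc n → ExtAlg n) : Euc n → ExtAlg n :=
  ((lam - n + k) * (lam - k + 1)) • codiff (d w)
    + ((lam - n + k + 1) * (lam - k)) • d (codiff w)

/-- `(lam - n + k)(lam - k + 1) ∂_j - (lam - k) ε_j δ - (lam - n + k) d ι_j`. -/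
def gradT (k : ℕ) (lam : ℂ) (j : Fin n) (w : Euc n → ExtAlg n) : Euc n → ExtAlg n :=
  ((lam - n + k) * (lam - k + 1)) • pd j w - (lam - k) • eps j (codiff w)
    - (lam - n + k) • d (iot j w)

/-- The source operator `F_{lam,mu}^{k,l}`, with all multiplications after the differentiations. -/
def opF (k l : ℕ) (lam mu : ℂ) (w : Euc n × Euc n → BiExtAlg n) : Euc n × Euc n → BiExtAlg n :=
  (16 : ℂ) • mulDistSq (tensor (boxT k lam) (boxT l mu) w)
  - (32 : ℂ) • ∑ j, mulDiff j
      ((2 * lam - n + 2) • tensor (gradT k lam j) (boxT l mu) w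
        - (2 * mu - n + 2) • tensor (boxT k lam) (gradT l mu j) w)
  - (32 * (2 * lam - n + 2) * (2 * mu - n + 2)) •
      ∑ j, tensor (gradT k lam j) (gradT l mu j) w
  - (32 * (2 * mu - n + 2) * (mu + 1) * (mu - l) * (mu - n + l)) • tensor (boxT k lam) id w
  - (32 * (2 * lam - n + 2) * (lam + 1) * (lam - k) * (lam - n + k)) • tensor id (boxT l mu) w

/-- `κ_{lam,mu}^{k,l}`, on `ℝⁿ`. -/
def kapF (n k l : ℕ) (lam mu : ℂ) : ℂ :=
  16 * (lam - k + 1) * (lam - n + k + 1) * (mu - l + 1) * (mu - n + l + 1)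

end Forms

end

noncomputable section

namespace Forms

variable {n : ℕ}

/-! ### Clifford relations -/

/-! Write σ = -s-n and let R_σ be the Riesz distribution. On k-forms three identities carry the
convolution statement: R_{σ+2} ∘ Box_{k,s} = κ R_σ, R_{σ+2} ∘ P_{k,s,j} = -κ R_σ ∘ x_j and R_σ ∘
‖x‖² = σ s R_{σ+2}, with κ = κ_{k,s} (`rieszCLM_boxOp`, `rieszCLM_gradOp`, `rieszCLM_sq`). Applied
to u ↦ w(x - u), they become rules for the convolution J_σ: J_{σ+2} Box = κ J_σ, J_{σ+2} P_j = κ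
[x_j, J_σ], and s(s+n) J_{σ+2} = -∑ [x_j, [x_j, J_σ]]. These are the axioms of `RieszRule`. For T =
J_σ ⊗ J_τ and z_j = x_j - y_j one has z_j² T = T z_j² + 2 [z_j, T] z_j + [z_j, [z_j, T]], where the
commutator with z_j is the one with x_j minus the one with y_j. The operator E is built so that the
rules turn (J_{σ+2} ⊗ J_{τ+2}) E into -κκ' times the sum over j of the right-hand side
(`WeylCliffordPair.apply_opEOp`).

The three identities are proved for Re σ > 2, where ∫ ‖x‖^σ ∂_j φ = -σ ∫ ‖x‖^{σ-2} x_j φ, and then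
only the Clifford relations and the degree k matter (`kerOp_boxOp`, `kerOp_gradOp`). Since the
family R_σ without its factor Γ(1 - σ/2) is entire, they extend to all σ. Restoring the factor uses
Γ(1 - σ/2) = -(σ/2) Γ(1 - (σ+2)/2), valid for σ ≠ 0.

That the family is entire is shown by two formulas on overlapping half-planes. For Re σ > -n the
defining integral converges, because the kernel is O(‖x‖^{Re σ}). For Re σ < 0 the kernel is
exchanged for the scalar power ‖x‖^σ (`smul_normInt_sKer`), and the functional equation moves the
integral to the Fourier transform of φ. The only poles then come from Γ(1 - σ/2).

The double pairing makes sense because x ↦ S(w(x, ·)) is Schwartz for every continuous functional S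
and Schwartz w (`applySlice`); this needs R_σ to be continuous on Schwartz forms for each σ.

The equality F = -E is an identity in the algebra generated by coordinates, derivatives and the
operators ε_j, ι_j (`WeylCliffordPair.opFOp_eq`). The differences x_j - y_j are commuted to the
left, and ∑ ε_j ι_j acts as the degree. The Knapp-Stein identity is the convolution identity at s =
n - 2λ, t = n - 2μ rewritten by F = -E. -/

theorem sgn_mul_self (j : Fin n) (I : Finset (Fin n)) : sgn j I * sgn j I = 1 := by
  unfold sgn
  rw [← mul_pow]
  norm_num

theorem sgn_insert {i j : Fin n} {I : Finset (Fin n)} (h : j ∉ I) :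
    sgn i (insert j I) = (if j < i then -1 else 1) * sgn i I := by
  unfold sgn
  rw [Finset.filter_insert]
  split_ifs with hji
  · rw [Finset.card_insert_of_notMem (by simp [h]), pow_succ']
  · simp

theorem sgn_erase {i j : Fin n} {I : Finset (Fin n)} (h : j ∈ I) :
    sgn i (I.erase j) = (if j < i then -1 else 1) * sgn i I := by
  conv_rhs => rw [← Finset.insert_erase h]
  rw [sgn_insert (Finset.notMem_erase j I), ← mul_assoc]
  split_ifs <;> simp

theorem extMul_extMul (i j : Fin n) (w : ExtAlg n) :
    extMul i (extMul j w) = -extMul j (extMul i w) := by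
  funext I
  by_cases hij : i = j
  · subst hij; simp [extMul]
  by_cases hi : i ∈ I
  · by_cases hj : j ∈ I
    · simp only [extMul, hi, hj, Finset.mem_erase, if_true, ne_eq, hij, Ne.symm hij,
        not_false_eq_true, and_self, Pi.neg_apply, sgn_erase hi, sgn_erase hj,
        Finset.erase_right_comm (a := i) (b := j)]
      rcases lt_or_gt_of_ne hij with h | h <;>
      · simp only [h, h.not_gt, if_true, if_false]; ring
    · simp [extMul, hj]
  · simp [extMul, hi]

theorem intMul_intMul (i j : Fin n) (w : ExtAlg n) :
    intMul i (intMul j w) = -intMul j (intMul i w) := by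
  funext I
  by_cases hij : i = j
  · subst hij; simp [intMul]
  by_cases hi : i ∈ I
  · simp [intMul, hi]
  · by_cases hj : j ∈ I
    · simp [intMul, hj]
    · simp only [intMul, hi, hj, Finset.mem_insert, if_false, hij, Ne.symm hij, or_false,
        Pi.neg_apply, sgn_insert hi, sgn_insert hj, Finset.insert_comm j i]
      rcases lt_or_gt_of_ne hij with h | h <;>
      · simp only [h, h.not_gt, if_true, if_false]; ring

theorem intMul_extMul (i j : Fin n) (w : ExtAlg n) :
    intMul i (extMul j w) + extMul j (intMul i w) = if i = j then w else 0 := by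
  funext I
  by_cases hij : i = j
  · subst hij
    by_cases hi : i ∈ I
    · simp [intMul, extMul, hi, sgn_erase hi, ← mul_assoc, sgn_mul_self]
    · simp [intMul, extMul, hi, sgn_insert hi, ← mul_assoc, sgn_mul_self]
  by_cases hi : i ∈ I
  · simp [intMul, extMul, hi, hij]
  by_cases hj : j ∈ I
  · simp only [intMul, extMul, hi, hj, Finset.mem_insert, Finset.mem_erase, if_true, if_false,
      hij, or_true, and_false, Pi.add_apply, Pi.zero_apply]
    rw [Finset.erase_insert_of_ne hij, sgn_insert hi, sgn_erase hj]
    rcases lt_or_gt_of_ne hij with h | h <;>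
    · simp only [h, h.not_gt, if_true, if_false]; ring
  · simp [intMul, extMul, hi, hj, hij, Ne.symm hij]

/-- Each summand projects onto the basis forms that contain e_j. The resulting degree operator turns
homogeneity into an eigenvalue equation, which can be used in the abstract operator algebra. -/
theorem sum_extMul_intMul (w : ExtAlg n) (I : Finset (Fin n)) :
    (∑ j, extMul j (intMul j w)) I = I.card * w I := by
  have h (j : Fin n) : extMul j (intMul j w) I = if j ∈ I then w I else 0 := by
    by_cases hj : j ∈ I
    · simp [intMul, extMul, hj, sgn_erase hj, ← mul_assoc, sgn_mul_self]
    · simp [extMul, hj]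
  simp [Finset.sum_apply, h, Finset.sum_ite_mem]

/-- `extMul` as a continuous linear map. -/
def extL (j : Fin n) : ExtAlg n →L[ℂ] ExtAlg n :=
  LinearMap.toContinuousLinearMap
    { toFun := extMul j
      map_add' := fun v w => by
        funext I; by_cases h : j ∈ I <;> simp [extMul, h, mul_add]
      map_smul' := fun c w => by
        funext I; by_cases h : j ∈ I <;> simp [extMul, h, mul_left_comm] }

/-- `intMul` as a continuous linear map. -/
def intL (j : Fin n) : ExtAlg n →L[ℂ] ExtAlg n :=
  LinearMap.toContinuousLinearMap
    { toFun := intMul j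
      map_add' := fun v w => by
        funext I; by_cases h : j ∈ I <;> simp [intMul, h, mul_add]
      map_smul' := fun c w => by
        funext I; by_cases h : j ∈ I <;> simp [intMul, h, mul_left_comm] }

@[simp] theorem extL_apply (j : Fin n) (w : ExtAlg n) : extL j w = extMul j w := rfl
@[simp] theorem intL_apply (j : Fin n) (w : ExtAlg n) : intL j w = intMul j w := rfl

/-- An endomorphism of `Λ` acting on the first factor of `Λ ⊗ Λ`. -/
def leftL (A : ExtAlg n →L[ℂ] ExtAlg n) : BiExtAlg n →L[ℂ] BiExtAlg n :=
  LinearMap.toContinuousLinearMap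
    { toFun := fun w I J => A (fun I' => w I' J) I
      map_add' := fun v w => by
        funext I J
        exact congrFun (map_add A (fun I' => v I' J) (fun I' => w I' J)) I
      map_smul' := fun c w => by
        funext I J
        exact congrFun (map_smul A c (fun I' => w I' J)) I }

/-- An endomorphism of `Λ` acting on the second factor of `Λ ⊗ Λ`. -/
def rightL (A : ExtAlg n →L[ℂ] ExtAlg n) : BiExtAlg n →L[ℂ] BiExtAlg n :=
  LinearMap.toContinuousLinearMap
    { toFun := fun w I => A (w I)
      map_add' := fun v w => by funext I; exact map_add A (v I) (w I)
      map_smul' := fun c w => by funext I; exact map_smul A c (w I) }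

theorem leftL_apply (A : ExtAlg n →L[ℂ] ExtAlg n) (w : BiExtAlg n) (I J : Finset (Fin n)) :
    leftL A w I J = A (fun I' => w I' J) I := rfl

theorem rightL_apply (A : ExtAlg n →L[ℂ] ExtAlg n) (w : BiExtAlg n) (I : Finset (Fin n)) :
    rightL A w I = A (w I) := rfl

/-- In the basis, the two endomorphisms contract different indices with scalar matrix entries, and
finite sums can be interchanged. -/
theorem leftL_rightL (A B : ExtAlg n →L[ℂ] ExtAlg n) (w : BiExtAlg n) :
    leftL A (rightL B w) = rightL B (leftL A w) := by
  have key (v : ExtAlg n) : v = ∑ I, v I • (Pi.single I 1 : ExtAlg n) := by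
    funext J; simp [Finset.sum_apply, Pi.single_apply]
  funext I J
  simp only [leftL_apply, rightL_apply]
  conv_lhs => rw [key (fun I' => B (w I') J)]
  conv_rhs =>
    rw [show leftL A w I = ∑ I', (A (Pi.single I' 1) I) • w I' by
      funext J
      rw [leftL_apply]
      conv_lhs => rw [key (fun I' => w I' J)]
      simp [map_sum, Finset.sum_apply, mul_comm]]
  simp [map_sum, Finset.sum_apply, mul_comm]

/-! ### The algebra of polynomial differential operators on forms -/

section Abstract

variable {n : ℕ} {M : Type*} [AddCommGroup M] [Module ℂ M]

/-- Operators `X_j`, `P_j`, `e_j`, `f_j` on a vector space that satisfy the relations between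
the coordinates, the partial derivatives, the exterior and the interior multiplications. -/
structure WeylClifford (X P e f : Fin n → M →ₗ[ℂ] M) : Prop where
  X_X : ∀ i j v, X i (X j v) = X j (X i v)
  P_P : ∀ i j v, P i (P j v) = P j (P i v)
  P_X : ∀ i j v, P i (X j v) = X j (P i v) + if i = j then v else 0
  e_X : ∀ i j v, e i (X j v) = X j (e i v)
  f_X : ∀ i j v, f i (X j v) = X j (f i v)
  e_P : ∀ i j v, e i (P j v) = P j (e i v)
  f_P : ∀ i j v, f i (P j v) = P j (f i v)
  e_e : ∀ i j v, e i (e j v) = -e j (e i v)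
  f_f : ∀ i j v, f i (f j v) = -f j (f i v)
  f_e : ∀ i j v, f i (e j v) = -e j (f i v) + if i = j then v else 0

/-- `∑ a_m b_m`. -/
def contract (a b : Fin n → M →ₗ[ℂ] M) : M →ₗ[ℂ] M := ∑ m, a m ∘ₗ b m

theorem contract_apply (a b : Fin n → M →ₗ[ℂ] M) (v : M) :
    contract a b v = ∑ m, a m (b m v) := by
  simp [contract, LinearMap.sum_apply]

/-- The exterior differential. -/
def dOp (P e : Fin n → M →ₗ[ℂ] M) : M →ₗ[ℂ] M := contract e P

/-- The co-differential. -/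
def codOp (P f : Fin n → M →ₗ[ℂ] M) : M →ₗ[ℂ] M := -contract f P

/-- The operator `box`. -/
def boxOp (k : ℕ) (s : ℂ) (P e f : Fin n → M →ₗ[ℂ] M) : M →ₗ[ℂ] M :=
  alpha n k s • (codOp P f ∘ₗ dOp P e) + beta n k s • (dOp P e ∘ₗ codOp P f)

/-- The operator `grad`. -/
def gradOp (k : ℕ) (s : ℂ) (P e f : Fin n → M →ₗ[ℂ] M) (j : Fin n) : M →ₗ[ℂ] M :=
  (s * kap n k s) • P j - gam n k s • (codOp P f ∘ₗ e j) + del n k s • (dOp P e ∘ₗ f j)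

/-- The operator `boxT`. -/
def boxTOp (k : ℕ) (lam : ℂ) (P e f : Fin n → M →ₗ[ℂ] M) : M →ₗ[ℂ] M :=
  ((lam - n + k) * (lam - k + 1)) • (codOp P f ∘ₗ dOp P e)
    + ((lam - n + k + 1) * (lam - k)) • (dOp P e ∘ₗ codOp P f)

/-- The operator `gradT`. -/
def gradTOp (k : ℕ) (lam : ℂ) (P e f : Fin n → M →ₗ[ℂ] M) (j : Fin n) : M →ₗ[ℂ] M :=
  ((lam - n + k) * (lam - k + 1)) • P j - (lam - k) • (e j ∘ₗ codOp P f)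
    - (lam - n + k) • (dOp P e ∘ₗ f j)

theorem boxOp_eq (P e f : Fin n → M →ₗ[ℂ] M) (k : ℕ) (lam : ℂ) (v : M) :
    boxOp k (n - 2 * lam) P e f v = (4 : ℂ) • boxTOp k lam P e f v := by
  simp only [boxOp, boxTOp, alpha, beta, LinearMap.add_apply, LinearMap.smul_apply]
  module

namespace WeylClifford

variable {X P e f : Fin n → M →ₗ[ℂ] M} (W : WeylClifford X P e f)
include W

theorem d_X (j : Fin n) (v : M) : dOp P e (X j v) = X j (dOp P e v) + e j v := by
  simp only [dOp, contract_apply, W.P_X, map_add, W.e_X, Finset.sum_add_distrib, map_sum,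
    apply_ite (e _), map_zero, Finset.sum_ite_eq', Finset.mem_univ, if_true]

theorem cod_X (j : Fin n) (v : M) : codOp P f (X j v) = X j (codOp P f v) - f j v := by
  simp only [codOp, LinearMap.neg_apply, contract_apply, W.P_X, map_add, W.f_X,
    Finset.sum_add_distrib, map_sum, map_neg,
    apply_ite (f _), map_zero, Finset.sum_ite_eq', Finset.mem_univ, if_true]
  abel

theorem f_d (j : Fin n) (v : M) : f j (dOp P e v) = P j v - dOp P e (f j v) := by
  simp only [dOp, contract_apply, map_sum, W.f_e, W.f_P, Finset.sum_add_distrib,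
    Finset.sum_neg_distrib, Finset.sum_ite_eq, Finset.mem_univ, if_true]
  abel

theorem cod_e (j : Fin n) (v : M) : codOp P f (e j v) = -P j v - e j (codOp P f v) := by
  have h (m : Fin n) : f m (P m (e j v)) = -e j (f m (P m v)) + if m = j then P m v else 0 := by
    rw [← W.e_P, W.f_e]
  simp only [codOp, LinearMap.neg_apply, contract_apply, map_sum, map_neg, h,
    Finset.sum_add_distrib, Finset.sum_neg_distrib, Finset.sum_ite_eq', Finset.mem_univ, if_true]
  abel

theorem deg_e (j : Fin n) (v : M) : contract e f (e j v) = e j (contract e f v) + e j v := by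
  simp only [contract_apply, W.f_e, map_add, map_neg, W.e_e _ j, neg_neg, map_sum,
    Finset.sum_add_distrib, apply_ite (e _), map_zero, Finset.sum_ite_eq', Finset.mem_univ, if_true]

theorem deg_f (j : Fin n) (v : M) : contract e f (f j v) = f j (contract e f v) - f j v := by
  simp only [contract_apply, W.f_e, W.f_f _ j, map_neg, map_sum,
    Finset.sum_add_distrib, Finset.sum_neg_distrib, Finset.sum_ite_eq, Finset.mem_univ, if_true]
  abel

theorem deg_P (j : Fin n) (v : M) : contract e f (P j v) = P j (contract e f v) := by
  simp only [contract_apply, W.f_P, W.e_P, map_sum]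

theorem deg_X (j : Fin n) (v : M) : contract e f (X j v) = X j (contract e f v) := by
  simp only [contract_apply, W.f_X, W.e_X, map_sum]

theorem deg_d (v : M) : contract e f (dOp P e v) = dOp P e (contract e f v) + dOp P e v := by
  rw [dOp, contract_apply e P, map_sum]
  simp only [W.deg_e, W.deg_P, Finset.sum_add_distrib, contract_apply e P]

theorem deg_cod (v : M) :
    contract e f (codOp P f v) = codOp P f (contract e f v) - codOp P f v := by
  simp only [codOp, LinearMap.neg_apply, map_neg]
  rw [contract_apply f P, map_sum]
  simp only [W.deg_f, W.deg_P, Finset.sum_sub_distrib, contract_apply f P]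
  abel

theorem sum_f_e (v : M) : contract f e v = (n : ℂ) • v - contract e f v := by
  simp only [contract_apply, W.f_e, Finset.sum_add_distrib, Finset.sum_neg_distrib, if_true,
    Finset.sum_const, Finset.card_univ, Fintype.card_fin]
  rw [← Nat.cast_smul_eq_nsmul ℂ]
  abel

/-- The sources are [d, x_j] = ε_j and [δ, x_j] = -ι_j. The remainder is split into these two pieces
because ε_j δ + d ι_j commutes with x_j, so that a second commutation only meets the gradient. -/
theorem boxTOp_X (k : ℕ) (lam : ℂ) (j : Fin n) (v : M) :
    boxTOp k lam P e f (X j v) = X j (boxTOp k lam P e f v)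
      + ((n - 2 * lam) • (e j (codOp P f v) + dOp P e (f j v))
      - (2 : ℂ) • gradTOp k lam P e f j v) := by
  simp only [boxTOp, gradTOp, LinearMap.add_apply, LinearMap.sub_apply, LinearMap.smul_apply,
    LinearMap.comp_apply, W.d_X, W.cod_X, map_add, map_sub, W.cod_e, W.f_d, map_smul]
  module

theorem gradTOp_X (k : ℕ) (lam : ℂ) (j : Fin n) (v : M) :
    gradTOp k lam P e f j (X j v) = X j (gradTOp k lam P e f j v)
      + (((lam - n + k) * (lam - k + 1)) • v + ((n : ℂ) - 2 * k) • e j (f j v)) := by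
  simp only [gradTOp, LinearMap.sub_apply, LinearMap.smul_apply,
    LinearMap.comp_apply, W.d_X, W.cod_X, map_sub, W.f_X, W.e_X, map_smul, W.P_X, if_true]
  module

/-- The commutator of ε_j δ contributes -ε_j ι_j and that of d ι_j contributes ε_j ι_j. -/
theorem e_cod_add_d_f_X (j : Fin n) (v : M) :
    e j (codOp P f (X j v)) + dOp P e (f j (X j v))
      = X j (e j (codOp P f v) + dOp P e (f j v)) := by
  simp only [W.d_X, W.cod_X, map_add, map_sub, W.f_X, W.e_X]
  abel

theorem gradOp_eq (k : ℕ) (lam : ℂ) (j : Fin n) (v : M) :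
    gradOp k (n - 2 * lam) P e f j v = (4 * (n - 2 * lam)) •
      (gradTOp k lam P e f j v - (e j (codOp P f v) + dOp P e (f j v))) := by
  simp only [gradOp, gradTOp, kap, gam, del, LinearMap.add_apply, LinearMap.sub_apply,
    LinearMap.smul_apply, LinearMap.comp_apply, W.cod_e]
  module

end WeylClifford

variable {N : Type*} [AddCommGroup N] [Module ℂ N]

theorem commute_dOp {P e : Fin n → M →ₗ[ℂ] M} {P' e' : Fin n → N →ₗ[ℂ] N}
    {T : M →ₗ[ℂ] N}
    (hP : ∀ j v, T (P j v) = P' j (T v)) (he : ∀ j v, T (e j v) = e' j (T v)) (v : M) :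
    T (dOp P e v) = dOp P' e' (T v) := by
  simp only [dOp, contract_apply, map_sum, hP, he]

theorem commute_codOp {P f : Fin n → M →ₗ[ℂ] M} {P' f' : Fin n → N →ₗ[ℂ] N}
    {T : M →ₗ[ℂ] N}
    (hP : ∀ j v, T (P j v) = P' j (T v)) (hf : ∀ j v, T (f j v) = f' j (T v)) (v : M) :
    T (codOp P f v) = codOp P' f' (T v) := by
  simp only [codOp, LinearMap.neg_apply, contract_apply, map_neg, map_sum, hP, hf]

theorem commute_boxOp {P e f : Fin n → M →ₗ[ℂ] M} {P' e' f' : Fin n → N →ₗ[ℂ] N}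
    {T : M →ₗ[ℂ] N}
    (hP : ∀ j v, T (P j v) = P' j (T v)) (he : ∀ j v, T (e j v) = e' j (T v))
    (hf : ∀ j v, T (f j v) = f' j (T v)) (k : ℕ) (s : ℂ) (v : M) :
    T (boxOp k s P e f v) = boxOp k s P' e' f' (T v) := by
  simp only [boxOp, LinearMap.add_apply, LinearMap.smul_apply, LinearMap.comp_apply, map_add,
    map_smul, commute_dOp hP he, commute_codOp hP hf]

theorem commute_boxTOp {P e f : Fin n → M →ₗ[ℂ] M} {P' e' f' : Fin n → N →ₗ[ℂ] N}
    {T : M →ₗ[ℂ] N}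
    (hP : ∀ j v, T (P j v) = P' j (T v)) (he : ∀ j v, T (e j v) = e' j (T v))
    (hf : ∀ j v, T (f j v) = f' j (T v)) (k : ℕ) (s : ℂ) (v : M) :
    T (boxTOp k s P e f v) = boxTOp k s P' e' f' (T v) := by
  simp only [boxTOp, LinearMap.add_apply, LinearMap.smul_apply, LinearMap.comp_apply, map_add,
    map_smul, commute_dOp hP he, commute_codOp hP hf]

theorem commute_gradTOp {P e f : Fin n → M →ₗ[ℂ] M} {P' e' f' : Fin n → N →ₗ[ℂ] N}
    {T : M →ₗ[ℂ] N}
    (hP : ∀ j v, T (P j v) = P' j (T v)) (he : ∀ j v, T (e j v) = e' j (T v))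
    (hf : ∀ j v, T (f j v) = f' j (T v)) (k : ℕ) (s : ℂ) (i : Fin n) (v : M) :
    T (gradTOp k s P e f i v) = gradTOp k s P' e' f' i (T v) := by
  simp only [gradTOp, LinearMap.sub_apply, LinearMap.smul_apply, LinearMap.comp_apply, map_sub,
    map_smul, commute_dOp hP he, commute_codOp hP hf, hP, he, hf]

/-- The operators `e_j δ + d f_j`. -/
def mixedOp (P e f : Fin n → M →ₗ[ℂ] M) (j : Fin n) : M →ₗ[ℂ] M :=
  e j ∘ₗ codOp P f + dOp P e ∘ₗ f j

/-- The commutator of `gradTOp` with a coordinate. -/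
def gradTComm (k : ℕ) (lam : ℂ) (e f : Fin n → M →ₗ[ℂ] M) (j : Fin n) : M →ₗ[ℂ] M :=
  ((lam - n + k) * (lam - k + 1)) • LinearMap.id + ((n : ℂ) - 2 * k) • (e j ∘ₗ f j)

/-- The four families of generators as one family. -/
def gens (X P e f : Fin n → M →ₗ[ℂ] M) : Fin 4 → Fin n → M →ₗ[ℂ] M := ![X, P, e, f]

/-- Two commuting families of operators on forms. -/
structure WeylCliffordPair (X P e f X' P' e' f' : Fin n → M →ₗ[ℂ] M) : Prop where
  left : WeylClifford X P e f
  right : WeylClifford X' P' e' f'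
  comm : ∀ a b i j v, gens X P e f a i (gens X' P' e' f' b j v)
    = gens X' P' e' f' b j (gens X P e f a i v)

/-- The operator `opE`. -/
def opEOp (k l : ℕ) (s t : ℂ) (X P e f X' P' e' f' : Fin n → M →ₗ[ℂ] M) (w : M) : M :=
  -boxOp k s P e f (boxOp l t P' e' f' (contract (X - X') (X - X') w))
  - (2 : ℂ) • ∑ j, gradOp k s P e f j (boxOp l t P' e' f' ((X - X') j w))
  + (2 : ℂ) • ∑ j, boxOp k s P e f (gradOp l t P' e' f' j ((X - X') j w))
  + (2 : ℂ) • ∑ j, gradOp k s P e f j (gradOp l t P' e' f' j w)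
  + (s * (s + n) * kap n k s) • boxOp l t P' e' f' w
  + (t * (t + n) * kap n l t) • boxOp k s P e f w

/-- The operator `opF`. -/
def opFOp (k l : ℕ) (lam mu : ℂ) (X P e f X' P' e' f' : Fin n → M →ₗ[ℂ] M) (w : M) : M :=
  (16 : ℂ) • contract (X - X') (X - X') (boxTOp k lam P e f (boxTOp l mu P' e' f' w))
  - (32 : ℂ) • ∑ j, (X - X') j
      ((2 * lam - n + 2) • gradTOp k lam P e f j (boxTOp l mu P' e' f' w)
        - (2 * mu - n + 2) • boxTOp k lam P e f (gradTOp l mu P' e' f' j w))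
  - (32 * (2 * lam - n + 2) * (2 * mu - n + 2)) •
      ∑ j, gradTOp k lam P e f j (gradTOp l mu P' e' f' j w)
  - (32 * (2 * mu - n + 2) * (mu + 1) * (mu - l) * (mu - n + l)) • boxTOp k lam P e f w
  - (32 * (2 * lam - n + 2) * (lam + 1) * (lam - k) * (lam - n + k)) • boxTOp l mu P' e' f' w

/-- The contribution of one coordinate to the comparison of `opE` and `opF`. -/
theorem coordinate_identity (x B G Y H y B' G' Y' H' : M →ₗ[ℂ] M) (s t : ℂ)
    (hB : ∀ v, B (x v) = x (B v) + (s • Y v - (2 : ℂ) • G v))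
    (hG : ∀ v, G (x v) = x (G v) + H v) (hY : ∀ v, Y (x v) = x (Y v))
    (hB' : ∀ v, B' (y v) = y (B' v) + (t • Y' v - (2 : ℂ) • G' v))
    (hG' : ∀ v, G' (y v) = y (G' v) + H' v) (hY' : ∀ v, Y' (y v) = y (Y' v))
    (xy : ∀ v, y (x v) = x (y v)) (By : ∀ v, B (y v) = y (B v)) (Gy : ∀ v, G (y v) = y (G v))
    (Yy : ∀ v, Y (y v) = y (Y v)) (xB : ∀ v, B' (x v) = x (B' v))
    (xG : ∀ v, G' (x v) = x (G' v)) (xY : ∀ v, Y' (x v) = x (Y' v)) (v : M) :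
    -B (B' ((x - y) ((x - y) v))) - (2 * s) • (G - Y) (B' ((x - y) v))
      + (2 * t) • B ((G' - Y') ((x - y) v)) + (2 * s * t) • (G - Y) ((G' - Y') v)
    = -(x - y) ((x - y) (B (B' v)))
      + (2 : ℂ) • (x - y) ((2 - s) • G (B' v) - (2 - t) • B (G' v))
      + (2 * (2 - s) * (2 - t)) • G (G' v) + (2 - 2 * s) • H (B' v) + (2 - 2 * t) • B (H' v) := by
  simp only [LinearMap.sub_apply, map_sub, map_add, map_smul, hB, hG, hY, hB', hG', hY', xy, By,
    Gy, Yy, xB, xG, xY]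
  module

end Abstract

section Abstract

variable {n : ℕ} {M : Type*} [AddCommGroup M] [Module ℂ M]

namespace WeylCliffordPair

variable {X P e f X' P' e' f' : Fin n → M →ₗ[ℂ] M} (W : WeylCliffordPair X P e f X' P' e' f')
include W

theorem symm : WeylCliffordPair X' P' e' f' X P e f :=
  ⟨W.right, W.left, fun a b i j v => (W.comm b a j i v).symm⟩

theorem coordinate (k l : ℕ) (lam mu : ℂ) (j : Fin n) (w : M) :
    -boxTOp k lam P e f (boxTOp l mu P' e' f' ((X j - X' j) ((X j - X' j) w)))
      - (2 * (n - 2 * lam)) • (gradTOp k lam P e f j - mixedOp P e f j)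
        (boxTOp l mu P' e' f' ((X j - X' j) w))
      + (2 * (n - 2 * mu)) • boxTOp k lam P e f
        ((gradTOp l mu P' e' f' j - mixedOp P' e' f' j) ((X j - X' j) w))
      + (2 * (n - 2 * lam) * (n - 2 * mu)) •
        (gradTOp k lam P e f j - mixedOp P e f j)
        ((gradTOp l mu P' e' f' j - mixedOp P' e' f' j) w)
    = -(X j - X' j) ((X j - X' j) (boxTOp k lam P e f (boxTOp l mu P' e' f' w)))
      + (2 : ℂ) • (X j - X' j) ((2 - (n - 2 * lam)) • gradTOp k lam P e f j (boxTOp l mu P' e' f' w)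
        - (2 - (n - 2 * mu)) • boxTOp k lam P e f (gradTOp l mu P' e' f' j w))
      + (2 * (2 - (n - 2 * lam)) * (2 - (n - 2 * mu))) •
        gradTOp k lam P e f j (gradTOp l mu P' e' f' j w)
      + (2 - 2 * (n - 2 * lam)) • gradTComm k lam e f j (boxTOp l mu P' e' f' w)
      + (2 - 2 * (n - 2 * mu)) • boxTOp k lam P e f (gradTComm l mu e' f' j w) := by
  have hP (i : Fin n) (v : M) : X' j (P i v) = P i (X' j v) := (W.comm 1 0 i j v).symm
  have he (i : Fin n) (v : M) : X' j (e i v) = e i (X' j v) := (W.comm 2 0 i j v).symm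
  have hf (i : Fin n) (v : M) : X' j (f i v) = f i (X' j v) := (W.comm 3 0 i j v).symm
  have hP' (i : Fin n) (v : M) : X j (P' i v) = P' i (X j v) := W.comm 0 1 j i v
  have he' (i : Fin n) (v : M) : X j (e' i v) = e' i (X j v) := W.comm 0 2 j i v
  have hf' (i : Fin n) (v : M) : X j (f' i v) = f' i (X j v) := W.comm 0 3 j i v
  refine coordinate_identity (X j) _ _ (mixedOp P e f j) (gradTComm k lam e f j) (X' j) _ _
    (mixedOp P' e' f' j) (gradTComm l mu e' f' j) _ _ (W.left.boxTOp_X k lam j)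
    (W.left.gradTOp_X k lam j) (W.left.e_cod_add_d_f_X j) (W.right.boxTOp_X l mu j)
    (W.right.gradTOp_X l mu j) (W.right.e_cod_add_d_f_X j) (fun v => (W.comm 0 0 j j v).symm)
    (fun v => (commute_boxTOp hP he hf k lam v).symm)
    (fun v => (commute_gradTOp hP he hf k lam j v).symm) (fun v => ?_)
    (fun v => (commute_boxTOp hP' he' hf' l mu v).symm)
    (fun v => (commute_gradTOp hP' he' hf' l mu j v).symm) (fun v => ?_) w
  · simp only [mixedOp, LinearMap.add_apply, LinearMap.comp_apply, map_add, commute_dOp hP he,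
      commute_codOp hP hf, hf, he]
  · simp only [mixedOp, LinearMap.add_apply, LinearMap.comp_apply, map_add, commute_dOp hP' he',
      commute_codOp hP' hf', hf', he']

/-- Summing the one-coordinate identity leaves the zeroth-order commutators of the gradients. On
forms of fixed degree their sums over j are scalars, and these combine with the last two terms of E
to give the last two terms of F. -/
theorem opFOp_eq (k l : ℕ) (lam mu : ℂ) (w : M) (hk : contract e f w = (k : ℂ) • w)
    (hl : contract e' f' w = (l : ℂ) • w) :
    opFOp k l lam mu X P e f X' P' e' f' w
      = -opEOp k l (n - 2 * lam) (n - 2 * mu) X P e f X' P' e' f' w := by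
  have hk' : contract e f (boxTOp l mu P' e' f' w) = (k : ℂ) • boxTOp l mu P' e' f' w := by
    rw [commute_boxTOp (T := contract e f), hk, map_smul]
    · intro j v
      simp only [contract_apply, map_sum]
      exact Finset.sum_congr rfl fun i _ => by
        rw [show f i (P' j v) = P' j (f i v) from W.comm 3 1 i j v]; exact W.comm 2 1 i j _
    · intro j v
      simp only [contract_apply, map_sum]
      exact Finset.sum_congr rfl fun i _ => by
        rw [show f i (e' j v) = e' j (f i v) from W.comm 3 2 i j v]; exact W.comm 2 2 i j _
    · intro j v
      simp only [contract_apply, map_sum]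
      exact Finset.sum_congr rfl fun i _ => by
        rw [show f i (f' j v) = f' j (f i v) from W.comm 3 3 i j v]; exact W.comm 2 3 i j _
  have hsum := Finset.sum_congr (rfl : (Finset.univ : Finset (Fin n)) = Finset.univ)
    fun j _ => W.coordinate k l lam mu j w
  -- The term with e_j f_j sums to the degree operator, hence to the factor k.
  have h1 : ∑ j, gradTComm k lam e f j (boxTOp l mu P' e' f' w)
      = (n * ((lam - n + k) * (lam - k + 1)) + (n - 2 * k) * k) • boxTOp l mu P' e' f' w := by
    simp only [gradTComm, LinearMap.add_apply, LinearMap.smul_apply, LinearMap.id_apply, LinearMap.comp_apply,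
      Finset.sum_add_distrib, ← Finset.smul_sum, ← contract_apply, hk', Finset.sum_const,
      Finset.card_univ, Fintype.card_fin]
    rw [← Nat.cast_smul_eq_nsmul ℂ]
    module
  have h2 : ∑ j, boxTOp k lam P e f (gradTComm l mu e' f' j w)
      = (n * ((mu - n + l) * (mu - l + 1)) + (n - 2 * l) * l) • boxTOp k lam P e f w := by
    rw [← map_sum]
    simp only [gradTComm, LinearMap.add_apply, LinearMap.smul_apply, LinearMap.id_apply, LinearMap.comp_apply,
      Finset.sum_add_distrib, ← Finset.smul_sum, ← contract_apply, hl, Finset.sum_const,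
      Finset.card_univ, Fintype.card_fin]
    rw [← Nat.cast_smul_eq_nsmul ℂ]
    simp only [map_add, map_smul]
    module
  simp only [Finset.sum_add_distrib, Finset.sum_sub_distrib, Finset.sum_neg_distrib,
    ← Finset.smul_sum, h1, h2, map_sub, map_smul] at hsum
  have hG (j : Fin n) (v : M) : gradOp k (n - 2 * lam) P e f j v = (4 * (n - 2 * lam)) •
      (gradTOp k lam P e f j - mixedOp P e f j) v := W.left.gradOp_eq k lam j v
  have hG' (j : Fin n) (v : M) : gradOp l (n - 2 * mu) P' e' f' j v = (4 * (n - 2 * mu)) •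
      (gradTOp l mu P' e' f' j - mixedOp P' e' f' j) v := W.right.gradOp_eq l mu j v
  simp only [opFOp, opEOp, boxOp_eq, hG, hG', contract_apply, Pi.sub_apply, map_sum, map_sub,
    map_smul, Finset.sum_sub_distrib, ← Finset.smul_sum, kap]
  rw [eq_neg_iff_add_eq_zero]
  -- The factor 16 collects one factor 4 from each variable, produced by the substitutions s = n -
  -- 2λ and t = n - 2μ.
  linear_combination (norm := module) (16 : ℂ) • hsum

end WeylCliffordPair
end Abstract

/-! ### Operators on spaces of functions -/

section FunRep

variable {n : ℕ} {E V M : Type*} [NormedAddCommGroup E] [NormedSpace ℝ E]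
  [NormedAddCommGroup V] [NormedSpace ℂ V] [AddCommGroup M] [Module ℂ M]

theorem fderiv_coord_smul {g : E → V} (hg : ContDiff ℝ (⊤ : ℕ∞) g) (ξ : E →L[ℝ] ℝ) (p v : E) :
    fderiv ℝ (fun q => (ξ q : ℂ) • g q) p v = (ξ p : ℂ) • fderiv ℝ g p v + (ξ v : ℂ) • g p := by
  have h1 : HasFDerivAt (fun q => (ξ q : ℂ)) (Complex.ofRealCLM.comp ξ) p :=
    Complex.ofRealCLM.hasFDerivAt.comp p ξ.hasFDerivAt
  have h2 : HasFDerivAt g (fderiv ℝ g p) p :=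
    ((hg.differentiable (by simp)) p).hasFDerivAt
  have h := (h1.smul h2).fderiv
  simp only [Pi.smul_def'] at h
  rw [h]
  simp

theorem fderiv_clm_comp_apply {g : E → V} (hg : ContDiff ℝ (⊤ : ℕ∞) g) (A : V →L[ℂ] V) (p v : E) :
    fderiv ℝ (fun q => A (g q)) p v = A (fderiv ℝ g p v) := by
  have h2 : HasFDerivAt g (fderiv ℝ g p) p :=
    ((hg.differentiable (by simp)) p).hasFDerivAt
  exact congrArg (· v) ((A.restrictScalars ℝ).hasFDerivAt.comp p h2).fderiv

theorem fderiv_fderiv_comm {g : E → V} (hg : ContDiff ℝ (⊤ : ℕ∞) g) (p u v : E) :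
    fderiv ℝ (fun q => fderiv ℝ g q u) p v = fderiv ℝ (fun q => fderiv ℝ g q v) p u := by
  have hd : DifferentiableAt ℝ (fderiv ℝ g) p :=
    (hg.fderiv_right (m := 1) (WithTop.coe_le_coe.2 le_top)).differentiable (by simp) p
  have h (w : E) : fderiv ℝ (fun q => fderiv ℝ g q w) p = (fderiv ℝ (fderiv ℝ g) p).flip w := by
    rw [fderiv_clm_apply hd (differentiableAt_const w)]
    simp
  rw [h, h]
  exact (hg.contDiffAt.isSymmSndFDerivAt
    (by simpa using WithTop.coe_le_coe.2 (le_top (a := (2 : ℕ∞))))).eq v u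

/-- `M` is a space of smooth functions, and `X`, `P`, `e`, `f` are the multiplications with the
coordinates `ξ`, the derivatives in the directions `v` and the pointwise applications of
`A` and `B`. -/
structure FunRep (coe : M →ₗ[ℂ] (E → V)) (ξ : Fin n → E →L[ℝ] ℝ) (v : Fin n → E)
    (A B : Fin n → V →L[ℂ] V) (X P e f : Fin n → M →ₗ[ℂ] M) : Prop where
  inj : Function.Injective coe
  smooth : ∀ w, ContDiff ℝ (⊤ : ℕ∞) (coe w)
  X_apply : ∀ j w p, coe (X j w) p = (ξ j p : ℂ) • coe w p
  P_apply : ∀ j w p, coe (P j w) p = fderiv ℝ (coe w) p (v j)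
  e_apply : ∀ j w p, coe (e j w) p = A j (coe w p)
  f_apply : ∀ j w p, coe (f j w) p = B j (coe w p)

namespace FunRep

variable {coe : M →ₗ[ℂ] (E → V)} {ξ ξ' : Fin n → E →L[ℝ] ℝ} {v v' : Fin n → E}
  {A B A' B' : Fin n → V →L[ℂ] V} {X P e f X' P' e' f' : Fin n → M →ₗ[ℂ] M}
  (R : FunRep coe ξ v A B X P e f) (R' : FunRep coe ξ' v' A' B' X' P' e' f')
include R

theorem coe_X (j : Fin n) (w : M) : coe (X j w) = fun p => (ξ j p : ℂ) • coe w p :=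
  funext (R.X_apply j w)

theorem coe_P (j : Fin n) (w : M) : coe (P j w) = fun p => fderiv ℝ (coe w) p (v j) :=
  funext (R.P_apply j w)

theorem coe_e (j : Fin n) (w : M) : coe (e j w) = fun p => A j (coe w p) :=
  funext (R.e_apply j w)

theorem coe_f (j : Fin n) (w : M) : coe (f j w) = fun p => B j (coe w p) :=
  funext (R.f_apply j w)

theorem ext {w z : M} (h : ∀ p, coe w p = coe z p) : w = z := R.inj (funext h)

/-- Injectivity of `coe` reduces every relation to a pointwise one: the product rule, symmetry of
second derivatives, or a relation between constant matrices. -/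
theorem weylClifford (hξ : ∀ i j, ξ i (v j) = if i = j then 1 else 0)
    (hA : ∀ i j w, A i (A j w) = -A j (A i w)) (hB : ∀ i j w, B i (B j w) = -B j (B i w))
    (hBA : ∀ i j w, B i (A j w) = -A j (B i w) + if i = j then w else 0) :
    WeylClifford X P e f where
  X_X i j w := R.ext fun p => by rw [R.X_apply, R.X_apply, R.X_apply, R.X_apply, smul_comm]
  P_P i j w := R.ext fun p => by
    rw [R.P_apply, R.P_apply, R.coe_P, R.coe_P, fderiv_fderiv_comm (R.smooth w)]
  P_X i j w := R.ext fun p => by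
    rw [map_add, Pi.add_apply, R.P_apply, R.X_apply, R.coe_X, fderiv_coord_smul (R.smooth w),
      R.P_apply, hξ]
    by_cases h : i = j
    · simp [h]
    · simp [h, Ne.symm h]
  e_X i j w := R.ext fun p => by simp only [R.X_apply, R.e_apply, map_smul]
  f_X i j w := R.ext fun p => by simp only [R.X_apply, R.f_apply, map_smul]
  e_P i j w := R.ext fun p => by
    rw [R.e_apply, R.P_apply, R.P_apply, R.coe_e, fderiv_clm_comp_apply (R.smooth w)]
  f_P i j w := R.ext fun p => by
    rw [R.f_apply, R.P_apply, R.P_apply, R.coe_f, fderiv_clm_comp_apply (R.smooth w)]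
  e_e i j w := R.ext fun p => by
    simp only [map_neg, Pi.neg_apply, R.e_apply, hA i j]
  f_f i j w := R.ext fun p => by
    simp only [map_neg, Pi.neg_apply, R.f_apply, hB i j]
  f_e i j w := R.ext fun p => by
    simp only [map_add, map_neg, Pi.neg_apply, Pi.add_apply, R.f_apply, R.e_apply, hBA i j]
    split_ifs <;> simp

include R'

theorem weylCliffordPair (W : WeylClifford X P e f) (W' : WeylClifford X' P' e' f')
    (hξ : ∀ i j, ξ i (v' j) = 0) (hξ' : ∀ i j, ξ' i (v j) = 0)
    (hAA : ∀ i j w, A i (A' j w) = A' j (A i w)) (hAB : ∀ i j w, A i (B' j w) = B' j (A i w))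
    (hBA : ∀ i j w, B i (A' j w) = A' j (B i w)) (hBB : ∀ i j w, B i (B' j w) = B' j (B i w)) :
    WeylCliffordPair X P e f X' P' e' f' where
  left := W
  right := W'
  comm a b i j w := by
    refine R.ext fun p => ?_
    fin_cases a <;> fin_cases b <;>
      simp only [gens, Fin.zero_eta, Fin.mk_one, Fin.reduceFinMk, Matrix.cons_val_zero,
        Matrix.cons_val_one, Matrix.cons_val]
    · rw [R.X_apply, R'.X_apply, R'.X_apply, R.X_apply, smul_comm]
    · rw [R.X_apply, R'.P_apply, R'.P_apply, R.coe_X, fderiv_coord_smul (R.smooth w), hξ]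
      simp
    · simp only [R.X_apply, R'.e_apply, map_smul]
    · simp only [R.X_apply, R'.f_apply, map_smul]
    · rw [R.P_apply, R'.X_apply, R.P_apply, R'.coe_X, fderiv_coord_smul (R.smooth w), hξ']
      simp
    · rw [R.P_apply, R'.P_apply, R.coe_P, R'.coe_P, fderiv_fderiv_comm (R.smooth w)]
    · rw [R.P_apply, R'.e_apply, R.P_apply, R'.coe_e, fderiv_clm_comp_apply (R.smooth w)]
    · rw [R.P_apply, R'.f_apply, R.P_apply, R'.coe_f, fderiv_clm_comp_apply (R.smooth w)]
    · simp only [R.e_apply, R'.X_apply, map_smul]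
    · rw [R.e_apply, R'.P_apply, R'.P_apply, R.coe_e, fderiv_clm_comp_apply (R.smooth w)]
    · simp only [R.e_apply, R'.e_apply, hAA]
    · simp only [R.e_apply, R'.f_apply, hAB]
    · simp only [R.f_apply, R'.X_apply, map_smul]
    · rw [R.f_apply, R'.P_apply, R'.P_apply, R.coe_f, fderiv_clm_comp_apply (R.smooth w)]
    · simp only [R.f_apply, R'.e_apply, hBA]
    · simp only [R.f_apply, R'.f_apply, hBB]

end FunRep

end FunRep

/-! ### The concrete operators in terms of generators -/

section Lift

variable {n : ℕ} {Ω U M : Type*} [AddCommGroup U] [Module ℂ U] [AddCommGroup M] [Module ℂ M]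

/-- Operators on forms. -/
abbrev FormOp (n : ℕ) := (Euc n → ExtAlg n) → Euc n → ExtAlg n

/-- A way to let operators on forms act on other functions. -/
structure IsLift (L : FormOp n → (Ω → U) → Ω → U) : Prop where
  comp : ∀ S T w, L (fun u => S (T u)) w = L S (L T w)
  add : ∀ S T w, L (S + T) w = L S w + L T w
  smul : ∀ (c : ℂ) S w, L (c • S) w = c • L S w
  zero : ∀ w, L 0 w = 0

namespace IsLift

variable {L : FormOp n → (Ω → U) → Ω → U} (h : IsLift L)
include h

theorem neg (S : FormOp n) (w : Ω → U) : L (-S) w = -L S w := by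
  rw [← neg_one_smul ℂ S, h.smul, neg_one_smul]

theorem sub (S T : FormOp n) (w : Ω → U) : L (S - T) w = L S w - L T w := by
  rw [sub_eq_add_neg, h.add, h.neg, sub_eq_add_neg]

theorem sum {ι : Type*} (s : Finset ι) (S : ι → FormOp n) (w : Ω → U) :
    L (∑ i ∈ s, S i) w = ∑ i ∈ s, L (S i) w := by
  classical
  induction s using Finset.induction_on with
  | empty => simp [h.zero]
  | insert a s ha ih => rw [Finset.sum_insert ha, h.add, ih, Finset.sum_insert ha]

end IsLift

/-- The linear operators `P`, `e`, `f` on `M` correspond to derivatives, exterior and interior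
multiplications under `L` and `coe`. -/
structure Implements (L : FormOp n → (Ω → U) → Ω → U) (coe : M →ₗ[ℂ] (Ω → U))
    (P e f : Fin n → M →ₗ[ℂ] M) : Prop where
  lift : IsLift L
  pd : ∀ j w, L (pd j) (coe w) = coe (P j w)
  eps : ∀ j w, L (eps j) (coe w) = coe (e j w)
  iot : ∀ j w, L (iot j) (coe w) = coe (f j w)

namespace Implements

variable {L : FormOp n → (Ω → U) → Ω → U} {coe : M →ₗ[ℂ] (Ω → U)}
  {P e f : Fin n → M →ₗ[ℂ] M} (h : Implements L coe P e f)
include h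

/-- A lift respects sums, scalars and composition of operators, so the differential has to be
presented as a sum of composites of generators before the lift can be pushed inside. -/
theorem d (w : M) : L d (coe w) = coe (dOp P e w) := by
  rw [show (Forms.d : FormOp n) = ∑ m, fun u => Forms.eps m (Forms.pd m u) by
    funext u; simp [Forms.d, Finset.sum_apply]]
  simp only [h.lift.sum, h.lift.comp (Forms.eps _) (Forms.pd _), h.pd, h.eps, dOp, contract_apply,
    map_sum]

theorem codiff (w : M) : L codiff (coe w) = coe (codOp P f w) := by
  rw [show (Forms.codiff : FormOp n) = -∑ m, fun u => Forms.iot m (Forms.pd m u) by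
    funext u; simp [Forms.codiff, Finset.sum_apply]]
  simp only [h.lift.sum, h.lift.neg, h.lift.comp (Forms.iot _) (Forms.pd _), h.pd, h.iot, codOp, contract_apply, map_sum,
    LinearMap.neg_apply, map_neg]

theorem box (k : ℕ) (s : ℂ) (w : M) : L (box k s) (coe w) = coe (boxOp k s P e f w) := by
  rw [show (Forms.box k s : FormOp n) = alpha n k s • (fun u => Forms.codiff (Forms.d u))
    + beta n k s • (fun u => Forms.d (Forms.codiff u)) from rfl]
  simp only [h.lift.add, h.lift.smul, h.lift.comp Forms.d Forms.codiff,
    h.lift.comp Forms.codiff Forms.d, h.d, h.codiff, boxOp, LinearMap.add_apply,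
    LinearMap.smul_apply, LinearMap.comp_apply, map_add, map_smul]

theorem boxT (k : ℕ) (s : ℂ) (w : M) : L (boxT k s) (coe w) = coe (boxTOp k s P e f w) := by
  rw [show (Forms.boxT k s : FormOp n) =
    ((s - n + k) * (s - k + 1)) • (fun u => Forms.codiff (Forms.d u))
    + ((s - n + k + 1) * (s - k)) • (fun u => Forms.d (Forms.codiff u)) from rfl]
  simp only [h.lift.add, h.lift.smul, h.lift.comp Forms.d Forms.codiff,
    h.lift.comp Forms.codiff Forms.d, h.d, h.codiff, boxTOp, LinearMap.add_apply,
    LinearMap.smul_apply, LinearMap.comp_apply, map_add, map_smul]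

theorem grad (k : ℕ) (s : ℂ) (j : Fin n) (w : M) :
    L (grad k s j) (coe w) = coe (gradOp k s P e f j w) := by
  rw [show (Forms.grad k s j : FormOp n) = (s * kap n k s) • Forms.pd j
    - gam n k s • (fun u => Forms.codiff (Forms.eps j u))
    + del n k s • (fun u => Forms.d (Forms.iot j u)) from rfl]
  simp only [h.lift.add, h.lift.sub, h.lift.smul,
    h.lift.comp Forms.codiff (Forms.eps _), h.lift.comp Forms.d (Forms.iot _),
    h.d, h.codiff, h.pd, h.eps, h.iot, gradOp, LinearMap.add_apply, LinearMap.sub_apply,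
    LinearMap.smul_apply, LinearMap.comp_apply, map_add, map_sub, map_smul]

theorem gradT (k : ℕ) (s : ℂ) (j : Fin n) (w : M) :
    L (gradT k s j) (coe w) = coe (gradTOp k s P e f j w) := by
  rw [show (Forms.gradT k s j : FormOp n) = ((s - n + k) * (s - k + 1)) • Forms.pd j
    - (s - k) • (fun u => Forms.eps j (Forms.codiff u))
    - (s - n + k) • (fun u => Forms.d (Forms.iot j u)) from rfl]
  simp only [h.lift.sub, h.lift.smul,
    h.lift.comp (Forms.eps _) Forms.codiff, h.lift.comp Forms.d (Forms.iot _),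
    h.d, h.codiff, h.pd, h.eps, h.iot, gradTOp, LinearMap.sub_apply,
    LinearMap.smul_apply, LinearMap.comp_apply, map_sub, map_smul]

end Implements

theorem isLift_onFst : IsLift (onFst (n := n)) :=
  ⟨fun _ _ _ => rfl, fun _ _ _ => rfl, fun _ _ _ => rfl, fun _ => rfl⟩

theorem isLift_onSnd : IsLift (onSnd (n := n)) :=
  ⟨fun _ _ _ => rfl, fun _ _ _ => rfl, fun _ _ _ => rfl, fun _ => rfl⟩

end Lift

/-! ### Spaces of smooth functions and of Schwartz functions -/

section Spaces

variable {n : ℕ} {E V : Type*} [NormedAddCommGroup E] [NormedSpace ℝ E]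
  [NormedAddCommGroup V] [NormedSpace ℂ V]

variable (E V) in
/-- The space of smooth functions. -/
def smoothFns : Submodule ℂ (E → V) where
  carrier := {w | ContDiff ℝ (⊤ : ℕ∞) w}
  add_mem' := by
    intro v w hv hw
    rw [Set.mem_ofPred_eq] at hv hw ⊢
    exact hv.add hw
  zero_mem' := by
    rw [Set.mem_ofPred_eq]
    exact contDiff_const
  smul_mem' c w hw := by
    rw [Set.mem_ofPred_eq] at hw ⊢
    exact contDiff_const.smul hw

theorem mem_smoothFns_iff {w : E → V} : w ∈ smoothFns E V ↔ ContDiff ℝ (⊤ : ℕ∞) w := by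
  rw [smoothFns, Submodule.mem_mk, AddSubmonoid.mem_mk]
  rfl

theorem contDiff_smoothFns (w : smoothFns E V) : ContDiff ℝ (⊤ : ℕ∞) w.1 :=
  mem_smoothFns_iff.1 w.2

theorem mem_smoothFns {w : E → V} (h : ContDiff ℝ (⊤ : ℕ∞) w) : w ∈ smoothFns E V :=
  mem_smoothFns_iff.2 h

/-- Multiplication of smooth functions with a coordinate. -/
def smoothX (ξ : E →L[ℝ] ℝ) : smoothFns E V →ₗ[ℂ] smoothFns E V where
  toFun w := ⟨fun p => (ξ p : ℂ) • w.1 p, mem_smoothFns <| (Complex.ofRealCLM.comp ξ).contDiff.smul (contDiff_smoothFns w)⟩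
  map_add' _ _ := Subtype.ext (funext fun _ => smul_add _ _ _)
  map_smul' _ _ := Subtype.ext (funext fun _ => smul_comm _ _ _)

/-- The derivative of smooth functions in a direction. -/
def smoothP (v : E) : smoothFns E V →ₗ[ℂ] smoothFns E V where
  toFun w := ⟨fun p => fderiv ℝ w.1 p v,
    mem_smoothFns <| (ContDiff.fderiv_right (contDiff_smoothFns w) (m := (⊤ : ℕ∞)) (by simp)).clm_apply contDiff_const⟩
  map_add' w z := Subtype.ext <| funext fun p => by
    have h := fderiv_add ((contDiff_smoothFns w).differentiable (by simp) p)
      ((contDiff_smoothFns z).differentiable (by simp) p)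
    exact congrArg (· v) h
  map_smul' c w := Subtype.ext <| funext fun p => by
    have h := fderiv_const_smul ((contDiff_smoothFns w).differentiable (by simp) p) c
    exact congrArg (· v) h

/-- The pointwise application of an endomorphism to smooth functions. -/
def smoothA (A : V →L[ℂ] V) : smoothFns E V →ₗ[ℂ] smoothFns E V where
  toFun w := ⟨fun p => A (w.1 p), mem_smoothFns <| (A.restrictScalars ℝ).contDiff.comp (contDiff_smoothFns w)⟩
  map_add' _ _ := Subtype.ext (funext fun _ => map_add A _ _)
  map_smul' _ _ := Subtype.ext (funext fun _ => map_smul A _ _)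

theorem funRep_smooth (ξ : Fin n → E →L[ℝ] ℝ) (v : Fin n → E) (A B : Fin n → V →L[ℂ] V) :
    FunRep (smoothFns E V).subtype ξ v A B (fun j => smoothX (ξ j)) (fun j => smoothP (v j))
      (fun j => smoothA (A j)) (fun j => smoothA (B j)) :=
  ⟨Subtype.val_injective, contDiff_smoothFns, fun _ _ _ => rfl, fun _ _ _ => rfl, fun _ _ _ => rfl,
    fun _ _ _ => rfl⟩

variable (E V) in
/-- Schwartz functions as functions. -/
def schwCoe : 𝓢(E, V) →ₗ[ℂ] (E → V) where
  toFun w := w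
  map_add' _ _ := rfl
  map_smul' _ _ := rfl

theorem hasTemperateGrowth_coord (ξ : E →L[ℝ] ℝ) : (fun p => (ξ p : ℂ)).HasTemperateGrowth :=
  (Complex.ofRealCLM.comp ξ).hasTemperateGrowth

/-- Multiplication of Schwartz functions with a coordinate. -/
def schwX (ξ : E →L[ℝ] ℝ) : 𝓢(E, V) →L[ℂ] 𝓢(E, V) :=
  SchwartzMap.smulLeftCLM V fun p => (ξ p : ℂ)

@[simp] theorem schwX_apply (ξ : E →L[ℝ] ℝ) (w : 𝓢(E, V)) (p : E) :
    schwX ξ w p = (ξ p : ℂ) • w p :=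
  SchwartzMap.smulLeftCLM_apply_apply (hasTemperateGrowth_coord ξ) w p

open LineDeriv in
/-- The derivative of Schwartz functions in a direction. -/
def schwP (v : E) : 𝓢(E, V) →L[ℂ] 𝓢(E, V) := lineDerivOpCLM ℂ 𝓢(E, V) v

@[simp] theorem schwP_apply (v : E) (w : 𝓢(E, V)) (p : E) : schwP v w p = fderiv ℝ w p v := rfl

/-- The pointwise application of an endomorphism to Schwartz functions. -/
def schwA (A : V →L[ℂ] V) : 𝓢(E, V) →L[ℂ] 𝓢(E, V) := SchwartzMap.postcompCLM A

theorem funRep_schwartz (ξ : Fin n → E →L[ℝ] ℝ) (v : Fin n → E) (A B : Fin n → V →L[ℂ] V) :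
    FunRep (schwCoe E V) ξ v A B (fun j => (schwX (ξ j)).toLinearMap)
      (fun j => (schwP (v j)).toLinearMap)
      (fun j => (schwA (A j)).toLinearMap) (fun j => (schwA (B j)).toLinearMap) :=
  ⟨DFunLike.coe_injective, fun w => w.smooth _, fun j w p => schwX_apply (ξ j) w p,
    fun _ _ _ => rfl, fun _ _ _ => rfl, fun _ _ _ => rfl⟩

end Spaces

/-! ### Forms on `ℝⁿ` -/

section Single

variable {n : ℕ}

/-- The coordinate `x_j`. -/
def coord (j : Fin n) : Euc n →L[ℝ] ℝ := EuclideanSpace.proj j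

@[simp] theorem coord_apply (j : Fin n) (x : Euc n) : coord j x = x j := rfl

/-- The basis vector `e_j`. -/
def dir (j : Fin n) : Euc n := EuclideanSpace.single j 1

theorem coord_dir (i j : Fin n) : coord i (dir j) = if i = j then 1 else 0 := by
  simp [dir, PiLp.single_apply]

/-- The space of Schwartz forms. -/
abbrev SForm (n : ℕ) := 𝓢(Euc n, ExtAlg n)

/-- Multiplication with `x_j`. -/
def sX (j : Fin n) : SForm n →ₗ[ℂ] SForm n := (schwX (coord j)).toLinearMap
/-- The partial derivative. -/
def sP (j : Fin n) : SForm n →ₗ[ℂ] SForm n := (schwP (dir j)).toLinearMap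
/-- Exterior multiplication with `e_j`. -/
def sE (j : Fin n) : SForm n →ₗ[ℂ] SForm n := (schwA (extL j)).toLinearMap
/-- Interior multiplication with `e_j`. -/
def sI (j : Fin n) : SForm n →ₗ[ℂ] SForm n := (schwA (intL j)).toLinearMap

theorem funRep_single : FunRep (schwCoe (Euc n) (ExtAlg n)) coord dir extL intL sX sP sE sI :=
  funRep_schwartz coord dir extL intL

theorem weylClifford_single : WeylClifford (sX (n := n)) sP sE sI :=
  funRep_single.weylClifford coord_dir (fun i j w => extMul_extMul i j w)
    (fun i j w => intMul_intMul i j w)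
    (fun i j w => by simp [← intMul_extMul i j w])

end Single

/-! ### Forms on `ℝⁿ × ℝⁿ` -/

section Double

variable {n : ℕ} {M : Type*} [AddCommGroup M] [Module ℂ M]

/-- The coordinate `x_j` on the product. -/
def fstCoord (j : Fin n) : Euc n × Euc n →L[ℝ] ℝ := (coord j).comp (ContinuousLinearMap.fst ℝ _ _)
/-- The coordinate `y_j` on the product. -/
def sndCoord (j : Fin n) : Euc n × Euc n →L[ℝ] ℝ := (coord j).comp (ContinuousLinearMap.snd ℝ _ _)
/-- The basis vector `e_j` of the first factor. -/
def fstDir (j : Fin n) : Euc n × Euc n := (dir j, 0)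
/-- The basis vector `e_j` of the second factor. -/
def sndDir (j : Fin n) : Euc n × Euc n := (0, dir j)

theorem tensor_coe {coe : M →ₗ[ℂ] (Euc n × Euc n → BiExtAlg n)} {S T : FormOp n} {S' T' : M →ₗ[ℂ] M} (hS : ∀ w, onFst S (coe w) = coe (S' w))
    (hT : ∀ w, onSnd T (coe w) = coe (T' w)) (w : M) : tensor S T (coe w) = coe (S' (T' w)) := by
  rw [tensor, hT, hS]

/-- `M` is a space of smooth forms on the product, and the remaining data are the standard
operators on it. -/
structure BiRep (coe : M →ₗ[ℂ] (Euc n × Euc n → BiExtAlg n))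
    (X P e f X' P' e' f' : Fin n → M →ₗ[ℂ] M) : Prop where
  fst : FunRep coe fstCoord fstDir (fun j => leftL (extL j)) (fun j => leftL (intL j)) X P e f
  snd : FunRep coe sndCoord sndDir (fun j => rightL (extL j)) (fun j => rightL (intL j)) X' P' e' f'

namespace BiRep

variable {coe : M →ₗ[ℂ] (Euc n × Euc n → BiExtAlg n)} {X P e f X' P' e' f' : Fin n → M →ₗ[ℂ] M}
  (R : BiRep coe X P e f X' P' e' f')
include R

theorem weylCliffordPair : WeylCliffordPair X P e f X' P' e' f' := by
  refine R.fst.weylCliffordPair R.snd (R.fst.weylClifford ?_ ?_ ?_ ?_)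
    (R.snd.weylClifford ?_ ?_ ?_ ?_) ?_ ?_ (fun _ _ _ => leftL_rightL _ _ _)
    (fun _ _ _ => leftL_rightL _ _ _) (fun _ _ _ => leftL_rightL _ _ _)
    (fun _ _ _ => leftL_rightL _ _ _)
  · exact coord_dir
  · intro i j w
    funext I J
    exact congrFun (extMul_extMul i j fun I' => w I' J) I
  · intro i j w
    funext I J
    exact congrFun (intMul_intMul i j fun I' => w I' J) I
  · intro i j w
    funext I J
    have h := congrFun (intMul_extMul i j fun I' => w I' J) I
    simp only [Pi.add_apply, Pi.neg_apply, leftL_apply, extL_apply, intL_apply] at h ⊢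
    rw [eq_sub_of_add_eq h]
    split_ifs <;> simp <;> ring
  · exact coord_dir
  · intro i j w
    funext I
    exact extMul_extMul i j (w I)
  · intro i j w
    funext I
    exact intMul_intMul i j (w I)
  · intro i j w
    funext I
    have h := intMul_extMul i j (w I)
    simp only [Pi.add_apply, Pi.neg_apply, rightL_apply, extL_apply, intL_apply] at h ⊢
    rw [eq_sub_of_add_eq h]
    split_ifs <;> simp [sub_eq_neg_add]
  · intro i j; simp [fstCoord, sndDir]
  · intro i j; simp [sndCoord, fstDir]

theorem implements_fst : Implements onFst coe P e f where
  lift := isLift_onFst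
  pd j w := by
    funext p I J
    rw [R.fst.P_apply]
    have h2 := ((R.fst.smooth w).differentiable (by simp) p).hasFDerivAt
    -- Fixing the second index of a value is a linear map, and fixing y is an affine map, so the
    -- partial derivative follows from the chain rule.
    let L : BiExtAlg n →L[ℝ] ExtAlg n :=
      ContinuousLinearMap.pi fun I' => (ContinuousLinearMap.proj J).comp
        (ContinuousLinearMap.proj (R := ℝ) (φ := fun _ : Finset (Fin n) => ExtAlg n) I')
    have h3 : HasFDerivAt (fun x : Euc n => (x, p.2)) (ContinuousLinearMap.inl ℝ (Euc n) (Euc n)) p.1 :=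
      hasFDerivAt_prodMk_left p.1 p.2
    have h := (L.hasFDerivAt.comp p h2).comp p.1 h3
    exact congrArg (fun T : Euc n →L[ℝ] ExtAlg n => T (EuclideanSpace.single j 1) I) h.fderiv
  eps j w := by
    funext p I J
    rw [R.fst.e_apply]; rfl
  iot j w := by
    funext p I J
    rw [R.fst.f_apply]; rfl

theorem implements_snd : Implements onSnd coe P' e' f' where
  lift := isLift_onSnd
  pd j w := by
    funext p I J
    rw [R.snd.P_apply]
    have h2 := ((R.fst.smooth w).differentiable (by simp) p).hasFDerivAt
    let L : BiExtAlg n →L[ℝ] ExtAlg n :=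
      ContinuousLinearMap.proj (R := ℝ) (φ := fun _ : Finset (Fin n) => ExtAlg n) I
    have h3 : HasFDerivAt (fun y : Euc n => (p.1, y)) (ContinuousLinearMap.inr ℝ (Euc n) (Euc n)) p.2 :=
      hasFDerivAt_prodMk_right p.1 p.2
    have h := (L.hasFDerivAt.comp p h2).comp p.2 h3
    exact congrArg (fun T : Euc n →L[ℝ] ExtAlg n => T (EuclideanSpace.single j 1) J) h.fderiv
  eps j w := by
    funext p I J
    rw [R.snd.e_apply]; rfl
  iot j w := by
    funext p I J
    rw [R.snd.f_apply]; rfl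

theorem mulDiff (j : Fin n) (w : M) : mulDiff j (coe w) = coe ((X - X') j w) := by
  funext p
  simp only [Forms.mulDiff, Pi.sub_apply, LinearMap.sub_apply, map_sub, R.fst.X_apply,
    R.snd.X_apply, ← sub_smul]
  simp [fstCoord, sndCoord]

theorem mulDistSq (w : M) : mulDistSq (coe w) = coe (contract (X - X') (X - X') w) := by
  funext p
  simp only [contract_apply, map_sum, ← R.mulDiff, Finset.sum_apply, Forms.mulDiff, smul_smul,
    ← Finset.sum_smul, Forms.mulDistSq]
  congr 1
  rw [EuclideanSpace.norm_sq_eq]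
  push_cast
  refine Finset.sum_congr rfl fun j _ => ?_
  rw [← Complex.ofReal_pow, Real.norm_eq_abs, sq_abs]
  simp [sq]

theorem opE_coe (k l : ℕ) (s t : ℂ) (w : M) :
    opE k l s t (coe w) = coe (opEOp k l s t X P e f X' P' e' f' w) := by
  have h1 := R.implements_fst
  have h2 := R.implements_snd
  have i1 (w : M) : onFst (fun u => u) (coe w) = coe ((LinearMap.id : M →ₗ[ℂ] M) w) := rfl
  have i2 (w : M) : onSnd (fun u => u) (coe w) = coe ((LinearMap.id : M →ₗ[ℂ] M) w) := rfl
  have e1 : tensor id (box l t) (coe w) = coe (boxOp l t P' e' f' w) :=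
    tensor_coe i1 (h2.box l t) w
  have e2 : tensor (box k s) id (coe w) = coe (boxOp k s P e f w) :=
    tensor_coe (h1.box k s) i2 w
  simp only [opE, opEOp, R.mulDistSq, R.mulDiff, e1, e2, tensor_coe (h1.box k s) (h2.box l t),
    tensor_coe (h1.grad k s _) (h2.box l t), tensor_coe (h1.box k s) (h2.grad l t _),
    tensor_coe (h1.grad k s _) (h2.grad l t _), map_add, map_sub, map_neg, map_smul, map_sum]

theorem opF_coe (k l : ℕ) (lam mu : ℂ) (w : M) :
    opF k l lam mu (coe w) = coe (opFOp k l lam mu X P e f X' P' e' f' w) := by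
  have h1 := R.implements_fst
  have h2 := R.implements_snd
  have i1 (w : M) : onFst (fun u => u) (coe w) = coe ((LinearMap.id : M →ₗ[ℂ] M) w) := rfl
  have i2 (w : M) : onSnd (fun u => u) (coe w) = coe ((LinearMap.id : M →ₗ[ℂ] M) w) := rfl
  have e1 : tensor id (boxT l mu) (coe w) = coe (boxTOp l mu P' e' f' w) :=
    tensor_coe i1 (h2.boxT l mu) w
  have e2 : tensor (boxT k lam) id (coe w) = coe (boxTOp k lam P e f w) :=
    tensor_coe (h1.boxT k lam) i2 w
  simp only [opF, opFOp, e1, e2, tensor_coe (h1.boxT k lam) (h2.boxT l mu),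
    tensor_coe (h1.gradT k lam _) (h2.boxT l mu), tensor_coe (h1.boxT k lam) (h2.gradT l mu _),
    tensor_coe (h1.gradT k lam _) (h2.gradT l mu _), ← map_smul, ← map_sub, R.mulDistSq,
    R.mulDiff, ← map_sum]

theorem contract_apply_fst (w : M) (p : Euc n × Euc n) (I J : Finset (Fin n)) :
    coe (contract e f w) p I J = I.card * coe w p I J := by
  rw [← sum_extMul_intMul (fun I' => coe w p I' J) I]
  simp only [contract_apply, map_sum, Finset.sum_apply, R.fst.e_apply, R.fst.f_apply]
  rfl

theorem contract_apply_snd (w : M) (p : Euc n × Euc n) (I J : Finset (Fin n)) :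
    coe (contract e' f' w) p I J = J.card * coe w p I J := by
  rw [← sum_extMul_intMul (coe w p I) J]
  simp only [contract_apply, map_sum, Finset.sum_apply, R.snd.e_apply, R.snd.f_apply]
  rfl

/-- The two degree operators are diagonal in the basis e_I ⊗ e_J, with eigenvalues |I| and |J|. -/
theorem hasBidegree_iff (k l : ℕ) (w : M) : HasBidegree k l (coe w) ↔
    contract e f w = (k : ℂ) • w ∧ contract e' f' w = (l : ℂ) • w := by
  constructor
  · intro h
    refine ⟨R.fst.ext fun p => funext fun I => funext fun J => ?_,
      R.fst.ext fun p => funext fun I => funext fun J => ?_⟩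
    · rw [R.contract_apply_fst, map_smul]
      by_cases hI : I.card = k
      · simp [hI]
      · simp [h p I J (by tauto)]
    · rw [R.contract_apply_snd, map_smul]
      by_cases hJ : J.card = l
      · simp [hJ]
      · simp [h p I J (by tauto)]
  · rintro ⟨h1, h2⟩ p I J hIJ
    have e1 := R.contract_apply_fst w p I J
    have e2 := R.contract_apply_snd w p I J
    rw [h1, map_smul, Pi.smul_apply, Pi.smul_apply, Pi.smul_apply, smul_eq_mul, mul_eq_mul_right_iff,
      Nat.cast_inj] at e1
    rw [h2, map_smul, Pi.smul_apply, Pi.smul_apply, Pi.smul_apply, smul_eq_mul, mul_eq_mul_right_iff,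
      Nat.cast_inj] at e2
    tauto

end BiRep

end Double

/-! ### Preservation of the bidegree, and the operators on smooth and Schwartz forms -/

section Degree

variable {n : ℕ} {M : Type*} [AddCommGroup M] [Module ℂ M]

variable {N : Type*} [AddCommGroup N] [Module ℂ N]

theorem commute_gradOp {P e f : Fin n → M →ₗ[ℂ] M} {P' e' f' : Fin n → N →ₗ[ℂ] N}
    {T : M →ₗ[ℂ] N}
    (hP : ∀ j v, T (P j v) = P' j (T v)) (he : ∀ j v, T (e j v) = e' j (T v))
    (hf : ∀ j v, T (f j v) = f' j (T v)) (k : ℕ) (s : ℂ) (i : Fin n) (v : M) :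
    T (gradOp k s P e f i v) = gradOp k s P' e' f' i (T v) := by
  simp only [gradOp, LinearMap.add_apply, LinearMap.sub_apply, LinearMap.smul_apply,
    LinearMap.comp_apply, map_add, map_sub,
    map_smul, commute_dOp hP he, commute_codOp hP hf, hP, he, hf]

/-- The differential raises the degree by one and the co-differential lowers it by one; each summand
contains both. -/
theorem WeylClifford.deg_boxOp {X P e f : Fin n → M →ₗ[ℂ] M} (W : WeylClifford X P e f)
    (k : ℕ) (s : ℂ) (v : M) :
    contract e f (boxOp k s P e f v) = boxOp k s P e f (contract e f v) := by
  simp only [boxOp, LinearMap.add_apply, LinearMap.smul_apply, LinearMap.comp_apply, map_add,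
    map_smul, W.deg_d, W.deg_cod, map_sub]
  module

theorem WeylClifford.deg_gradOp {X P e f : Fin n → M →ₗ[ℂ] M} (W : WeylClifford X P e f)
    (k : ℕ) (s : ℂ) (j : Fin n) (v : M) :
    contract e f (gradOp k s P e f j v) = gradOp k s P e f j (contract e f v) := by
  simp only [gradOp, LinearMap.add_apply, LinearMap.sub_apply, LinearMap.smul_apply,
    LinearMap.comp_apply, map_add,
    map_smul, W.deg_d, W.deg_cod, W.deg_e, W.deg_f, W.deg_P, map_sub]
  module

namespace WeylCliffordPair

variable {X P e f X' P' e' f' : Fin n → M →ₗ[ℂ] M} (W : WeylCliffordPair X P e f X' P' e' f')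
include W

/-- Operators that commute with the generators of one family commute with its degree operator. -/
theorem deg_gens (b : Fin 4) (j : Fin n) (v : M) :
    contract e f (gens X' P' e' f' b j v) = gens X' P' e' f' b j (contract e f v) := by
  simp only [contract_apply, map_sum]
  refine Finset.sum_congr rfl fun i _ => ?_
  rw [show f i (gens X' P' e' f' b j v) = gens X' P' e' f' b j (f i v) from W.comm 3 b i j v]
  exact W.comm 2 b i j _

theorem deg_opEOp {w : M} {c : ℂ} (hw : contract e f w = c • w) (k l : ℕ) (s t : ℂ) :
    contract e f (opEOp k l s t X P e f X' P' e' f' w)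
      = c • opEOp k l s t X P e f X' P' e' f' w := by
  have hX := W.deg_gens 0
  have hP := W.deg_gens 1
  have he := W.deg_gens 2
  have hf := W.deg_gens 3
  simp only [gens, Matrix.cons_val_zero, Matrix.cons_val_one, Matrix.cons_val] at hX hP he hf
  simp only [opEOp, contract_apply (X - X'), Pi.sub_apply, LinearMap.sub_apply, map_sum, map_add,
    map_sub, map_neg, map_smul,
    W.left.deg_boxOp, W.left.deg_gradOp, commute_boxOp hP he hf, commute_gradOp hP he hf,
    W.left.deg_X, hX, hw, ← Finset.smul_sum, Finset.sum_sub_distrib]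
  module

theorem deg_opEOp' {w : M} {c : ℂ} (hw : contract e' f' w = c • w) (k l : ℕ) (s t : ℂ) :
    contract e' f' (opEOp k l s t X P e f X' P' e' f' w)
      = c • opEOp k l s t X P e f X' P' e' f' w := by
  have hX := W.symm.deg_gens 0
  have hP := W.symm.deg_gens 1
  have he := W.symm.deg_gens 2
  have hf := W.symm.deg_gens 3
  simp only [gens, Matrix.cons_val_zero, Matrix.cons_val_one, Matrix.cons_val] at hX hP he hf
  simp only [opEOp, contract_apply (X - X'), Pi.sub_apply, LinearMap.sub_apply, map_sum, map_add,
    map_sub, map_neg, map_smul,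
    W.right.deg_boxOp, W.right.deg_gradOp, commute_boxOp hP he hf, commute_gradOp hP he hf,
    W.right.deg_X, hX, hw, ← Finset.smul_sum, Finset.sum_sub_distrib]
  module

end WeylCliffordPair

namespace BiRep

variable {coe : M →ₗ[ℂ] (Euc n × Euc n → BiExtAlg n)} {X P e f X' P' e' f' : Fin n → M →ₗ[ℂ] M}
  (R : BiRep coe X P e f X' P' e' f')
include R

theorem hasBidegree_opEOp {k l : ℕ} {w : M} (hw : HasBidegree k l (coe w)) (s t : ℂ) :
    HasBidegree k l (coe (opEOp k l s t X P e f X' P' e' f' w)) := by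
  rw [R.hasBidegree_iff] at hw ⊢
  exact ⟨R.weylCliffordPair.deg_opEOp hw.1 k l s t, R.weylCliffordPair.deg_opEOp' hw.2 k l s t⟩

theorem opF_eq {k l : ℕ} {w : M} (hw : HasBidegree k l (coe w)) (lam mu : ℂ) :
    opF k l lam mu (coe w) = -opE k l (n - 2 * lam) (n - 2 * mu) (coe w) := by
  rw [R.opF_coe, R.opE_coe]
  rw [R.hasBidegree_iff] at hw
  rw [R.weylCliffordPair.opFOp_eq k l lam mu w hw.1 hw.2, map_neg]

end BiRep

theorem biRep_smooth : BiRep (smoothFns (Euc n × Euc n) (BiExtAlg n)).subtype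
    (fun j => smoothX (fstCoord j)) (fun j => smoothP (fstDir j)) (fun j => smoothA (leftL (extL j)))
    (fun j => smoothA (leftL (intL j)))
    (fun j => smoothX (sndCoord j)) (fun j => smoothP (sndDir j)) (fun j => smoothA (rightL (extL j)))
    (fun j => smoothA (rightL (intL j))) :=
  ⟨funRep_smooth _ _ _ _, funRep_smooth _ _ _ _⟩

theorem HasBidegree.neg {k l : ℕ} {w : Euc n × Euc n → BiExtAlg n} (hw : HasBidegree k l w) :
    HasBidegree k l (-w) := fun p I J h => by simp [hw p I J h]

theorem opF_smooth {k l : ℕ} (lam mu : ℂ) {w : Euc n × Euc n → BiExtAlg n}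
    (hw : ContDiff ℝ (⊤ : ℕ∞) w) (hkl : HasBidegree k l w) :
    ContDiff ℝ (⊤ : ℕ∞) (opF k l lam mu w) ∧ HasBidegree k l (opF k l lam mu w) ∧
      opF k l lam mu w = -opE k l (n - 2 * lam) (n - 2 * mu) w := by
  let v : smoothFns (Euc n × Euc n) (BiExtAlg n) := ⟨w, mem_smoothFns hw⟩
  have h : opF k l lam mu w = -opE k l (n - 2 * lam) (n - 2 * mu) w :=
    biRep_smooth.opF_eq (w := v) hkl lam mu
  refine ⟨?_, ?_, h⟩
  · rw [show opF k l lam mu w = _ from biRep_smooth.opF_coe k l lam mu v]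
    exact contDiff_smoothFns _
  · rw [h, show opE k l _ _ w = _ from biRep_smooth.opE_coe k l _ _ v]
    exact (biRep_smooth.hasBidegree_opEOp (w := v) hkl _ _).neg

/-- The space of Schwartz forms on the product. -/
abbrev SBiForm (n : ℕ) := 𝓢(Euc n × Euc n, BiExtAlg n)

/-- Multiplication with `x_j`. -/
def bX (j : Fin n) : SBiForm n →ₗ[ℂ] SBiForm n := (schwX (fstCoord j)).toLinearMap
/-- The partial derivative in `x_j`. -/
def bP (j : Fin n) : SBiForm n →ₗ[ℂ] SBiForm n := (schwP (fstDir j)).toLinearMap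
/-- Exterior multiplication on the first factor. -/
def bE (j : Fin n) : SBiForm n →ₗ[ℂ] SBiForm n := (schwA (leftL (extL j))).toLinearMap
/-- Interior multiplication on the first factor. -/
def bI (j : Fin n) : SBiForm n →ₗ[ℂ] SBiForm n := (schwA (leftL (intL j))).toLinearMap
/-- Multiplication with `y_j`. -/
def cX (j : Fin n) : SBiForm n →ₗ[ℂ] SBiForm n := (schwX (sndCoord j)).toLinearMap
/-- The partial derivative in `y_j`. -/
def cP (j : Fin n) : SBiForm n →ₗ[ℂ] SBiForm n := (schwP (sndDir j)).toLinearMap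
/-- Exterior multiplication on the second factor. -/
def cE (j : Fin n) : SBiForm n →ₗ[ℂ] SBiForm n := (schwA (rightL (extL j))).toLinearMap
/-- Interior multiplication on the second factor. -/
def cI (j : Fin n) : SBiForm n →ₗ[ℂ] SBiForm n := (schwA (rightL (intL j))).toLinearMap

theorem biRep_schwartz :
    BiRep (schwCoe (Euc n × Euc n) (BiExtAlg n)) bX bP bE bI cX cP cE cI :=
  ⟨funRep_schwartz _ _ _ _, funRep_schwartz _ _ _ _⟩

/-- The operator `opE` on Schwartz forms. -/
def sOpE (k l : ℕ) (s t : ℂ) (w : SBiForm n) : SBiForm n :=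
  opEOp k l s t bX bP bE bI cX cP cE cI w

theorem opE_schwartz (k l : ℕ) (s t : ℂ) (w : SBiForm n) : opE k l s t w = sOpE k l s t w :=
  biRep_schwartz.opE_coe k l s t w

end Degree

/-! ### Integrals against powers of the norm -/

section Zeta

open MeasureTheory Set

variable {n : ℕ} {V W : Type*} [NormedAddCommGroup V] [NormedSpace ℂ V]
  [NormedAddCommGroup W] [NormedSpace ℂ W]

/-- Split at 1: the integrand is at most y^r near the origin and at most y^(r - b) at infinity. -/
theorem integrableOn_rpow_mul_one_add_rpow {r b : ℝ} (hr : -1 < r) (hb : r + 1 < b) :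
    IntegrableOn (fun y : ℝ => y ^ r * (1 + y) ^ (-b)) (Ioi 0) := by
  have hm : Measurable fun y : ℝ => y ^ r * (1 + y) ^ (-b) := by fun_prop
  rw [← Ioc_union_Ioi_eq_Ioi zero_le_one]
  refine IntegrableOn.union ?_ ?_
  · have h := (intervalIntegral.intervalIntegrable_rpow' (a := 0) (b := 1) hr).1
    refine Integrable.mono' h hm.aestronglyMeasurable ?_
    filter_upwards [ae_restrict_mem measurableSet_Ioc] with y hy
    have h1 : (1 + y) ^ (-b) ≤ 1 := Real.rpow_le_one_of_one_le_of_nonpos (by linarith [hy.1])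
      (by linarith)
    have h2 : 0 ≤ y ^ r := Real.rpow_nonneg hy.1.le _
    have h3 : 0 ≤ (1 + y) ^ (-b) := Real.rpow_nonneg (by linarith [hy.1]) _
    rw [Real.norm_of_nonneg (mul_nonneg h2 h3)]
    nlinarith
  · have h := integrableOn_Ioi_rpow_of_lt (a := r - b) (c := 1) (by linarith) one_pos
    refine Integrable.mono' h hm.aestronglyMeasurable ?_
    filter_upwards [ae_restrict_mem measurableSet_Ioi] with y hy
    have hy' : (0 : ℝ) < y := lt_trans one_pos hy
    have h1 : (1 + y) ^ (-b) ≤ y ^ (-b) :=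
      Real.rpow_le_rpow_of_nonpos hy' (by linarith) (by linarith)
    have h2 : 0 ≤ y ^ r := Real.rpow_nonneg hy'.le _
    have h3 : 0 ≤ (1 + y) ^ (-b) := Real.rpow_nonneg (by linarith) _
    rw [Real.norm_of_nonneg (mul_nonneg h2 h3), sub_eq_add_neg, Real.rpow_add hy']
    gcongr

/-- Polar coordinates contribute y^(n-1), so the one-dimensional criterion is used with exponent r +
n - 1. -/
theorem integrable_norm_rpow_mul_one_add_norm_rpow [NeZero n] {r b : ℝ} (hr : -(n : ℝ) < r)
    (hb : r + n < b) : Integrable fun x : Euc n => ‖x‖ ^ r * (1 + ‖x‖) ^ (-b) := by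
  have h1 : 1 ≤ n := Nat.one_le_iff_ne_zero.2 (NeZero.ne n)
  have : Nontrivial (Euc n) := inferInstance
  rw [integrable_fun_norm_addHaar (volume : Measure (Euc n)) (f := fun y : ℝ => y ^ r * (1 + y) ^ (-b))]
  refine IntegrableOn.congr_fun (integrableOn_rpow_mul_one_add_rpow (r := r + n - 1) (b := b)
    (by linarith) (by linarith)) ?_ measurableSet_Ioi
  intro y hy
  simp only [smul_eq_mul, finrank_euclideanSpace, Fintype.card_fin]
  rw [← mul_assoc, ← Real.rpow_natCast, ← Real.rpow_add hy]
  congr 2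
  push_cast [h1]
  ring

theorem ae_norm_pos [NeZero n] : ∀ᵐ x : Euc n, 0 < ‖x‖ := by
  have : Nontrivial (Euc n) := inferInstance
  filter_upwards [Measure.ae_ne (volume : Measure (Euc n)) 0] with x hx using norm_pos_iff.2 hx

/-- A bound for the values of a Schwartz function. -/
theorem norm_schwartz_le (b : ℕ) : ∃ C : ℝ, 0 ≤ C ∧ ∀ (φ : 𝓢(Euc n, V)) (x : Euc n),
    ‖φ x‖ ≤ C * (Finset.Iic (b, 0)).sup (schwartzSeminormFamily ℂ (Euc n) V) φ
      * (1 + ‖x‖) ^ (-(b : ℝ)) := by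
  refine ⟨2 ^ b, by positivity, fun φ x => ?_⟩
  have h := SchwartzMap.one_add_le_sup_seminorm_apply (𝕜 := ℂ) (m := (b, 0)) (k := b) (n := 0)
    le_rfl le_rfl φ x
  rw [norm_iteratedFDeriv_zero] at h
  have hp : 0 < (1 + ‖x‖) ^ b := by positivity
  rw [Real.rpow_neg (by positivity), Real.rpow_natCast, ← div_eq_mul_inv, le_div_iff₀ hp, mul_comm]
  exact h

theorem integrable_norm_rpow_mul_norm [NeZero n] {r : ℝ} (hr : -(n : ℝ) < r) (φ : 𝓢(Euc n, V)) :
    Integrable fun x => ‖x‖ ^ r * ‖φ x‖ := by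
  obtain ⟨b, hb⟩ := exists_nat_gt (r + n)
  obtain ⟨C, -, hC⟩ := norm_schwartz_le (n := n) (V := V) b
  refine ((integrable_norm_rpow_mul_one_add_norm_rpow hr hb).const_mul
    (C * (Finset.Iic (b, 0)).sup (schwartzSeminormFamily ℂ (Euc n) V) φ)).mono' ?_ ?_
  · exact (by fun_prop : Measurable fun x : Euc n => ‖x‖ ^ r).aestronglyMeasurable.mul
      φ.continuous.norm.aestronglyMeasurable
  · refine Filter.Eventually.of_forall fun x => ?_
    rw [Real.norm_of_nonneg (by positivity)]
    calc ‖x‖ ^ r * ‖φ x‖ ≤ ‖x‖ ^ r * _ := mul_le_mul_of_nonneg_left (hC φ x) (by positivity)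
      _ = _ := by ring

/-- Integration against a kernel with a singularity at the origin. -/
theorem exists_kernelCLM [NeZero n] {r : ℝ} (hr : -(n : ℝ) < r) {C : ℝ}
    (K : Euc n → V →L[ℂ] W) (hK : AEStronglyMeasurable K volume)
    (hb : ∀ x, x ≠ 0 → ‖K x‖ ≤ C * ‖x‖ ^ r) :
    (∀ φ : 𝓢(Euc n, V), Integrable fun x => K x (φ x)) ∧
      ∃ T : 𝓢(Euc n, V) →L[ℂ] W, ∀ φ, T φ = ∫ x, K x (φ x) := by
  have hle (φ : 𝓢(Euc n, V)) : ∀ᵐ x, ‖K x (φ x)‖ ≤ |C| * (‖x‖ ^ r * ‖φ x‖) := by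
    filter_upwards [ae_norm_pos (n := n)] with x hx
    refine (K x).le_opNorm_of_le le_rfl |>.trans ?_
    have h1 := (hb x (norm_pos_iff.1 hx)).trans
      (mul_le_mul_of_nonneg_right (le_abs_self C) (by positivity))
    nlinarith [norm_nonneg (φ x)]
  have hint (φ : 𝓢(Euc n, V)) : Integrable fun x => K x (φ x) :=
    ((integrable_norm_rpow_mul_norm hr φ).const_mul |C|).mono'
      ((ContinuousLinearMap.id ℂ (V →L[ℂ] W)).aestronglyMeasurable_comp₂ hK
        φ.continuous.aestronglyMeasurable) (hle φ)
  refine ⟨hint, ?_⟩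
  obtain ⟨b, hrb⟩ := exists_nat_gt (r + n)
  obtain ⟨C', hC', hC⟩ := norm_schwartz_le (n := n) (V := V) b
  have hw := integrable_norm_rpow_mul_one_add_norm_rpow hr hrb
  have hI : 0 ≤ ∫ x : Euc n, ‖x‖ ^ r * (1 + ‖x‖) ^ (-(b : ℝ)) :=
    integral_nonneg fun x => by positivity
  refine ⟨SchwartzMap.mkCLMtoNormedSpace (fun φ => ∫ x, K x (φ x)) (fun φ ψ => ?_) (fun c φ => ?_)
    ⟨Finset.Iic (b, 0), |C| * C' * ∫ x : Euc n, ‖x‖ ^ r * (1 + ‖x‖) ^ (-(b : ℝ)), by positivity,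
      fun φ => ?_⟩, fun φ => rfl⟩
  · rw [← integral_add (hint φ) (hint ψ)]
    simp
  · rw [← integral_smul]
    simp
  · refine (norm_integral_le_of_norm_le (((hw.const_mul
      (|C| * (C' * (Finset.Iic (b, 0)).sup (schwartzSeminormFamily ℂ (Euc n) V) φ)))))
      ?_).trans_eq ?_
    · filter_upwards [hle φ] with x hx
      refine hx.trans ?_
      rw [mul_assoc]
      refine mul_le_mul_of_nonneg_left ?_ (abs_nonneg C)
      calc ‖x‖ ^ r * ‖φ x‖ ≤ ‖x‖ ^ r * _ := mul_le_mul_of_nonneg_left (hC φ x) (by positivity)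
        _ = _ := by ring
    · rw [integral_const_mul]
      ring

theorem abs_log_le_rpow_add_rpow {y ε : ℝ} (hy : 0 < y) (hε : 0 < ε) :
    |Real.log y| ≤ (y ^ ε + y ^ (-ε)) / ε := by
  have h1 := Real.log_le_rpow_div hy.le hε
  have h2 := Real.log_le_rpow_div (inv_pos.2 hy).le hε
  rw [Real.log_inv, Real.inv_rpow hy.le, ← Real.rpow_neg hy.le] at h2
  have h3 : 0 ≤ y ^ ε / ε := by positivity
  have h4 : 0 ≤ y ^ (-ε) / ε := by positivity
  rw [add_div, abs_le]
  constructor <;> linarith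

theorem rpow_le_rpow_add_rpow {y r s t : ℝ} (hy : 0 < y) (hrs : r ≤ s) (hst : s ≤ t) :
    y ^ s ≤ y ^ r + y ^ t := by
  have h1 : 0 ≤ y ^ r := by positivity
  have h2 : 0 ≤ y ^ t := by positivity
  rcases le_total y 1 with h | h
  · linarith [Real.rpow_le_rpow_of_exponent_ge hy h hrs]
  · linarith [Real.rpow_le_rpow_of_exponent_le h hst]

/-- Integrals of complex powers are holomorphic in the exponent. -/
theorem differentiableAt_integral_cpow {Ω : Type*} [MeasurableSpace Ω] {μ : Measure Ω}
    {ρ : Ω → ℝ} (hρ : Measurable ρ) (hpos : ∀ᵐ x ∂μ, 0 < ρ x) {g : Ω → V}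
    (hg : AEStronglyMeasurable g μ) {c : ℝ}
    (hint : ∀ r > c, Integrable (fun x => ρ x ^ r * ‖g x‖) μ) {a : ℂ} (ha : c < a.re) :
    DifferentiableAt ℂ (fun a : ℂ => ∫ x, (ρ x : ℂ) ^ a • g x ∂μ) a := by
  obtain ⟨ε, hε, hεa⟩ : ∃ ε : ℝ, 0 < ε ∧ c < a.re - 2 * ε :=
    ⟨(a.re - c) / 3, by linarith, by linarith⟩
  have hmeas (b : ℂ) : AEStronglyMeasurable (fun x => (ρ x : ℂ) ^ b • g x) μ := by
    have : Measurable fun x => (ρ x : ℂ) ^ b := by fun_prop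
    exact this.aestronglyMeasurable.smul hg
  have hnorm (b : ℂ) {x : Ω} (hx : 0 < ρ x) : ‖(ρ x : ℂ) ^ b‖ = ρ x ^ b.re :=
    Complex.norm_cpow_eq_rpow_re_of_pos hx b
  refine (hasDerivAt_integral_of_dominated_loc_of_deriv_le (μ := μ) (s := Metric.ball a ε)
    -- Differentiation in the exponent produces a logarithm. Real parts on the ball differ from
    -- `a.re` by less than ε and the logarithm costs another ε, which gives the exponents `a.re ± 2
    -- * ε`; the lower one still exceeds `c` by the choice of ε.
    (bound := fun x => (2 / ε) * (ρ x ^ (a.re - 2 * ε) * ‖g x‖ + ρ x ^ (a.re + 2 * ε) * ‖g x‖))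
    (F' := fun b x => ((ρ x : ℂ) ^ b * Complex.log (ρ x)) • g x)
    (Metric.ball_mem_nhds a hε) (Filter.Eventually.of_forall hmeas) ?_ ?_ ?_ ?_
    ?_).2.differentiableAt
  · refine (hint a.re ha).mono' (hmeas a) ?_
    filter_upwards [hpos] with x hx
    rw [norm_smul, hnorm a hx]
  · have : Measurable fun x => (ρ x : ℂ) ^ a * Complex.log (ρ x) := by fun_prop
    exact this.aestronglyMeasurable.smul hg
  · filter_upwards [hpos] with x hx b hb
    rw [norm_smul, norm_mul, hnorm b hx, ← Complex.ofReal_log hx.le, Complex.norm_real,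
      Real.norm_eq_abs, ← add_mul, ← mul_assoc]
    refine mul_le_mul_of_nonneg_right ?_ (norm_nonneg _)
    have hb' : |b.re - a.re| < ε := by
      rw [← Complex.sub_re]
      exact (Complex.abs_re_le_norm _).trans_lt (by simpa [dist_eq_norm] using hb)
    rw [abs_lt] at hb'
    have h1 := rpow_le_rpow_add_rpow hx (r := a.re - 2 * ε) (s := b.re + ε) (t := a.re + 2 * ε)
      (by linarith) (by linarith)
    have h2 := rpow_le_rpow_add_rpow hx (r := a.re - 2 * ε) (s := b.re + -ε) (t := a.re + 2 * ε)
      (by linarith) (by linarith)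
    rw [Real.rpow_add hx] at h1 h2
    calc ρ x ^ b.re * |Real.log (ρ x)|
        ≤ ρ x ^ b.re * ((ρ x ^ ε + ρ x ^ (-ε)) / ε) :=
          mul_le_mul_of_nonneg_left (abs_log_le_rpow_add_rpow hx hε) (by positivity)
      _ = (ρ x ^ b.re * ρ x ^ ε + ρ x ^ b.re * ρ x ^ (-ε)) / ε := by ring
      _ ≤ ((ρ x ^ (a.re - 2 * ε) + ρ x ^ (a.re + 2 * ε)) +
          (ρ x ^ (a.re - 2 * ε) + ρ x ^ (a.re + 2 * ε))) / ε := by gcongr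
      _ = _ := by ring
  · exact ((hint _ hεa).add (hint _ (by linarith))).const_mul _
  · filter_upwards [hpos] with x hx b _
    have h := (hasDerivAt_id b).const_cpow (c := (ρ x : ℂ))
      (Or.inl (Complex.ofReal_ne_zero.2 hx.ne'))
    simpa using h.smul_const (g x)

end Zeta

/-! ### The functional equation for integrals against powers of the norm -/

section FunctionalEquation

open MeasureTheory Set FourierTransform

variable {n : ℕ} {V : Type*} [NormedAddCommGroup V] [NormedSpace ℂ V]

/-- The integral of a function against a complex power of the norm. -/
def normInt (a : ℂ) (φ : Euc n → V) : V := ∫ x, (‖x‖ : ℂ) ^ a • φ x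

/-- The integral of a function against a Gaussian. -/
def gaussInt (φ : Euc n → V) (t : ℝ) : V := ∫ x, Complex.exp (-(Real.pi * t * ‖x‖ ^ 2)) • φ x

/-- The Fourier transform is symmetric for the integral pairing, so it can be moved onto the
Gaussian, whose transform is a Gaussian of inverse width times t^(-n/2). -/
theorem gaussInt_eq [CompleteSpace V] (φ : 𝓢(Euc n, V)) {t : ℝ} (ht : 0 < t) :
    gaussInt (𝓕 φ : 𝓢(Euc n, V)) t = (t : ℂ) ^ (-(n / 2 : ℂ)) • gaussInt φ t⁻¹ := by
  have hpt : 0 < ((Real.pi * t : ℝ) : ℂ).re := by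
    rw [Complex.ofReal_re]; positivity
  have hg : Integrable fun v : Euc n => Complex.exp (-((Real.pi * t : ℝ) : ℂ) * ‖v‖ ^ 2) := by
    simpa using GaussianFourier.integrable_cexp_neg_mul_sq_norm_add hpt 0 (0 : Euc n)
  have h := VectorFourier.integral_fourierIntegral_smul_eq_flip (L := innerₗ (Euc n))
    (μ := volume) (ν := volume) Real.continuous_fourierChar continuous_inner hg φ.integrable
  rw [flip_innerₗ] at h
  change ∫ ξ, 𝓕 (fun v : Euc n => Complex.exp (-((Real.pi * t : ℝ) : ℂ) * ‖v‖ ^ 2)) ξ • φ ξ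
    = ∫ x, _ • (𝓕 (φ : Euc n → V)) x at h
  rw [← SchwartzMap.fourier_coe] at h
  have hl : gaussInt (𝓕 φ : 𝓢(Euc n, V)) t
      = ∫ x, Complex.exp (-((Real.pi * t : ℝ) : ℂ) * ‖x‖ ^ 2) • (𝓕 φ : 𝓢(Euc n, V)) x := by
    rw [gaussInt]
    congr 1; funext x; congr 2; push_cast; ring
  rw [hl, ← h, gaussInt, ← integral_smul]
  congr 1
  funext x
  rw [fourier_gaussian_innerProductSpace hpt, smul_smul]
  congr 2
  · rw [finrank_euclideanSpace, Fintype.card_fin, Complex.cpow_neg, ← Complex.inv_cpow]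
    · congr 1
      have : (Real.pi : ℂ) ≠ 0 := Complex.ofReal_ne_zero.2 Real.pi_ne_zero
      push_cast
      field_simp
    · rw [Complex.arg_ofReal_of_nonneg ht.le]; exact Real.pi_pos.ne
  · congr 1
    have : (Real.pi : ℂ) ≠ 0 := Complex.ofReal_ne_zero.2 Real.pi_ne_zero
    have : (t : ℂ) ≠ 0 := Complex.ofReal_ne_zero.2 ht.ne'
    push_cast
    field_simp

/-- Fubini reduces this to the Gamma integral ∫ t^(z-1) exp(-π‖x‖² t) dt = Γ(z) (π‖x‖²)^(-z) at z =
-a/2. The bound Re a < 0 gives convergence in t, and Re a > -n gives integrability of the resulting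
power of ‖x‖ against φ. -/
theorem mellin_gaussInt [NeZero n] [CompleteSpace V] (φ : 𝓢(Euc n, V)) {a : ℂ} (h1 : -(n : ℝ) < a.re)
    (h2 : a.re < 0) :
    mellin (gaussInt φ) (-a / 2)
      = (Complex.Gamma (-a / 2) * (Real.pi : ℂ) ^ (a / 2)) • normInt a φ := by
  have hz : 0 < (-a / 2).re := by simp; linarith
  have hmeas : AEStronglyMeasurable (Function.uncurry fun (t : ℝ) (x : Euc n) =>
      ((t : ℂ) ^ (-a / 2 - 1) * Complex.exp (-(Real.pi * t * ‖x‖ ^ 2))) • φ x)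
      ((volume.restrict (Ioi 0)).prod volume) := by
    have h : Measurable fun p : ℝ × Euc n =>
        (p.1 : ℂ) ^ (-a / 2 - 1) * Complex.exp (-(Real.pi * p.1 * ‖p.2‖ ^ 2)) := by fun_prop
    exact h.aestronglyMeasurable.smul
      (φ.continuous.comp continuous_snd).aestronglyMeasurable
  have hnorm (x : Euc n) {t : ℝ} (ht : t ∈ Ioi (0 : ℝ)) :
      ‖((t : ℂ) ^ (-a / 2 - 1) * Complex.exp (-(Real.pi * t * ‖x‖ ^ 2))) • φ x‖
        = t ^ ((-a / 2).re - 1) * Real.exp (-(Real.pi * ‖x‖ ^ 2 * t)) * ‖φ x‖ := by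
    rw [norm_smul, norm_mul, Complex.norm_cpow_eq_rpow_re_of_pos ht, Complex.norm_exp,
      Complex.sub_re, Complex.one_re]
    congr 3
    norm_cast
    ring
  have hint : Integrable (Function.uncurry fun (t : ℝ) (x : Euc n) =>
      ((t : ℂ) ^ (-a / 2 - 1) * Complex.exp (-(Real.pi * t * ‖x‖ ^ 2))) • φ x)
      ((volume.restrict (Ioi 0)).prod volume) := by
    rw [integrable_prod_iff' hmeas]
    constructor
    · filter_upwards [ae_norm_pos (n := n)] with x hx
      have h := integrableOn_rpow_mul_exp_neg_mul_rpow (p := 1) (s := (-a / 2).re - 1)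
        (b := Real.pi * ‖x‖ ^ 2) (by linarith) one_pos (by positivity)
      refine (Integrable.mul_const h ‖φ x‖).mono' ?_ ?_
      · have h : Measurable fun t : ℝ =>
          (t : ℂ) ^ (-a / 2 - 1) * Complex.exp (-(Real.pi * t * ‖x‖ ^ 2)) := by fun_prop
        exact AEStronglyMeasurable.smul_const h.aestronglyMeasurable (φ x)
      · filter_upwards [ae_restrict_mem measurableSet_Ioi] with t ht
        simp only [Function.uncurry_apply_pair]
        rw [hnorm x ht, Real.rpow_one, neg_mul]
    · refine ((integrable_norm_rpow_mul_norm h1 φ).const_mul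
        (Real.pi ^ (a.re / 2) * Real.Gamma (-a / 2).re)).congr ?_
      filter_upwards [ae_norm_pos (n := n)] with x hx
      have e : ∫ t in Ioi (0 : ℝ),
          ‖((t : ℂ) ^ (-a / 2 - 1) * Complex.exp (-(Real.pi * t * ‖x‖ ^ 2))) • φ x‖
          = ∫ t in Ioi (0 : ℝ),
            t ^ ((-a / 2).re - 1) * Real.exp (-(Real.pi * ‖x‖ ^ 2 * t)) * ‖φ x‖ :=
        setIntegral_congr_fun measurableSet_Ioi fun t ht => hnorm x ht
      simp only [Function.uncurry_apply_pair]
      rw [e, integral_mul_const, Real.integral_rpow_mul_exp_neg_mul_Ioi hz (by positivity),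
        one_div, Real.inv_rpow (by positivity), ← Real.rpow_neg (by positivity),
        Real.mul_rpow Real.pi_pos.le (by positivity), ← Real.rpow_natCast ‖x‖ 2, ← Real.rpow_mul hx.le,
        show -(-a / 2).re = a.re / 2 by simp; ring, show ((2 : ℕ) : ℝ) * (a.re / 2) = a.re by
          push_cast; ring]
      ring
  have hL : mellin (gaussInt φ) (-a / 2) = ∫ t in Ioi (0 : ℝ), ∫ x : Euc n,
      ((t : ℂ) ^ (-a / 2 - 1) * Complex.exp (-(Real.pi * t * ‖x‖ ^ 2))) • φ x := by
    rw [mellin]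
    congr 1; funext t
    rw [gaussInt, ← integral_smul]
    simp only [smul_smul]
  rw [hL, integral_integral_swap hint, normInt, ← integral_smul]
  refine integral_congr_ae ?_
  filter_upwards [ae_norm_pos (n := n)] with x hx
  rw [integral_smul_const, smul_smul]
  congr 1
  have h := Complex.integral_cpow_mul_exp_neg_mul_Ioi (r := Real.pi * ‖x‖ ^ 2) hz (by positivity)
  have e : ∫ t in Ioi (0 : ℝ), (t : ℂ) ^ (-a / 2 - 1) * Complex.exp (-(Real.pi * t * ‖x‖ ^ 2))
      = ∫ t in Ioi (0 : ℝ),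
        (t : ℂ) ^ (-a / 2 - 1) * Complex.exp (-((Real.pi * ‖x‖ ^ 2 : ℝ) * t)) := by
    congr 1; funext t; congr 2; push_cast; ring
  rw [e, h]
  have hx' : (0 : ℝ) < Real.pi * ‖x‖ ^ 2 := by positivity
  have e2 : (1 / ((Real.pi * ‖x‖ ^ 2 : ℝ) : ℂ)) ^ (-a / 2)
      = (Real.pi : ℂ) ^ (a / 2) * (‖x‖ : ℂ) ^ a := by
    rw [one_div, Complex.inv_cpow, ← Complex.cpow_neg, Complex.ofReal_mul,
      Complex.mul_cpow_ofReal_nonneg Real.pi_pos.le (by positivity),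
      show -(-a / 2) = a / 2 by ring]
    · congr 1
      rw [sq, Complex.ofReal_mul, Complex.mul_cpow_ofReal_nonneg hx.le hx.le,
        ← Complex.cpow_add _ _ (Complex.ofReal_ne_zero.2 hx.ne')]
      congr 1; ring
    · rw [Complex.arg_ofReal_of_nonneg hx'.le]; exact Real.pi_pos.ne
  rw [e2]
  ring

/-- The functional equation. -/
theorem normInt_functional_equation [NeZero n] [CompleteSpace V] (φ : 𝓢(Euc n, V)) {a : ℂ}
    (h1 : -(n : ℝ) < a.re) (h2 : a.re < 0) :
    (Complex.Gamma ((a + n) / 2))⁻¹ • normInt a φ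
      = ((Real.pi : ℂ) ^ (-a - n / 2) * (Complex.Gamma (-a / 2))⁻¹) • normInt (-a - n) (𝓕 φ : 𝓢(Euc n, V)) := by
  have e1 := mellin_gaussInt φ h1 h2
  have e2 := mellin_gaussInt (𝓕 φ) (a := -a - n) (by simp; linarith) (by simp; linarith)
  -- The substitution t ↦ 1/t, together with the weight t^(-n/2), exchanges the Mellin parameters (a
  -- + n)/2 and -a/2.
  have e3 : mellin (gaussInt (𝓕 φ : 𝓢(Euc n, V))) (-(-a - n) / 2) = mellin (gaussInt φ) (-a / 2) := by
    have : mellin (gaussInt (𝓕 φ : 𝓢(Euc n, V))) (-(-a - n) / 2)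
        = mellin (fun t => (t : ℂ) ^ (-(n / 2 : ℂ)) • gaussInt φ t⁻¹) (-(-a - n) / 2) := by
      refine setIntegral_congr_fun measurableSet_Ioi fun t ht => ?_
      simp only [gaussInt_eq φ ht]
    rw [this, mellin_cpow_smul, mellin_comp_inv (gaussInt φ)]
    congr 1; ring
  rw [e3, e1] at e2
  have hp : (Real.pi : ℂ) ≠ 0 := Complex.ofReal_ne_zero.2 Real.pi_ne_zero
  have g1 : Complex.Gamma (-a / 2) ≠ 0 := Complex.Gamma_ne_zero_of_re_pos (by simp; linarith)
  have g2 : Complex.Gamma ((a + n) / 2) ≠ 0 :=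
    Complex.Gamma_ne_zero_of_re_pos (by simp; linarith)
  rw [show -(-a - n) / 2 = (a + n) / 2 by ring] at e2
  have p1 : (Real.pi : ℂ) ^ (a / 2) ≠ 0 := by simp [Complex.cpow_eq_zero_iff, hp]
  have p2 : (Real.pi : ℂ) ^ (-a - n / 2) = (Real.pi : ℂ) ^ ((-a - n) / 2) / (Real.pi : ℂ) ^ (a / 2) := by
    rw [← Complex.cpow_sub _ _ hp]
    congr 1; ring
  have e4 := congrArg (fun v => ((Complex.Gamma ((a + n) / 2))⁻¹ * (Complex.Gamma (-a / 2))⁻¹ *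
    ((Real.pi : ℂ) ^ (a / 2))⁻¹) • v) e2
  simp only [smul_smul] at e4
  rw [p2]
  generalize Complex.Gamma (-a / 2) = G at *
  convert! e4 using 2 <;> field_simp

end FunctionalEquation

/-! ### Integration by parts, and continuation of identities in the exponent -/

section ByParts

open MeasureTheory Set

variable {n : ℕ} {V : Type*} [NormedAddCommGroup V] [NormedSpace ℂ V]

theorem integrable_normInt [NeZero n] {a : ℂ} (ha : -(n : ℝ) < a.re) (φ : 𝓢(Euc n, V)) :
    Integrable fun x => (‖x‖ : ℂ) ^ a • φ x := by
  have h : Measurable fun x : Euc n => (‖x‖ : ℂ) ^ a := by fun_prop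
  refine (integrable_norm_rpow_mul_norm ha φ).mono'
    (h.aestronglyMeasurable.smul φ.continuous.aestronglyMeasurable) ?_
  filter_upwards [ae_norm_pos (n := n)] with x hx
  rw [norm_smul, Complex.norm_cpow_eq_rpow_re_of_pos hx]

/-- Away from the origin this is the chain rule through ‖x‖². At the origin the formula gives zero,
which is correct because ‖h‖^(Re a) = o(‖h‖) when Re a > 1. -/
theorem hasFDerivAt_norm_cpow {a : ℂ} (ha : 1 < a.re) (x : Euc n) :
    HasFDerivAt (fun x : Euc n => (‖x‖ : ℂ) ^ a)
      ((a * (‖x‖ : ℂ) ^ (a - 2)) • Complex.ofRealCLM.comp (innerSL ℝ x)) x := by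
  have ha0 : a ≠ 0 := by rintro rfl; simp at ha; linarith
  by_cases hx : x = 0
  · subst hx
    have e0 : (a * (‖(0 : Euc n)‖ : ℂ) ^ (a - 2)) •
        Complex.ofRealCLM.comp (innerSL ℝ (0 : Euc n)) = 0 := by
      ext v
      simp
    rw [e0, hasFDerivAt_iff_isLittleO_nhds_zero]
    simp only [zero_add, norm_zero, Complex.ofReal_zero, Complex.zero_cpow ha0, sub_zero,
      zero_apply]
    have h1 : (fun h : Euc n => (‖h‖ : ℂ) ^ a) =O[nhds 0] fun h : Euc n => ‖h‖ ^ a.re := by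
      refine Asymptotics.IsBigO.of_bound (1 : ℝ) (Filter.Eventually.of_forall fun (h : Euc n) => ?_)
      rw [one_mul, Complex.norm_cpow_eq_rpow_re_of_nonneg (norm_nonneg _) (by linarith)]
      exact le_abs_self _
    have h2 : (fun h : Euc n => ‖h‖ ^ a.re) = fun h : Euc n => ‖h‖ ^ (a.re - 1) * ‖h‖ := by
      funext h
      rcases eq_or_ne h 0 with rfl | hh
      · simp [Real.zero_rpow (show a.re ≠ 0 by linarith)]
      · rw [Real.rpow_sub_one (norm_ne_zero_iff.2 hh), div_mul_cancel₀ _ (norm_ne_zero_iff.2 hh)]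
    have h3 : (fun h : Euc n => ‖h‖ ^ (a.re - 1)) =o[nhds 0] fun _ => (1 : ℝ) := by
      rw [Asymptotics.isLittleO_one_iff]
      have : ContinuousAt (fun h : Euc n => ‖h‖ ^ (a.re - 1)) 0 :=
        continuousAt_id.norm.rpow_const (Or.inr (by linarith))
      simpa [ContinuousAt, Real.zero_rpow (show a.re - 1 ≠ 0 by linarith)] using this
    have h4 := h3.mul_isBigO (Asymptotics.isBigO_refl (fun h : Euc n => ‖h‖) (nhds 0))
    simp only [one_mul, ← h2] at h4
    exact h1.trans_isLittleO h4.of_norm_right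
  · have hx' : 0 < ‖x‖ := norm_pos_iff.2 hx
    have h1 : HasFDerivAt (fun y : Euc n => ‖y‖ ^ 2) (2 • innerSL ℝ x) x :=
      (hasStrictFDerivAt_norm_sq x).hasFDerivAt
    have h2 := hasDerivAt_ofReal_cpow_const (x := ‖x‖ ^ 2) (r := a / 2) (by positivity)
      (by simpa using ha0)
    have h3 := h2.hasFDerivAt.comp x h1
    have e1 : ((fun y : ℝ => (y : ℂ) ^ (a / 2)) ∘
        fun y : Euc n => ‖y‖ ^ 2) = fun y : Euc n => (‖y‖ : ℂ) ^ a := by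
      funext y
      simp only [Function.comp_apply]
      rw [sq, Complex.ofReal_mul,
        Complex.mul_cpow_ofReal_nonneg (norm_nonneg y) (norm_nonneg y)]
      rcases eq_or_ne y 0 with rfl | hy
      · simp [ha0]
      · rw [← Complex.cpow_add _ _ (by simpa using hy)]
        congr 1; ring
    rw [e1] at h3
    convert! h3 using 1
    ext v
    have e2 : ((‖x‖ ^ 2 : ℝ) : ℂ) ^ (a / 2 - 1) = (‖x‖ : ℂ) ^ (a - 2) := by
      rw [sq, Complex.ofReal_mul, Complex.mul_cpow_ofReal_nonneg hx'.le hx'.le,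
        ← Complex.cpow_add _ _ (by simpa using hx)]
      congr 1; ring
    rw [e2]
    simp
    ring

/-- Integration by parts against a power of the norm. -/
theorem normInt_schwP [NeZero n] {a : ℂ} (ha : 2 < a.re) (j : Fin n) (φ : 𝓢(Euc n, V)) :
    normInt a (schwP (dir j) φ) = -a • normInt (a - 2) (schwX (coord j) φ) := by
  have hn : (0 : ℝ) ≤ n := n.cast_nonneg
  have hi (x : Euc n) : ((a * (‖x‖ : ℂ) ^ (a - 2)) • Complex.ofRealCLM.comp (innerSL ℝ x)) (dir j)
      = a * (‖x‖ : ℂ) ^ (a - 2) * x j := by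
    simp [dir, EuclideanSpace.inner_single_right]
  have e (x : Euc n) : (a * (‖x‖ : ℂ) ^ (a - 2) * x j) • φ x
      = a • ((‖x‖ : ℂ) ^ (a - 2) • schwX (coord j) φ x) := by
    rw [schwX_apply, coord_apply, mul_assoc, mul_smul, mul_smul]
  have h := integral_bilinear_hasFDerivAt_right_eq_neg_left_of_integrable (μ := volume)
    (f := fun x : Euc n => (‖x‖ : ℂ) ^ a)
    (f' := fun x => (a * (‖x‖ : ℂ) ^ (a - 2)) • Complex.ofRealCLM.comp (innerSL ℝ x))
    (g := φ) (g' := fun x => fderiv ℝ φ x) (v := dir j) (B := ContinuousLinearMap.lsmul ℝ ℂ)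
    ?_ ?_ ?_ (fun x _ => hasFDerivAt_norm_cpow (by linarith) x)
    (fun x _ => φ.differentiableAt.hasFDerivAt)
  · simp only [ContinuousLinearMap.lsmul_apply, hi, e] at h
    rw [integral_smul] at h
    rw [neg_smul]
    exact h
  · simp only [ContinuousLinearMap.lsmul_apply, hi, e]
    exact (integrable_normInt (by simp; linarith) _).smul a
  · exact integrable_normInt (by linarith) (schwP (dir j) φ)
  · exact integrable_normInt (by linarith) φ

theorem differentiableAt_normInt [NeZero n] (φ : 𝓢(Euc n, V)) {a : ℂ} (ha : -(n : ℝ) < a.re) :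
    DifferentiableAt ℂ (fun a => normInt a φ) a :=
  differentiableAt_integral_cpow (by fun_prop) ae_norm_pos φ.continuous.aestronglyMeasurable
    (fun _ hr => integrable_norm_rpow_mul_norm hr φ) ha

/-- The identity theorem on a half-plane. It allows integration by parts to be done only where the
power of the norm is regular enough. -/
theorem eq_of_eq_on_right [CompleteSpace V] {f g : ℂ → V} {c c' : ℝ}
    (hf : ∀ a : ℂ, c < a.re → DifferentiableAt ℂ f a)
    (hg : ∀ a : ℂ, c < a.re → DifferentiableAt ℂ g a) (h : ∀ a : ℂ, c' < a.re → f a = g a)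
    {a : ℂ} (ha : c < a.re) : f a = g a := by
  have ho (b : ℝ) : IsOpen {a : ℂ | b < a.re} := isOpen_lt continuous_const Complex.continuous_re
  have hf' : AnalyticOnNhd ℂ f {a : ℂ | c < a.re} :=
    DifferentiableOn.analyticOnNhd (fun a ha => (hf a ha).differentiableWithinAt) (ho c)
  have hg' : AnalyticOnNhd ℂ g {a : ℂ | c < a.re} :=
    DifferentiableOn.analyticOnNhd (fun a ha => (hg a ha).differentiableWithinAt) (ho c)
  have hz : (((max c c' + 1 : ℝ) : ℂ)) ∈ {a : ℂ | c < a.re} := by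
    simp only [mem_ofPred_eq, Complex.ofReal_re]; linarith [le_max_left c c']
  refine hf'.eqOn_of_preconnected_of_eventuallyEq hg'
    (convex_halfSpace_re_gt c).isPreconnected hz ?_ ha
  filter_upwards [(ho c').mem_nhds (show (((max c c' + 1 : ℝ) : ℂ)) ∈ {a : ℂ | c' < a.re} by
    simp only [mem_ofPred_eq, Complex.ofReal_re]; linarith [le_max_right c c'])] with a ha
    using h a ha

end ByParts

/-! ### The kernel of the Riesz distribution and the differential operators -/

section KernelAlgebra

variable {n : ℕ} {M Y : Type*} [AddCommGroup M] [Module ℂ M] [AddCommGroup Y] [Module ℂ Y]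

theorem eq_zero_of_eq_neg {v : M} (h : v = -v) : v = 0 := by
  have h2 : (2 : ℂ) • v = 0 := by rw [two_smul]; nth_rw 1 [h]; exact neg_add_cancel v
  exact (smul_eq_zero.1 h2).resolve_left two_ne_zero

/-- The operator `ι_x ε_x - ε_x ι_x`. -/
def kerOp (X e f : Fin n → M →ₗ[ℂ] M) : M →ₗ[ℂ] M :=
  contract X f ∘ₗ contract X e - contract X e ∘ₗ contract X f

namespace WeylClifford

variable {X P e f : Fin n → M →ₗ[ℂ] M} (W : WeylClifford X P e f)
include W

theorem X_ext (j : Fin n) (v : M) : X j (contract X e v) = contract X e (X j v) := by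
  simp only [contract_apply, map_sum, W.e_X, W.X_X j]

theorem X_int (j : Fin n) (v : M) : X j (contract X f v) = contract X f (X j v) := by
  simp only [contract_apply, map_sum, W.f_X, W.X_X j]

theorem e_ext (j : Fin n) (v : M) : e j (contract X e v) = -contract X e (e j v) := by
  simp only [contract_apply, map_sum, W.e_X, W.e_e j, map_neg, Finset.sum_neg_distrib]

theorem f_int (j : Fin n) (v : M) : f j (contract X f v) = -contract X f (f j v) := by
  simp only [contract_apply, map_sum, W.f_X, W.f_f j, map_neg, Finset.sum_neg_distrib]

theorem f_ext (j : Fin n) (v : M) : f j (contract X e v) = X j v - contract X e (f j v) := by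
  simp only [contract_apply, map_sum, W.f_X, W.f_e j, map_neg, Finset.sum_neg_distrib, map_add,
    Finset.sum_add_distrib, apply_ite (X _), map_zero, Finset.sum_ite_eq, Finset.mem_univ, if_true]
  abel

theorem e_int (j : Fin n) (v : M) : e j (contract X f v) = X j v - contract X f (e j v) := by
  have h (m : Fin n) : e j (f m v) = (if m = j then v else 0) - f m (e j v) := by
    rw [W.f_e]; abel
  simp only [contract_apply, map_sum, W.e_X, h, map_sub, Finset.sum_sub_distrib,
    apply_ite (X _), map_zero, Finset.sum_ite_eq', Finset.mem_univ, if_true]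

theorem P_ext (j : Fin n) (v : M) : P j (contract X e v) = contract X e (P j v) + e j v := by
  simp only [contract_apply, map_sum, W.P_X, W.e_P, Finset.sum_add_distrib, Finset.sum_ite_eq,
    Finset.mem_univ, if_true]

theorem P_int (j : Fin n) (v : M) : P j (contract X f v) = contract X f (P j v) + f j v := by
  simp only [contract_apply, map_sum, W.P_X, W.f_P, Finset.sum_add_distrib, Finset.sum_ite_eq,
    Finset.mem_univ, if_true]

theorem ext_ext (v : M) : contract X e (contract X e v) = 0 := by
  have h : contract X e (contract X e v) = -contract X e (contract X e v) := by
    conv_lhs => rw [contract_apply]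
    simp only [W.e_ext, map_neg, Finset.sum_neg_distrib, W.X_ext]
    rw [← map_sum, ← contract_apply]
  exact eq_zero_of_eq_neg h

theorem int_int (v : M) : contract X f (contract X f v) = 0 := by
  have h : contract X f (contract X f v) = -contract X f (contract X f v) := by
    conv_lhs => rw [contract_apply]
    simp only [W.f_int, map_neg, Finset.sum_neg_distrib, W.X_int]
    rw [← map_sum, ← contract_apply]
  exact eq_zero_of_eq_neg h

theorem int_ext (v : M) :
    contract X f (contract X e v) + contract X e (contract X f v) = contract X X v := by
  rw [contract_apply X f (contract X e v)]
  simp only [W.f_ext, map_sub, Finset.sum_sub_distrib, W.X_ext]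
  rw [← map_sum, ← contract_apply X f, ← contract_apply]
  abel

theorem X_kerOp (j : Fin n) (v : M) : X j (kerOp X e f v) = kerOp X e f (X j v) := by
  simp only [kerOp, LinearMap.sub_apply, LinearMap.comp_apply, map_sub, W.X_int, W.X_ext]

theorem kerOp_P (j : Fin n) (v : M) : kerOp X e f (P j v) = P j (kerOp X e f v)
    - (2 : ℂ) • contract X f (e j v) + (2 : ℂ) • contract X e (f j v) := by
  simp only [kerOp, LinearMap.sub_apply, LinearMap.comp_apply, map_sub, W.P_int, W.P_ext, map_add,
    W.f_ext, W.e_int]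
  module

/-- Since ι_x² = 0, only ι_x ε_x survives in the kernel and in ‖x‖² = ι_x ε_x + ε_x ι_x, so the two
agree on the image of ι_x. On the image of ε_x they differ by a sign. -/
theorem kerOp_int (v : M) :
    kerOp X e f (contract X f v) = contract X X (contract X f v) := by
  rw [← W.int_ext]
  simp [kerOp, W.int_int]

theorem kerOp_ext (v : M) :
    kerOp X e f (contract X e v) = -contract X X (contract X e v) := by
  rw [← W.int_ext]
  simp [kerOp, W.ext_ext]

theorem kerOp_sq (v : M) : kerOp X e f (contract X X v) = contract X X (kerOp X e f v) := by
  simp only [contract_apply, map_sum, W.X_kerOp]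

theorem contract_X_kerOp (g : Fin n → M →ₗ[ℂ] M) (v : M) :
    ∑ m, X m (kerOp X e f (g m v)) = kerOp X e f (contract X g v) := by
  simp only [contract_apply, map_sum, W.X_kerOp]

variable {I0 I2 : M →ₗ[ℂ] Y} {σ : ℂ} (hP : ∀ j v, I0 (P j v) = -σ • I2 (X j v))
  (hr : ∀ v, I2 (contract X X v) = I0 v)
include hP

include hr in
-- Here `I0` and `I2` model integration against ‖x‖^σ and ‖x‖^(σ-2): `hP` is integration by parts
-- and `hr` absorbs ‖x‖². Moving the derivatives to the outside leaves a multiple of ι_x times the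
-- degree operator, and the coordinates produced by integration by parts recombine to the kernel
-- applied to ι_x.
theorem kerOp_codOp {v : M} {c : ℂ} (hv : contract e f v = c • v) :
    I0 (kerOp X e f (codOp P f v)) = (σ + 2 * c) • I0 (contract X f v) := by
  have h : kerOp X e f (codOp P f v)
      = -∑ m, P m (kerOp X e f (f m v)) + (2 : ℂ) • contract X f (contract e f v) := by
    have h0 (m : Fin n) : f m (f m v) = 0 := eq_zero_of_eq_neg (W.f_f m m v)
    simp only [codOp, LinearMap.neg_apply, contract_apply f P, map_neg, map_sum, W.f_P,
      W.kerOp_P, h0, map_zero, smul_zero, add_zero, Finset.sum_sub_distrib, contract_apply e f,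
      ← Finset.smul_sum]
    abel
  rw [h, hv]
  simp only [map_add, map_neg, map_sum, map_smul, hP, ← Finset.smul_sum]
  rw [← map_sum, W.contract_X_kerOp, W.kerOp_int, hr]
  module

theorem int_dOp {v : M} {c : ℂ} (hv : contract e f v = c • v) :
    I0 (contract X f (dOp P e v))
      = -σ • I2 (contract X f (contract X e v)) - ((n : ℂ) - c) • I0 v := by
  have h : contract X f (dOp P e v)
      = ∑ m, P m (contract X f (e m v)) - contract f e v := by
    simp only [dOp, contract_apply e P, map_sum, W.e_P, W.P_int, contract_apply f e,
      Finset.sum_add_distrib]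
    abel
  have h1 : ∑ m, X m (contract X f (e m v)) = contract X f (contract X e v) := by
    simp only [W.X_int]
    rw [← map_sum, ← contract_apply]
  rw [h, W.sum_f_e, hv]
  simp only [map_sub, map_sum, map_smul, hP, ← Finset.smul_sum]
  rw [← map_sum, h1]
  module

include hr in
theorem kerOp_dOp {v : M} {c : ℂ} (hv : contract e f v = c • v) :
    I0 (kerOp X e f (dOp P e v)) = (σ + 2 * n - 2 * c) • I0 (contract X e v) := by
  have h : kerOp X e f (dOp P e v)
      = ∑ m, P m (kerOp X e f (e m v)) + (2 : ℂ) • contract X e (contract f e v) := by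
    have h0 (m : Fin n) : e m (e m v) = 0 := eq_zero_of_eq_neg (W.e_e m m v)
    simp only [dOp, contract_apply e P, map_sum, W.e_P,
      W.kerOp_P, h0, map_zero, smul_zero, sub_zero, Finset.sum_add_distrib, contract_apply f e,
      ← Finset.smul_sum]
  rw [h, W.sum_f_e, hv]
  simp only [map_add, map_sub, map_sum, map_smul, hP, ← Finset.smul_sum]
  rw [← map_sum, W.contract_X_kerOp, W.kerOp_ext, map_neg, hr]
  module

theorem ext_codOp {v : M} {c : ℂ} (hv : contract e f v = c • v) :
    I0 (contract X e (codOp P f v))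
      = σ • I2 (contract X e (contract X f v)) + c • I0 v := by
  have h : contract X e (codOp P f v)
      = -∑ m, P m (contract X e (f m v)) + contract e f v := by
    simp only [codOp, LinearMap.neg_apply, contract_apply f P, map_neg, map_sum, W.f_P, W.P_ext,
      contract_apply e f, Finset.sum_add_distrib]
    abel
  have h1 : ∑ m, X m (contract X e (f m v)) = contract X e (contract X f v) := by
    simp only [W.X_ext]
    rw [← map_sum, ← contract_apply]
  rw [h, hv]
  simp only [map_add, map_neg, map_sum, map_smul, hP, ← Finset.smul_sum]
  rw [← map_sum, h1]
  module

include hr in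
-- Both second-order terms reduce to `I2` of ι_x ε_x v and ε_x ι_x v, after ‖x‖² is written as the
-- sum of the two products. The coefficients α and β are those for which the outcome is proportional
-- to the difference of the products, which is the kernel. The degree changes to k + 1 or k - 1
-- after the inner operator.
theorem kerOp_boxOp {k : ℕ} {v : M} (hv : contract e f v = (k : ℂ) • v) {s : ℂ} (hσ : σ = -s - n) :
    I0 (kerOp X e f (boxOp k s P e f v))
      = -(kap n k s * (s * (s + n))) • I2 (kerOp X e f v) := by
  have h1 : contract e f (dOp P e v) = ((k : ℂ) + 1) • dOp P e v := by
    rw [W.deg_d, hv, map_smul]; module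
  have h2 : contract e f (codOp P f v) = ((k : ℂ) - 1) • codOp P f v := by
    rw [W.deg_cod, hv, map_smul]; module
  simp only [boxOp, LinearMap.add_apply, LinearMap.smul_apply, LinearMap.comp_apply, map_add,
    map_smul, W.kerOp_codOp hP hr h1, W.kerOp_dOp hP hr h2, W.int_dOp hP hv,
    W.ext_codOp hP hv]
  rw [← hr v, ← W.int_ext, map_add]
  simp only [kerOp, LinearMap.sub_apply, LinearMap.comp_apply, map_sub, alpha, beta, kap, hσ]
  module

include hr in
-- Commuting ∂_j past the kernel creates terms in ι_x ε_j and ε_x ι_j. The coefficients γ and δ make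
-- the other two summands cancel exactly these.
theorem kerOp_gradOp {k : ℕ} {v : M} (hv : contract e f v = (k : ℂ) • v) {s : ℂ} (hσ : σ = -s - n)
    (j : Fin n) : I0 (kerOp X e f (gradOp k s P e f j v))
      = (kap n k s * (s * (s + n))) • I2 (kerOp X e f (X j v)) := by
  have h1 : contract e f (e j v) = ((k : ℂ) + 1) • e j v := by
    rw [W.deg_e, hv, map_smul]; module
  have h2 : contract e f (f j v) = ((k : ℂ) - 1) • f j v := by
    rw [W.deg_f, hv, map_smul]; module
  simp only [gradOp, LinearMap.add_apply, LinearMap.sub_apply, LinearMap.smul_apply,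
    LinearMap.comp_apply, map_add, map_sub, W.kerOp_P, hP,
    map_smul, W.kerOp_codOp hP hr h1, W.kerOp_dOp hP hr h2, W.X_kerOp, gam, del, kap, hσ]
  module

end WeylClifford

end KernelAlgebra

/-! ### The Riesz distribution -/

section Riesz

open MeasureTheory Set FourierTransform

variable {n : ℕ}

section

variable {V : Type*} [NormedAddCommGroup V] [NormedSpace ℂ V]

theorem exists_normIntCLM [NeZero n] {a : ℂ} (ha : -(n : ℝ) < a.re) :
    ∃ T : 𝓢(Euc n, V) →L[ℂ] V, ∀ φ, T φ = normInt a φ := by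
  have hm : Measurable fun x : Euc n => (‖x‖ : ℂ) ^ a := by fun_prop
  refine (exists_kernelCLM ha (C := 1) (fun x => (‖x‖ : ℂ) ^ a • ContinuousLinearMap.id ℂ V)
    (hm.aestronglyMeasurable.smul aestronglyMeasurable_const) fun x hx => ?_).2
  rw [norm_smul, Complex.norm_cpow_eq_rpow_re_of_pos (norm_pos_iff.2 hx), mul_comm]
  gcongr
  exact ContinuousLinearMap.norm_id_le

/-- The integral against a power of the norm as a continuous linear map. -/
def normIntCLM [NeZero n] (a : ℂ) : 𝓢(Euc n, V) →L[ℂ] V :=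
  if h : -(n : ℝ) < a.re then (exists_normIntCLM h).choose else 0

theorem normIntCLM_apply [NeZero n] {a : ℂ} (ha : -(n : ℝ) < a.re) (φ : 𝓢(Euc n, V)) :
    normIntCLM a φ = normInt a φ := by
  rw [normIntCLM, dif_pos ha]
  exact (exists_normIntCLM ha).choose_spec φ

end

/-- Exterior multiplication with the covector dual to `x`. -/
def extVecL (x : Euc n) : ExtAlg n →L[ℂ] ExtAlg n := ∑ j, (x j : ℂ) • extL j

/-- Interior multiplication with the vector `x`. -/
def intVecL (x : Euc n) : ExtAlg n →L[ℂ] ExtAlg n := ∑ j, (x j : ℂ) • intL j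

theorem extVecL_apply (x : Euc n) (w : ExtAlg n) : extVecL x w = extMulVec x w := by
  simp [extVecL, extMulVec]

theorem intVecL_apply (x : Euc n) (w : ExtAlg n) : intVecL x w = intMulVec x w := by
  simp [intVecL, intMulVec]

theorem norm_sum_coord_smul_le (A : Fin n → ExtAlg n →L[ℂ] ExtAlg n) (x : Euc n) :
    ‖∑ j, (x j : ℂ) • A j‖ ≤ (∑ j, ‖A j‖) * ‖x‖ := by
  refine (norm_sum_le _ _).trans ?_
  rw [Finset.sum_mul]
  refine Finset.sum_le_sum fun j _ => ?_
  rw [norm_smul, mul_comm]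
  gcongr
  simpa using PiLp.norm_apply_le x j

/-- The endomorphism `ι_x ε_x - ε_x ι_x`. -/
def kerL (x : Euc n) : ExtAlg n →L[ℂ] ExtAlg n :=
  (intVecL x).comp (extVecL x) - (extVecL x).comp (intVecL x)

theorem continuous_kerL : Continuous (kerL : Euc n → ExtAlg n →L[ℂ] ExtAlg n) := by
  have h1 : Continuous (extVecL : Euc n → ExtAlg n →L[ℂ] ExtAlg n) := by
    unfold extVecL; fun_prop
  have h2 : Continuous (intVecL : Euc n → ExtAlg n →L[ℂ] ExtAlg n) := by
    unfold intVecL; fun_prop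
  exact (h2.clm_comp h1).sub (h1.clm_comp h2)

/-- The kernel is quadratic in x. It therefore offsets the exponent σ - 2, and the defining integral
converges for all Re σ > -n. -/
theorem exists_norm_kerL_le : ∃ C : ℝ, ∀ x : Euc n, ‖kerL x‖ ≤ C * ‖x‖ ^ 2 := by
  refine ⟨2 * ((∑ j : Fin n, ‖extL j‖) * ∑ j : Fin n, ‖intL j‖), fun x => ?_⟩
  have h1 : ‖extVecL x‖ ≤ _ := norm_sum_coord_smul_le extL x
  have h2 : ‖intVecL x‖ ≤ _ := norm_sum_coord_smul_le intL x
  have h3 := mul_le_mul h1 h2 (norm_nonneg _) (by positivity)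
  have h4 := norm_sub_le ((intVecL x).comp (extVecL x)) ((extVecL x).comp (intVecL x))
  have h5 := (intVecL x).opNorm_comp_le (extVecL x)
  have h6 := (extVecL x).opNorm_comp_le (intVecL x)
  rw [kerL]
  nlinarith

/-- The operator `ι_x ε_x - ε_x ι_x` on Schwartz forms. -/
abbrev sKer : SForm n →ₗ[ℂ] SForm n := kerOp sX sE sI

theorem contract_sE_apply (φ : SForm n) (x : Euc n) :
    contract sX sE φ x = extMulVec x (φ x) := by
  rw [contract_apply, sum_apply, extMulVec]
  refine Finset.sum_congr rfl fun j _ => ?_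
  rw [show sX j (sE j φ) x = _ from schwX_apply (coord j) _ x]
  rfl

theorem contract_sI_apply (φ : SForm n) (x : Euc n) :
    contract sX sI φ x = intMulVec x (φ x) := by
  rw [contract_apply, sum_apply, intMulVec]
  refine Finset.sum_congr rfl fun j _ => ?_
  rw [show sX j (sI j φ) x = _ from schwX_apply (coord j) _ x]
  rfl

theorem contract_sX_apply (φ : SForm n) (x : Euc n) :
    contract sX sX φ x = ((‖x‖ : ℂ) ^ 2) • φ x := by
  rw [contract_apply, sum_apply, ← Complex.ofReal_pow, EuclideanSpace.norm_sq_eq,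
    Complex.ofReal_sum, Finset.sum_smul]
  refine Finset.sum_congr rfl fun j _ => ?_
  rw [show sX j (sX j φ) x = _ from schwX_apply (coord j) _ x,
    show sX j φ x = _ from schwX_apply (coord j) _ x, smul_smul, Real.norm_eq_abs, sq_abs, sq,
    Complex.ofReal_mul, coord_apply]

theorem sKer_apply (φ : SForm n) (x : Euc n) :
    sKer φ x = intMulVec x (extMulVec x (φ x)) - extMulVec x (intMulVec x (φ x)) := by
  simp only [sKer, kerOp, LinearMap.sub_apply, LinearMap.comp_apply, sub_apply,
    contract_sE_apply, contract_sI_apply]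

theorem sKer_apply' (φ : SForm n) (x : Euc n) : sKer φ x = kerL x (φ x) := by
  rw [sKer_apply]
  simp [kerL, extVecL_apply, intVecL_apply]

theorem integrable_norm_rpow_mul_norm_sKer [NeZero n] {r : ℝ} (hr : -(n : ℝ) - 2 < r)
    (φ : SForm n) : Integrable fun x => ‖x‖ ^ r * ‖sKer φ x‖ := by
  obtain ⟨C, hC⟩ := exists_norm_kerL_le (n := n)
  refine ((integrable_norm_rpow_mul_norm (r := r + 2) (by linarith) φ).const_mul C).mono' ?_ ?_
  · exact (by fun_prop : Measurable fun x : Euc n => ‖x‖ ^ r).aestronglyMeasurable.mul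
      (sKer φ).continuous.norm.aestronglyMeasurable
  · filter_upwards [ae_norm_pos (n := n)] with x hx
    rw [Real.norm_of_nonneg (by positivity), sKer_apply', Real.rpow_add hx, Real.rpow_two]
    have h := ((kerL x).le_opNorm (φ x)).trans
      (mul_le_mul_of_nonneg_right (hC x) (norm_nonneg _))
    calc ‖x‖ ^ r * ‖kerL x (φ x)‖ ≤ ‖x‖ ^ r * (C * ‖x‖ ^ 2 * ‖φ x‖) := by gcongr
      _ = _ := by ring

theorem exists_kerIntCLM [NeZero n] {σ : ℂ} (hσ : -(n : ℝ) < σ.re) :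
    ∃ T : SForm n →L[ℂ] ExtAlg n, ∀ φ, T φ = normInt (σ - 2) (sKer φ) := by
  obtain ⟨C, hC⟩ := exists_norm_kerL_le (n := n)
  have hm : Measurable fun x : Euc n => (‖x‖ : ℂ) ^ (σ - 2) := by fun_prop
  obtain ⟨T, hT⟩ := (exists_kernelCLM hσ (C := C) (fun x => (‖x‖ : ℂ) ^ (σ - 2) • kerL x)
    (hm.aestronglyMeasurable.smul continuous_kerL.aestronglyMeasurable) fun x hx => by
      have hx' := norm_pos_iff.2 hx
      rw [norm_smul, Complex.norm_cpow_eq_rpow_re_of_pos hx']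
      calc _ ≤ ‖x‖ ^ (σ - 2).re * (C * ‖x‖ ^ 2) := by gcongr; exact hC x
        _ = C * (‖x‖ ^ (σ.re - 2) * ‖x‖ ^ (2 : ℝ)) := by
          rw [Real.rpow_two]; simp; ring
        _ = _ := by rw [← Real.rpow_add hx']; simp).2
  refine ⟨T, fun φ => (hT φ).trans ?_⟩
  simp only [normInt, sKer_apply']
  rfl

theorem differentiableAt_normInt_sKer [NeZero n] (φ : SForm n) {σ : ℂ} (hσ : -(n : ℝ) < σ.re) :
    DifferentiableAt ℂ (fun σ => normInt (σ - 2) (sKer φ)) σ := by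
  have h : DifferentiableAt ℂ (fun a => normInt a (sKer φ)) (σ - 2) :=
    differentiableAt_integral_cpow (by fun_prop) ae_norm_pos
      (sKer φ).continuous.aestronglyMeasurable
      (fun _ hr => integrable_norm_rpow_mul_norm_sKer hr φ) (by simp; linarith)
  exact DifferentiableAt.comp (f := fun σ : ℂ => σ - 2) (g := fun a => normInt a (sKer φ)) σ h
    (by fun_prop)

theorem normInt_sX_sq [NeZero n] (a : ℂ) (φ : SForm n) :
    normInt (a - 2) (contract sX sX φ) = normInt a φ := by
  refine integral_congr_ae ?_
  filter_upwards [ae_norm_pos (n := n)] with x hx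
  rw [contract_sX_apply, smul_smul, Complex.cpow_sub _ _ (by exact_mod_cast hx.ne'),
    Complex.cpow_ofNat, div_mul_cancel₀ _ (pow_ne_zero _ (by exact_mod_cast hx.ne'))]

/-- The operator `φ ↦ ∑ ∂_j (ε_x ι_j φ)`. -/
def sShift : SForm n →L[ℂ] SForm n :=
  ∑ j, ∑ i, (schwP (dir j)).comp ((schwX (coord i)).comp ((schwA (extL i)).comp (schwA (intL j))))

theorem sShift_apply (φ : SForm n) : sShift φ = ∑ j, sP j (contract sX sE (sI j φ)) := by
  simp only [sShift, sum_apply, contract_apply, map_sum]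
  rfl

/-- By ι_x ε_x - ε_x ι_x = ‖x‖² - 2 ε_x ι_x, one coordinate of ε_x ι_x can be traded for a
derivative when Re σ > 2, and both sides are holomorphic for Re σ > -n. This expresses the
matrix-valued kernel through scalar powers of the norm, to which the functional equation applies. -/
theorem smul_normInt_sKer [NeZero n] (φ : SForm n) {σ : ℂ} (hσ : -(n : ℝ) < σ.re) :
    σ • normInt (σ - 2) (sKer φ) = σ • normInt σ φ + (2 : ℂ) • normInt σ (sShift φ) := by
  refine eq_of_eq_on_right (c := -n) (c' := 2)
    (f := fun σ => σ • normInt (σ - 2) (sKer φ))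
    (g := fun σ => σ • normInt σ φ + (2 : ℂ) • normInt σ (sShift φ)) ?_ ?_ ?_ hσ
  · exact fun a ha => differentiableAt_id.smul (differentiableAt_normInt_sKer φ ha)
  · intro a ha
    have h1 := differentiableAt_normInt φ ha
    have h2 := differentiableAt_normInt (sShift φ) ha
    fun_prop
  · intro a ha
    have hn : (0 : ℝ) ≤ n := n.cast_nonneg
    have h1 : -(n : ℝ) < a.re := by linarith
    have h2 : -(n : ℝ) < (a - 2).re := by simp; linarith
    have h3 : normInt a (sShift φ) = -a • normInt (a - 2) (contract sX sE (contract sX sI φ)) := by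
      have e : contract sX sE (contract sX sI φ) = ∑ j, sX j (contract sX sE (sI j φ)) := by
        simp only [weylClifford_single.X_ext]
        rw [← map_sum, ← contract_apply]
      rw [← normIntCLM_apply h1, ← normIntCLM_apply h2, sShift_apply, e, map_sum, map_sum,
        Finset.smul_sum]
      refine Finset.sum_congr rfl fun j _ => ?_
      rw [normIntCLM_apply h1, normIntCLM_apply h2]
      exact normInt_schwP ha j _
    have h4 : sKer φ = contract sX sX φ - (2 : ℂ) • contract sX sE (contract sX sI φ) := by
      rw [← weylClifford_single.int_ext]
      simp only [sKer, kerOp, LinearMap.sub_apply, LinearMap.comp_apply]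
      module
    rw [h3, h4, ← normIntCLM_apply h2, map_sub, map_smul, normIntCLM_apply h2, normInt_sX_sq,
      normIntCLM_apply h2]
    module

end Riesz

/-! ### The meromorphic continuation of the Riesz distribution -/

section Continuation

open MeasureTheory Set FourierTransform Filter

variable {n : ℕ} [NeZero n]

/-- The factor of the Riesz distribution that has no zeros and no poles. -/
def rieszCst (n : ℕ) (σ : ℂ) : ℂ := (Real.pi : ℂ) ^ (-(n : ℂ) / 2) * (2 : ℂ) ^ (-σ - n + 1)

omit [NeZero n] in
theorem differentiable_rieszCst : Differentiable ℂ (rieszCst n) := by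
  unfold rieszCst
  intro σ
  have h : DifferentiableAt ℂ (fun σ : ℂ => (2 : ℂ) ^ (-σ - n + 1)) σ :=
    DifferentiableAt.const_cpow (by fun_prop) (Or.inl two_ne_zero)
  exact h.const_mul _

omit [NeZero n] in
theorem rieszCst_add_two (σ : ℂ) : rieszCst n σ = 4 * rieszCst n (σ + 2) := by
  have h : -σ - n + 1 = (-(σ + 2) - n + 1) + (2 : ℕ) := by push_cast; ring
  rw [rieszCst, rieszCst, h, Complex.cpow_add _ _ two_ne_zero, Complex.cpow_natCast]
  ring

/-- The integral on the Fourier side of the functional equation. -/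
def spectralInt (σ : ℂ) : SForm n →L[ℂ] ExtAlg n :=
  ((Real.pi : ℂ) ^ (-σ - n / 2) * (Complex.Gamma (-σ / 2))⁻¹) •
    (normIntCLM (-σ - n)).comp (fourierCLM ℂ (SForm n))

theorem spectralInt_apply {σ : ℂ} (hσ : σ.re < 0) (φ : SForm n) :
    spectralInt σ φ = ((Real.pi : ℂ) ^ (-σ - n / 2) * (Complex.Gamma (-σ / 2))⁻¹) •
      normInt (-σ - n) (𝓕 φ : SForm n) := by
  rw [← normIntCLM_apply (by simp; linarith)]
  rfl

theorem differentiableAt_spectralInt {σ : ℂ} (hσ : σ.re < 0) (φ : SForm n) :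
    DifferentiableAt ℂ (fun σ => spectralInt σ φ) σ := by
  have h1 : DifferentiableAt ℂ (fun σ : ℂ => normInt (-σ - n) (𝓕 φ : SForm n)) σ :=
    DifferentiableAt.comp (f := fun σ : ℂ => -σ - n)
      (g := fun a => normInt a (𝓕 φ : SForm n)) σ
      (differentiableAt_normInt _ (by simp; linarith)) (by fun_prop)
  have h2 : DifferentiableAt ℂ (fun σ : ℂ => (Complex.Gamma (-σ / 2))⁻¹) σ :=
    DifferentiableAt.comp (f := fun σ : ℂ => -σ / 2)
      (g := fun a => (Complex.Gamma a)⁻¹) σ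
      (Complex.differentiable_one_div_Gamma _) (by fun_prop)
  have h3 : DifferentiableAt ℂ (fun σ : ℂ => (Real.pi : ℂ) ^ (-σ - n / 2)) σ :=
    DifferentiableAt.const_cpow (by fun_prop) (Or.inl (by simp [Real.pi_ne_zero]))
  have ho : IsOpen {σ : ℂ | σ.re < 0} := isOpen_lt Complex.continuous_re continuous_const
  refine ((h3.mul h2).smul h1).congr_of_eventuallyEq ?_
  filter_upwards [ho.mem_nhds hσ] with τ hτ using spectralInt_apply hτ φ

/-- The Riesz distribution without its factor `Γ(1 - σ / 2)`. -/
def rieszReg (σ : ℂ) : SForm n →L[ℂ] ExtAlg n :=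
  if h : -(n : ℝ) < σ.re then
    (rieszCst n σ * (Complex.Gamma ((σ + n) / 2))⁻¹) • (exists_kerIntCLM h).choose
  else rieszCst n σ • (spectralInt σ + (2 / σ) • (spectralInt σ).comp sShift)

theorem rieszReg_apply {σ : ℂ} (h : -(n : ℝ) < σ.re) (φ : SForm n) :
    rieszReg σ φ = (rieszCst n σ * (Complex.Gamma ((σ + n) / 2))⁻¹) •
      normInt (σ - 2) (sKer φ) := by
  rw [rieszReg, dif_pos h, smul_apply, (exists_kerIntCLM h).choose_spec φ]

/-- On the strip -n < Re σ < 0 the two branches of the definition agree by the functional equation.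
Division by σ is harmless since Re σ < 0. -/
theorem rieszReg_apply_of_neg {σ : ℂ} (h : σ.re < 0) (φ : SForm n) :
    rieszReg σ φ = rieszCst n σ • (spectralInt σ φ + (2 / σ) • spectralInt σ (sShift φ)) := by
  by_cases h1 : -(n : ℝ) < σ.re
  · have h0 : σ ≠ 0 := by rintro rfl; simp at h
    have h2 := smul_normInt_sKer φ h1
    have h3 : normInt (σ - 2) (sKer φ)
        = normInt σ φ + (2 / σ) • normInt σ (sShift φ) := by
      rw [← smul_right_inj h0, h2, smul_add, smul_smul, mul_div_cancel₀ _ h0]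
    rw [rieszReg_apply h1, h3, spectralInt_apply h, spectralInt_apply h,
      ← normInt_functional_equation φ h1 h, ← normInt_functional_equation (sShift φ) h1 h]
    module
  · rw [rieszReg, dif_neg h1]
    rfl

/-- The half-planes Re σ > -n and Re σ < 0 cover the plane because n ≥ 1, and each carries a
holomorphic formula; reciprocal Gamma factors are entire. -/
theorem differentiable_rieszReg (φ : SForm n) : Differentiable ℂ fun σ => rieszReg σ φ := by
  intro σ
  have hc := (differentiable_rieszCst (n := n)) σ
  by_cases h : -(n : ℝ) < σ.re
  · have ho : IsOpen {σ : ℂ | -(n : ℝ) < σ.re} :=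
      isOpen_lt continuous_const Complex.continuous_re
    have h2 : DifferentiableAt ℂ (fun σ : ℂ => (Complex.Gamma ((σ + n) / 2))⁻¹) σ :=
      DifferentiableAt.comp (f := fun σ : ℂ => (σ + n) / 2)
        (g := fun a => (Complex.Gamma a)⁻¹) σ
        (Complex.differentiable_one_div_Gamma _) (by fun_prop)
    refine ((hc.mul h2).smul (differentiableAt_normInt_sKer φ h)).congr_of_eventuallyEq ?_
    filter_upwards [ho.mem_nhds h] with τ hτ using rieszReg_apply hτ φ
  · have hn : (1 : ℝ) ≤ n := by exact_mod_cast Nat.one_le_iff_ne_zero.2 (NeZero.ne n)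
    have h' : σ.re < 0 := by linarith
    have h0 : σ ≠ 0 := by rintro rfl; simp at h'
    have ho : IsOpen {σ : ℂ | σ.re < 0} := isOpen_lt Complex.continuous_re continuous_const
    have h1 : DifferentiableAt ℂ (fun σ : ℂ => 2 / σ) σ :=
      (differentiableAt_const _).div differentiableAt_id h0
    refine (hc.smul ((differentiableAt_spectralInt h' φ).add
      (h1.smul (differentiableAt_spectralInt h' (sShift φ))))).congr_of_eventuallyEq ?_
    filter_upwards [ho.mem_nhds h'] with τ hτ using rieszReg_apply_of_neg hτ φ

/-- The Riesz distribution as a tempered distribution. -/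
def rieszCLM (σ : ℂ) : SForm n →L[ℂ] ExtAlg n := Complex.Gamma (1 - σ / 2) • rieszReg σ

theorem analyticAt_rieszCLM {σ : ℂ} (hσ : ∀ m : ℕ, σ ≠ 2 * (m + 1)) (φ : SForm n) :
    AnalyticAt ℂ (fun σ => rieszCLM σ φ) σ := by
  have ho : IsOpen {σ : ℂ | ∀ m : ℕ, 1 - σ / 2 ≠ -m} := by
    -- `Complex.Gamma` has the value 0 at its poles and nowhere else, so avoiding the poles means
    -- that the entire function 1/Γ does not vanish, which is an open condition.
    have : {σ : ℂ | ∀ m : ℕ, 1 - σ / 2 ≠ -m} = {σ : ℂ | (Complex.Gamma (1 - σ / 2))⁻¹ ≠ 0} := by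
      ext τ
      simp only [mem_ofPred_eq, ne_eq, inv_eq_zero, Complex.Gamma_eq_zero_iff, not_exists]
    rw [this]
    refine isOpen_ne.preimage ?_
    exact Complex.differentiable_one_div_Gamma.continuous.comp (by fun_prop)
  have hmem : σ ∈ {σ : ℂ | ∀ m : ℕ, 1 - σ / 2 ≠ -m} := by
    intro m hm
    exact hσ m (by linear_combination (-2 : ℂ) * hm)
  rw [Complex.analyticAt_iff_eventually_differentiableAt]
  filter_upwards [ho.mem_nhds hmem] with τ hτ
  have h2 : DifferentiableAt ℂ (fun σ : ℂ => Complex.Gamma (1 - σ / 2)) τ :=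
    DifferentiableAt.comp (f := fun σ : ℂ => 1 - σ / 2) (g := Complex.Gamma) τ
      (Complex.differentiableAt_Gamma _ hτ) (by fun_prop)
  exact h2.smul (differentiable_rieszReg φ τ)

theorem rieszCLM_eq_rieszIntegral {σ : ℂ} (h : -(n : ℝ) < σ.re) (φ : SForm n) :
    rieszCLM σ φ = rieszIntegral σ φ := by
  have e : rieszIntegral σ φ = (rieszCst n σ *
      (Complex.Gamma (-σ / 2 + 1) / Complex.Gamma ((σ + n) / 2))) • normInt (σ - 2) (sKer φ) := by
    simp only [rieszIntegral, normInt, sKer_apply, rieszCst]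
  rw [e, rieszCLM, smul_apply, rieszReg_apply h, smul_smul,
    show 1 - σ / 2 = -σ / 2 + 1 by ring]
  congr 1
  ring

/-- Passing to normal form changes nothing near points of analyticity. The possible exceptions 2, 4,
6, ... lie outside the strip on which the integral prescribes the values. -/
theorem exists_isRieszContinuation (φ : SForm n) : ∃ g, IsRieszContinuation φ g ∧
    ∀ σ : ℂ, (∀ m : ℕ, σ ≠ 2 * (m + 1)) → g σ = rieszCLM σ φ ∧ AnalyticAt ℂ g σ := by
  set F : ℂ → ExtAlg n := fun σ => rieszCLM σ φ with hF
  have hm : MeromorphicOn F univ := by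
    intro σ _
    have h1 : MeromorphicAt (fun σ : ℂ => Complex.Gamma (1 - σ / 2)) σ :=
      (Meromorphic.Gamma _).comp_analyticAt (g := fun σ : ℂ => 1 - σ / 2) (by fun_prop)
    have h2 : AnalyticAt ℂ (fun σ => rieszReg σ φ) σ := (differentiable_rieszReg φ).analyticAt σ
    exact h1.smul h2.meromorphicAt
  have key (σ : ℂ) (hσ : ∀ m : ℕ, σ ≠ 2 * (m + 1)) : toMeromorphicNFOn F univ =ᶠ[nhds σ] F := by
    have h1 := toMeromorphicNFOn_eq_toMeromorphicNFAt_on_nhds hm (mem_univ σ)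
    rwa [toMeromorphicNFAt_eq_self.2 (analyticAt_rieszCLM hσ φ).meromorphicNFAt] at h1
  refine ⟨toMeromorphicNFOn F univ, ⟨meromorphicNFOn_toMeromorphicNFOn F univ, ?_⟩, ?_⟩
  · intro s h1 h2
    rw [← rieszCLM_eq_rieszIntegral h1]
    refine (key s fun m hm => ?_).eq_of_nhds
    rw [hm] at h2
    have : (2 * ((m : ℂ) + 1)).re = 2 * (m + 1) := by simp
    rw [this] at h2
    have : (0 : ℝ) ≤ m := m.cast_nonneg
    linarith
  · exact fun σ hσ => ⟨(key σ hσ).eq_of_nhds, (analyticAt_rieszCLM hσ φ).congr (key σ hσ).symm⟩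

theorem rieszDefined {σ : ℂ} (hσ : ∀ m : ℕ, σ ≠ 2 * (m + 1)) (φ : SForm n) :
    RieszDefined σ φ := by
  obtain ⟨g, hg, h⟩ := exists_isRieszContinuation φ
  exact ⟨g, hg, (h σ hσ).2⟩

theorem rieszPairing_eq {σ : ℂ} (hσ : ∀ m : ℕ, σ ≠ 2 * (m + 1)) (φ : SForm n) :
    rieszPairing σ φ = rieszCLM σ φ := by
  obtain ⟨g, hg, h⟩ := exists_isRieszContinuation φ
  have he : ∃ g, IsRieszContinuation φ g := ⟨g, hg⟩
  rw [rieszPairing, dif_pos he, he.choose_spec.unique (Nat.one_le_iff_ne_zero.2 (NeZero.ne n)) hg]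
  exact (h σ hσ).1

theorem eq_of_eq_on_right_univ {V : Type*} [NormedAddCommGroup V] [NormedSpace ℂ V]
    [CompleteSpace V] {f g : ℂ → V} {c : ℝ} (hf : Differentiable ℂ f) (hg : Differentiable ℂ g)
    (h : ∀ a : ℂ, c < a.re → f a = g a) (a : ℂ) : f a = g a :=
  eq_of_eq_on_right (c := a.re - 1) (fun a _ => hf a) (fun a _ => hg a) h (by linarith)

omit [NeZero n] in
theorem inv_Gamma_add_two {σ : ℂ} (h : σ + n ≠ 0) : (Complex.Gamma ((σ + 2 + n) / 2))⁻¹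
    = 2 * (σ + n)⁻¹ * (Complex.Gamma ((σ + n) / 2))⁻¹ := by
  rw [show (σ + 2 + n) / 2 = (σ + n) / 2 + 1 by ring, Complex.Gamma_add_one _ (by simpa using h)]
  field_simp

theorem sKer_identities {k : ℕ} {φ : SForm n} (hφ : contract sE sI φ = (k : ℂ) • φ) (j : Fin n)
    {σ : ℂ} (hσ : 2 < σ.re) {s : ℂ} (hs : σ = -s - n) :
    normInt σ (sKer (boxOp k s sP sE sI φ))
        = -(kap n k s * (s * (s + n))) • normInt (σ - 2) (sKer φ) ∧
      normInt σ (sKer (gradOp k s sP sE sI j φ))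
        = (kap n k s * (s * (s + n))) • normInt (σ - 2) (sKer (sX j φ)) := by
  have hn : (0 : ℝ) ≤ n := n.cast_nonneg
  have h1 : -(n : ℝ) < σ.re := by linarith
  have h2 : -(n : ℝ) < (σ - 2).re := by simp; linarith
  have hP (j : Fin n) (v : SForm n) : (normIntCLM σ).toLinearMap (sP j v)
      = -σ • (normIntCLM (σ - 2)).toLinearMap (sX j v) := by
    simp only [ContinuousLinearMap.coe_coe, normIntCLM_apply h1, normIntCLM_apply h2]
    exact normInt_schwP hσ j v
  have hr (v : SForm n) : (normIntCLM (σ - 2)).toLinearMap (contract sX sX v)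
      = (normIntCLM σ).toLinearMap v := by
    simp only [ContinuousLinearMap.coe_coe, normIntCLM_apply h1, normIntCLM_apply h2]
    exact normInt_sX_sq σ v
  have := weylClifford_single.kerOp_boxOp hP hr hφ hs
  have := weylClifford_single.kerOp_gradOp hP hr hφ hs j
  simp only [ContinuousLinearMap.coe_coe, normIntCLM_apply h1, normIntCLM_apply h2] at *
  exact ⟨‹_›, ‹_›⟩

/-- The normalizing factors at σ and σ + 2 are compared: the powers of two differ by 4 and the Gamma
factors by 2/(σ + n), where σ + n = -s. -/
theorem rieszReg_identities {k : ℕ} {φ : SForm n} (hφ : contract sE sI φ = (k : ℂ) • φ)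
    (j : Fin n) {σ : ℂ} (hσ : 2 < σ.re) {s : ℂ} (hs : σ = -s - n) :
    rieszReg (σ + 2) (boxOp k s sP sE sI φ) = (kap n k s * (-σ / 2)) • rieszReg σ φ ∧
      rieszReg (σ + 2) (gradOp k s sP sE sI j φ)
        = (kap n k s * (σ / 2)) • rieszReg σ (sX j φ) ∧
      rieszReg σ (contract sX sX φ) = (-2 * s) • rieszReg (σ + 2) φ := by
  have hn : (0 : ℝ) ≤ n := n.cast_nonneg
  have h0 : σ + n ≠ 0 := by
    intro h
    have := congrArg Complex.re h
    simp at this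
    linarith
  have hs' : s ≠ 0 := by
    rintro rfl
    simp [hs] at h0
  obtain ⟨h1, h2⟩ := sKer_identities hφ j hσ hs
  have e1 : -(n : ℝ) < σ.re := by linarith
  have e2 : -(n : ℝ) < (σ + 2).re := by simp; linarith
  have h3 : normInt (σ - 2) (sKer (contract sX sX φ)) = normInt σ (sKer φ) := by
    rw [sKer, weylClifford_single.kerOp_sq, normInt_sX_sq]
  have e3 : σ + n = -s := by rw [hs]; ring
  simp only [rieszReg_apply e1, rieszReg_apply e2, add_sub_cancel_right, h1, h2, h3, smul_smul,
    inv_Gamma_add_two h0, rieszCst_add_two σ]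
  refine ⟨?_, ?_, ?_⟩
  all_goals
    congr 1
    rw [e3, hs]
    field_simp
    try ring

theorem differentiable_rieszReg_add_two (φ : SForm n) :
    Differentiable ℂ fun σ => rieszReg (σ + 2) φ :=
  (differentiable_rieszReg φ).comp (differentiable_id.add_const 2)

/-- The coefficients of the differential operator are polynomials in σ, so both sides are entire and
equality for Re σ > 2 suffices. -/
theorem rieszReg_boxOp {k : ℕ} {φ : SForm n} (hφ : contract sE sI φ = (k : ℂ) • φ) (σ : ℂ) :
    rieszReg (σ + 2) (boxOp k (-σ - n) sP sE sI φ)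
      = (kap n k (-σ - n) * (-σ / 2)) • rieszReg σ φ := by
  refine eq_of_eq_on_right_univ (c := 2)
    (f := fun σ => rieszReg (σ + 2) (boxOp k (-σ - n) sP sE sI φ))
    (g := fun σ => (kap n k (-σ - n) * (-σ / 2)) • rieszReg σ φ) ?_ ?_ ?_ σ
  · simp only [boxOp, LinearMap.add_apply, LinearMap.smul_apply, LinearMap.comp_apply, map_add,
      map_smul, alpha, beta]
    have h1 := differentiable_rieszReg_add_two (codOp sP sI (dOp sP sE φ))
    have h2 := differentiable_rieszReg_add_two (dOp sP sE (codOp sP sI φ))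
    fun_prop
  · have h1 := differentiable_rieszReg φ
    simp only [kap]
    fun_prop
  · exact fun a ha => (rieszReg_identities hφ 0 ha (by ring)).1

theorem rieszReg_gradOp {k : ℕ} {φ : SForm n} (hφ : contract sE sI φ = (k : ℂ) • φ) (j : Fin n)
    (σ : ℂ) : rieszReg (σ + 2) (gradOp k (-σ - n) sP sE sI j φ)
      = (kap n k (-σ - n) * (σ / 2)) • rieszReg σ (sX j φ) := by
  refine eq_of_eq_on_right_univ (c := 2)
    (f := fun σ => rieszReg (σ + 2) (gradOp k (-σ - n) sP sE sI j φ))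
    (g := fun σ => (kap n k (-σ - n) * (σ / 2)) • rieszReg σ (sX j φ)) ?_ ?_ ?_ σ
  · simp only [gradOp, LinearMap.add_apply, LinearMap.sub_apply, LinearMap.smul_apply,
      LinearMap.comp_apply, map_add, map_sub, map_smul, gam, del, kap]
    have h1 := differentiable_rieszReg_add_two (codOp sP sI (sE j φ))
    have h2 := differentiable_rieszReg_add_two (dOp sP sE (sI j φ))
    have h3 := differentiable_rieszReg_add_two (sP j φ)
    fun_prop
  · have h1 := differentiable_rieszReg (sX j φ)
    simp only [kap]
    fun_prop
  · exact fun a ha => (rieszReg_identities hφ j ha (by ring)).2.1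

theorem rieszReg_sq {k : ℕ} {φ : SForm n} (hφ : contract sE sI φ = (k : ℂ) • φ) (σ : ℂ) :
    rieszReg σ (contract sX sX φ) = (-2 * (-σ - n)) • rieszReg (σ + 2) φ := by
  refine eq_of_eq_on_right_univ (c := 2)
    (f := fun σ => rieszReg σ (contract sX sX φ))
    (g := fun σ => (-2 * (-σ - n)) • rieszReg (σ + 2) φ) ?_ ?_ ?_ σ
  · exact differentiable_rieszReg _
  · have h1 := differentiable_rieszReg_add_two φ
    fun_prop
  · exact fun a ha => (rieszReg_identities hφ 0 ha (by ring)).2.2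

/-- The only place where σ ≠ 0 is needed; for σ = -s - n this is the exclusion of s = -n. -/
theorem Gamma_one_sub_half {σ : ℂ} (h : σ ≠ 0) :
    Complex.Gamma (1 - σ / 2) = -σ / 2 * Complex.Gamma (1 - (σ + 2) / 2) := by
  rw [show 1 - σ / 2 = -σ / 2 + 1 by ring, Complex.Gamma_add_one _ (by simpa using h)]
  congr 2
  ring

theorem rieszCLM_boxOp {k : ℕ} {φ : SForm n} (hφ : contract sE sI φ = (k : ℂ) • φ) {σ : ℂ}
    (h : σ ≠ 0) : rieszCLM (σ + 2) (boxOp k (-σ - n) sP sE sI φ)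
      = kap n k (-σ - n) • rieszCLM σ φ := by
  simp only [rieszCLM, smul_apply, rieszReg_boxOp hφ, Gamma_one_sub_half h, smul_smul]
  congr 1
  ring

theorem rieszCLM_gradOp {k : ℕ} {φ : SForm n} (hφ : contract sE sI φ = (k : ℂ) • φ) (j : Fin n)
    {σ : ℂ} (h : σ ≠ 0) : rieszCLM (σ + 2) (gradOp k (-σ - n) sP sE sI j φ)
      = -kap n k (-σ - n) • rieszCLM σ (sX j φ) := by
  simp only [rieszCLM, smul_apply, rieszReg_gradOp hφ, Gamma_one_sub_half h, smul_smul]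
  congr 1
  ring

theorem rieszCLM_sq {k : ℕ} {φ : SForm n} (hφ : contract sE sI φ = (k : ℂ) • φ) {σ : ℂ}
    (h : σ ≠ 0) : rieszCLM σ (contract sX sX φ) = (σ * (-σ - n)) • rieszCLM (σ + 2) φ := by
  simp only [rieszCLM, smul_apply, rieszReg_sq hφ, Gamma_one_sub_half h, smul_smul]
  congr 1
  ring

end Continuation

/-! ### Slices of Schwartz functions -/

section Slices

open Set

variable {E F G V W : Type*} [NormedAddCommGroup E] [NormedSpace ℝ E]
  [NormedAddCommGroup F] [NormedSpace ℝ F] [NormedAddCommGroup G] [NormedSpace ℝ G]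
  [NormedAddCommGroup V] [NormedSpace ℂ V] [NormedAddCommGroup W] [NormedSpace ℂ W]

/-- Induction on the order, interchanging the new direction with the fixed one by symmetry of the
second derivative. -/
theorem fderiv_iteratedFDeriv_apply {f : E → G} (hf : ContDiff ℝ (⊤ : ℕ∞) f) (m : ℕ) (p h : E) :
    fderiv ℝ (iteratedFDeriv ℝ m f) p h = iteratedFDeriv ℝ m (fun q => fderiv ℝ f q h) p := by
  induction m generalizing p with
  | zero =>
    ext v
    have h1 := (hf.differentiable (by simp) p).hasFDerivAt
    have h2 := ((continuousMultilinearCurryFin0 ℝ E G).symm.toContinuousLinearEquiv.hasFDerivAt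
      (x := f p)).comp p h1
    rw [iteratedFDeriv_zero_eq_comp]
    erw [h2.fderiv]
    simp
  | succ m ih =>
    ext v
    have h1 : ContDiff ℝ (⊤ : ℕ∞) (iteratedFDeriv ℝ m f) :=
      hf.iteratedFDeriv_right (by exact_mod_cast le_top)
    have h2 : ContDiff ℝ (⊤ : ℕ∞) (fderiv ℝ (iteratedFDeriv ℝ m f)) :=
      h1.fderiv_right (by simp)
    have h3 := (h2.differentiable (by simp) p).hasFDerivAt
    have h4 := ((continuousMultilinearCurryLeftEquiv ℝ (fun _ : Fin (m + 1) => E)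
      G).symm.toContinuousLinearEquiv.hasFDerivAt
      (x := fderiv ℝ (iteratedFDeriv ℝ m f) p)).comp p h3
    have h5 : fderiv ℝ (iteratedFDeriv ℝ (m + 1) f) p = _ := h4.fderiv
    have hs : IsSymmSndFDerivAt ℝ (iteratedFDeriv ℝ m f) p :=
      h1.contDiffAt.isSymmSndFDerivAt (by
        rw [minSmoothness_of_isRCLikeNormedField]
        exact WithTop.coe_le_coe.2 (le_top : (2 : ℕ∞) ≤ ⊤))
    have h6 : fderiv ℝ (fun q => fderiv ℝ (iteratedFDeriv ℝ m f) q h) p (v 0)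
        = fderiv ℝ (fderiv ℝ (iteratedFDeriv ℝ m f)) p (v 0) h := by
      rw [fderiv_clm_apply (h2.differentiable (by simp) p) (differentiableAt_const h)]
      simp
    rw [iteratedFDeriv_succ_apply_left, ← funext ih, h6, ← hs.eq, h5]
    rfl

set_option maxSynthPendingDepth 3 in
theorem norm_fderiv_fderiv_iteratedFDeriv (f : E → G) (m : ℕ) (q : E) :
    ‖fderiv ℝ (fderiv ℝ (iteratedFDeriv ℝ m f)) q‖ = ‖iteratedFDeriv ℝ (m + 2) f q‖ := by
  rw [← norm_fderiv_iteratedFDeriv, iteratedFDeriv_succ_eq_comp_left,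
    LinearIsometryEquiv.comp_fderiv]
  exact (LinearIsometry.norm_toContinuousLinearMap_comp
    (continuousMultilinearCurryLeftEquiv ℝ (fun _ : Fin (m + 1) => E)
      G).symm.toLinearIsometry).symm

/-- The mean value inequality is applied first to the derivative and then to the function minus its
linear part. The constant weight `c` makes room for the polynomial weight of a Schwartz seminorm. -/
theorem taylor_bound {A : E → G} (h1 : Differentiable ℝ A) (h2 : Differentiable ℝ (fderiv ℝ A))
    {c M : ℝ} (hc : 0 ≤ c) (p h : E)
    (hM : ∀ q ∈ segment ℝ p (p + h), c * ‖fderiv ℝ (fderiv ℝ A) q‖ ≤ M) :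
    c * ‖A (p + h) - A p - fderiv ℝ A p h‖ ≤ M * ‖h‖ ^ 2 := by
  have hp := left_mem_segment ℝ p (p + h)
  have hM0 : 0 ≤ M := le_trans (by positivity) (hM p hp)
  rcases hc.eq_or_lt with rfl | hc
  · rw [zero_mul]; positivity
  have hs : Convex ℝ (segment ℝ p (p + h)) := convex_segment _ _
  have hq : ∀ q ∈ segment ℝ p (p + h), ‖fderiv ℝ A q - fderiv ℝ A p‖ ≤ M / c * ‖h‖ := by
    intro q hq
    have e := hs.norm_image_sub_le_of_norm_fderiv_le (f := fderiv ℝ A) (𝕜 := ℝ) (C := M / c)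
      (fun x _ => h2 x) (fun x hx => by rw [le_div_iff₀ hc, mul_comm]; exact hM x hx) hp hq
    refine e.trans ?_
    have : ‖q - p‖ ≤ ‖h‖ := by
      obtain ⟨a, b, ha, hb, hab, rfl⟩ := hq
      have : a • p + b • (p + h) - p = b • h := by
        rw [smul_add, ← add_assoc, ← add_smul, hab, one_smul, add_sub_cancel_left]
      rw [this, norm_smul, Real.norm_of_nonneg hb]
      nlinarith [norm_nonneg h]
    gcongr
  have e := hs.norm_image_sub_le_of_norm_fderiv_le' (f := A) (𝕜 := ℝ) (fun x _ => h1 x) hq hp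
    (right_mem_segment ℝ p (p + h))
  rw [add_sub_cancel_left] at e
  calc _ ≤ c * (M / c * ‖h‖ * ‖h‖) := by gcongr
    _ = _ := by field_simp

theorem hasTemperateGrowth_slice (x : E) : (fun y : F => (x, y)).HasTemperateGrowth := by
  have h : (fun y : F => (x, y)) = fun y : F => (x, (0 : F)) + ContinuousLinearMap.inr ℝ E F y := by
    funext y
    simp
  rw [h]
  fun_prop

/-- The Schwartz function `y ↦ w (x, y)`. -/
def slice (x : E) : 𝓢(E × F, V) →L[ℂ] 𝓢(F, V) :=
  SchwartzMap.compCLM ℂ (g := fun y => (x, y)) (hasTemperateGrowth_slice x)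
    ⟨1, 1, fun y => by
      have : ‖y‖ ≤ ‖(x, y)‖ := le_max_right _ _
      linarith⟩

@[simp] theorem slice_apply (x : E) (w : 𝓢(E × F, V)) (y : F) : slice x w y = w (x, y) := rfl

theorem norm_iteratedFDeriv_slice_le (m : ℕ) (x : E) (w : 𝓢(E × F, V)) (y : F) :
    ‖iteratedFDeriv ℝ m (slice x w) y‖ ≤ ‖iteratedFDeriv ℝ m w (x, y)‖ := by
  have e : (slice x w : F → V) = (fun p => w ((x, 0) + p)) ∘ ContinuousLinearMap.inr ℝ E F := by
    funext y
    simp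
  have hs : ContDiff ℝ (⊤ : ℕ∞) fun p => w ((x, 0) + p) :=
    (w.smooth _).comp (contDiff_const.add contDiff_id)
  rw [e, ContinuousLinearMap.iteratedFDeriv_comp_right _ hs _ (i := m) (by exact_mod_cast le_top),
    iteratedFDeriv_comp_add_left]
  refine (ContinuousMultilinearMap.norm_compContinuousLinearMap_le _ _).trans ?_
  have h1 : ‖ContinuousLinearMap.inr ℝ E F‖ ≤ 1 := ContinuousLinearMap.norm_inr_le_one ℝ E F
  have h2 : ∏ _i : Fin m, ‖ContinuousLinearMap.inr ℝ E F‖ ≤ 1 :=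
    Finset.prod_le_one (fun _ _ => norm_nonneg _) fun _ _ => h1
  simpa using mul_le_mul_of_nonneg_left h2 (norm_nonneg (iteratedFDeriv ℝ m w (x, y)))

theorem exists_seminorm_bound (T : 𝓢(F, V) →L[ℂ] W) : ∃ (s : Finset (ℕ × ℕ)) (C : ℝ), 0 ≤ C ∧
    ∀ φ, ‖T φ‖ ≤ C * ∑ i ∈ s, SchwartzMap.seminorm ℂ i.1 i.2 φ := by
  obtain ⟨s, C, -, h⟩ := Seminorm.bound_of_continuous (schwartz_withSeminorms ℂ F V)
    ((normSeminorm ℂ W).comp T.toLinearMap) (continuous_norm.comp T.continuous)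
  refine ⟨s, C, C.2, fun φ => (h φ).trans ?_⟩
  have h2 := Seminorm.finset_sup_le_sum (schwartzSeminormFamily ℂ F V) s φ
  rw [show (∑ i ∈ s, schwartzSeminormFamily ℂ F V i) φ
    = ∑ i ∈ s, SchwartzMap.seminorm ℂ i.1 i.2 φ by simp [schwartzSeminormFamily]] at h2
  exact mul_le_mul_of_nonneg_left h2 C.2

/-- Both ‖x‖ and ‖y‖ are at most ‖(x, y)‖, so decay in x is bought with a higher weight on the
product. -/
theorem pow_mul_seminorm_slice_le (a k m : ℕ) (x : E) (w : 𝓢(E × F, V)) :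
    ‖x‖ ^ a * SchwartzMap.seminorm ℂ k m (slice x w) ≤ SchwartzMap.seminorm ℂ (a + k) m w := by
  have h (y : F) : ‖x‖ ^ a * (‖y‖ ^ k * ‖iteratedFDeriv ℝ m (slice x w) y‖)
      ≤ SchwartzMap.seminorm ℂ (a + k) m w := by
    refine le_trans ?_ (SchwartzMap.le_seminorm ℂ (a + k) m w (x, y))
    rw [pow_add, mul_assoc]
    gcongr
    · exact le_max_left _ _
    · exact le_max_right _ _
    · exact norm_iteratedFDeriv_slice_le m x w y
  rcases (show 0 ≤ ‖x‖ ^ a by positivity).eq_or_lt with h0 | h0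
  · rw [← h0, zero_mul]
    exact apply_nonneg _ _
  · rw [mul_comm, ← le_div_iff₀ h0]
    refine SchwartzMap.seminorm_le_bound ℂ k m _ (by positivity) fun y => ?_
    rw [le_div_iff₀ h0, mul_comm]
    exact h y

/-- The difference is the slice of a first-order Taylor remainder on the product, and derivatives of
that remainder are Taylor remainders of derivatives. -/
theorem seminorm_slice_remainder_le (k m : ℕ) (x h : E) (w : 𝓢(E × F, V)) :
    SchwartzMap.seminorm ℂ k m (slice (x + h) w - slice x w - slice x (schwP (h, 0) w))
      ≤ SchwartzMap.seminorm ℂ k (m + 2) w * ‖h‖ ^ 2 := by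
  set R : 𝓢(E × F, V) := SchwartzMap.compSubConstCLM ℂ (-(h, 0)) w - w - schwP (h, 0) w with hR
  have e : slice (x + h) w - slice x w - slice x (schwP (h, 0) w) = slice x R := by
    ext y
    simp [hR]
  have hs := w.smooth (⊤ : ℕ∞)
  rw [e]
  refine SchwartzMap.seminorm_le_bound ℂ k m _ (by positivity) fun y => ?_
  have h1 : iteratedFDeriv ℝ m R (x, y) = iteratedFDeriv ℝ m w ((x, y) + (h, 0))
      - iteratedFDeriv ℝ m w (x, y) - fderiv ℝ (iteratedFDeriv ℝ m w) (x, y) (h, 0) := by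
    have e2 : (R : E × F → V) = ((fun p => w (p + (h, 0))) - ⇑w) - fun p => fderiv ℝ w p (h, 0) := by
      funext p
      simp only [hR, sub_apply, SchwartzMap.compSubConstCLM_apply, sub_neg_eq_add, schwP_apply,
        Pi.sub_apply]
    have s1 : ContDiff ℝ (⊤ : ℕ∞) fun p => w (p + (h, 0)) :=
      hs.comp (contDiff_id.add contDiff_const)
    have s2 : ContDiff ℝ (⊤ : ℕ∞) fun p => fderiv ℝ w p (h, 0) :=
      (schwP (h, 0) w).smooth _
    have hm : (m : ℕ∞) ≤ ⊤ := le_top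
    have s3 : ContDiff ℝ (⊤ : ℕ∞) ((fun p => w (p + (h, 0))) - ⇑w) := s1.sub hs
    rw [e2, iteratedFDeriv_sub_apply (s3.of_le (by exact_mod_cast hm)).contDiffAt
      (s2.of_le (by exact_mod_cast hm)).contDiffAt,
      iteratedFDeriv_sub_apply (s1.of_le (by exact_mod_cast hm)).contDiffAt
      (hs.of_le (by exact_mod_cast hm)).contDiffAt, fderiv_iteratedFDeriv_apply hs,
      iteratedFDeriv_comp_add_right]
  have d1 : ContDiff ℝ (⊤ : ℕ∞) (iteratedFDeriv ℝ m w) :=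
    hs.iteratedFDeriv_right (by exact_mod_cast le_top)
  have d2 : ContDiff ℝ (⊤ : ℕ∞) (fderiv ℝ (iteratedFDeriv ℝ m w)) :=
    d1.fderiv_right (by simp)
  have hh : ‖((h, 0) : E × F)‖ = ‖h‖ := by simp
  rw [← hh]
  refine (mul_le_mul_of_nonneg_left (norm_iteratedFDeriv_slice_le m x R y)
    (by positivity)).trans ?_
  rw [h1]
  refine taylor_bound (d1.differentiable (by simp)) (d2.differentiable (by simp)) (by positivity)
    _ _ fun q hq => ?_
  -- The segment runs in the first variable only, so the weight ‖y‖^k is constant along it.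
  have hq2 : q.2 = y := by
    obtain ⟨a, b, ha, hb, hab, rfl⟩ := hq
    simp [← add_smul, hab]
  rw [norm_fderiv_fderiv_iteratedFDeriv]
  refine le_trans ?_ (SchwartzMap.le_seminorm ℂ k (m + 2) w q)
  gcongr
  rw [← hq2]
  exact le_max_right _ _

section Apply

variable {n : ℕ} (T : 𝓢(F, V) →L[ℂ] W)

theorem schwP_fst (w : 𝓢(Euc n × F, V)) (h : Euc n) :
    schwP (h, 0) w = ∑ j, (h j : ℂ) • schwP (dir j, 0) w := by
  ext p
  have e : ((h, 0) : Euc n × F) = ∑ j, h j • ((dir j, 0) : Euc n × F) := by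
    have e1 : h = ∑ j, h j • dir j := by
      ext i
      simp [dir, Pi.single_apply]
    have e2 : ∑ j, h j • ((dir j, 0) : Euc n × F)
        = ContinuousLinearMap.inl ℝ (Euc n) F (∑ j, h j • dir j) := by
      rw [map_sum]
      simp
    rw [e2, ← e1]
    rfl
  rw [sum_apply, schwP_apply, e, map_sum]
  refine Finset.sum_congr rfl fun j _ => ?_
  rw [map_smul]
  rfl

/-- The derivative of `x ↦ T (w (x, ·))`. -/
def sliceDeriv (w : 𝓢(Euc n × F, V)) (x : Euc n) : Euc n →L[ℝ] W :=
  ∑ j, ContinuousLinearMap.smulRightL ℝ (Euc n) W (coord j) (T (slice x (schwP (dir j, 0) w)))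

theorem sliceDeriv_apply (w : 𝓢(Euc n × F, V)) (x h : Euc n) :
    sliceDeriv T w x h = T (slice x (schwP (h, 0) w)) := by
  rw [schwP_fst, map_sum, map_sum, sliceDeriv, sum_apply]
  refine Finset.sum_congr rfl fun j _ => ?_
  simp

/-- A continuous functional is controlled by finitely many seminorms, each of which is O(‖h‖²) on
the Taylor remainder. -/
theorem hasFDerivAt_slice (w : 𝓢(Euc n × F, V)) (x : Euc n) :
    HasFDerivAt (fun x => T (slice x w)) (sliceDeriv T w x) x := by
  obtain ⟨s, C, hC, hT⟩ := exists_seminorm_bound T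
  rw [hasFDerivAt_iff_isLittleO_nhds_zero]
  refine Asymptotics.IsBigO.trans_isLittleO (g := fun h : Euc n => ‖h‖ ^ 2) ?_
    (Asymptotics.isLittleO_norm_pow_id one_lt_two)
  refine Asymptotics.IsBigO.of_bound (C * ∑ i ∈ s, SchwartzMap.seminorm ℂ i.1 (i.2 + 2) w)
    (Filter.Eventually.of_forall fun h => ?_)
  rw [sliceDeriv_apply, ← map_sub, ← map_sub]
  refine (hT _).trans ?_
  rw [mul_assoc, Finset.sum_mul, Real.norm_of_nonneg (by positivity)]
  gcongr with i _
  exact seminorm_slice_remainder_le i.1 i.2 x h w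

theorem fderiv_slice (w : 𝓢(Euc n × F, V)) :
    fderiv ℝ (fun x => T (slice x w)) = fun x => sliceDeriv T w x :=
  funext fun x => (hasFDerivAt_slice T w x).fderiv

theorem contDiff_slice (m : ℕ) (w : 𝓢(Euc n × F, V)) :
    ContDiff ℝ m fun x => T (slice x w) := by
  induction m generalizing w with
  | zero =>
    exact contDiff_zero.2 (continuous_iff_continuousAt.2 fun x =>
      (hasFDerivAt_slice T w x).continuousAt)
  | succ m ih =>
    have h : ContDiff ℝ (((m : ℕ) : WithTop ℕ∞) + 1) fun x => T (slice x w) := by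
      rw [contDiff_succ_iff_fderiv]
      refine ⟨fun x => (hasFDerivAt_slice T w x).differentiableAt, by simp, ?_⟩
      rw [fderiv_slice]
      exact ContDiff.sum fun j _ => (ContinuousLinearMap.contDiff _).comp (ih _)
    exact_mod_cast h

/-- The derivative is a finite sum of functions of the same shape, formed from the partial
derivatives of w; hence an induction over all w at once. -/
theorem decay_slice (a m : ℕ) (w : 𝓢(Euc n × F, V)) :
    ∃ C : ℝ, ∀ x, ‖x‖ ^ a * ‖iteratedFDeriv ℝ m (fun x => T (slice x w)) x‖ ≤ C := by
  induction m generalizing w with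
  | zero =>
    obtain ⟨s, C, hC, hT⟩ := exists_seminorm_bound T
    refine ⟨C * ∑ i ∈ s, SchwartzMap.seminorm ℂ (a + i.1) i.2 w, fun x => ?_⟩
    rw [norm_iteratedFDeriv_zero]
    calc ‖x‖ ^ a * ‖T (slice x w)‖
        ≤ ‖x‖ ^ a * (C * ∑ i ∈ s, SchwartzMap.seminorm ℂ i.1 i.2 (slice x w)) := by
          gcongr; exact hT _
      _ = C * ∑ i ∈ s, ‖x‖ ^ a * SchwartzMap.seminorm ℂ i.1 i.2 (slice x w) := by
          rw [← Finset.mul_sum]; ring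
      _ ≤ _ := by
          gcongr with i _
          exact pow_mul_seminorm_slice_le a i.1 i.2 x w
  | succ m ih =>
    choose C hC using fun j : Fin n => ih (schwP (dir j, 0) w)
    refine ⟨∑ j, ‖ContinuousLinearMap.smulRightL ℝ (Euc n) W (coord j)‖ * C j, fun x => ?_⟩
    rw [← norm_iteratedFDeriv_fderiv, fderiv_slice]
    have h1 (j : Fin n) : ContDiff ℝ m fun x => ContinuousLinearMap.smulRightL ℝ (Euc n) W (coord j)
        (T (slice x (schwP (dir j, 0) w))) :=
      (ContinuousLinearMap.contDiff _).comp (contDiff_slice T m _)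
    have h2 : iteratedFDeriv ℝ m (fun x => sliceDeriv T w x) = ∑ j, iteratedFDeriv ℝ m fun x =>
        ContinuousLinearMap.smulRightL ℝ (Euc n) W (coord j) (T (slice x (schwP (dir j, 0) w))) := by
      rw [← iteratedFDeriv_sum fun j _ => h1 j]
      rfl
    rw [h2, Finset.sum_apply]
    refine (mul_le_mul_of_nonneg_left (norm_sum_le _ _) (by positivity)).trans ?_
    rw [Finset.mul_sum]
    refine Finset.sum_le_sum fun j _ => ?_
    have h3 := ContinuousLinearMap.norm_iteratedFDeriv_comp_left
      (ContinuousLinearMap.smulRightL ℝ (Euc n) W (coord j))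
      (contDiff_slice T m (schwP (dir j, 0) w)).contDiffAt (x := x) le_rfl
    calc _ ≤ ‖x‖ ^ a * (‖ContinuousLinearMap.smulRightL ℝ (Euc n) W (coord j)‖ *
          ‖iteratedFDeriv ℝ m (fun x => T (slice x (schwP (dir j, 0) w))) x‖) := by
          gcongr; exact h3
      _ = ‖ContinuousLinearMap.smulRightL ℝ (Euc n) W (coord j)‖ * (‖x‖ ^ a *
          ‖iteratedFDeriv ℝ m (fun x => T (slice x (schwP (dir j, 0) w))) x‖) := by ring
      _ ≤ _ := by gcongr; exact hC j x

/-- The Schwartz function `x ↦ T (w (x, ·))`. -/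
def applySlice : 𝓢(Euc n × F, V) →ₗ[ℂ] 𝓢(Euc n, W) where
  toFun w :=
    { toFun := fun x => T (slice x w)
      smooth' := contDiff_infty.2 fun m => contDiff_slice T m w
      decay' := fun a m => decay_slice T a m w }
  map_add' v w := by ext x; exact congrArg T (map_add (slice x) v w) |>.trans (map_add T _ _)
  map_smul' c w := by ext x; exact congrArg T (map_smul (slice x) c w) |>.trans (map_smul T _ _)

@[simp] theorem applySlice_apply (w : 𝓢(Euc n × F, V)) (x : Euc n) :
    applySlice T w x = T (slice x w) := rfl

theorem schwP_applySlice (w : 𝓢(Euc n × F, V)) (h : Euc n) :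
    schwP h (applySlice T w) = applySlice T (schwP (h, 0) w) := by
  ext x
  have : fderiv ℝ (applySlice T w) x = sliceDeriv T w x := (hasFDerivAt_slice T w x).fderiv
  rw [schwP_apply, this, sliceDeriv_apply, applySlice_apply]

end Apply

end Slices

/-! ### Convolution rules -/

section Rules

variable {n : ℕ} {M N Y : Type*} [AddCommGroup M] [Module ℂ M] [AddCommGroup N] [Module ℂ N]
  [AddCommGroup Y] [Module ℂ Y]

/-- The maps `T` and `T'` on forms of degree `k` behave like the evaluations at `x` of the
convolutions with the Riesz distributions of parameters `-s-n` and `-s-n+2`. -/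
structure RieszRule (k : ℕ) (s : ℂ) (x : Fin n → ℂ) (X P e f : Fin n → M →ₗ[ℂ] M)
    (T T' : M →ₗ[ℂ] Y) : Prop where
  box : ∀ v, contract e f v = (k : ℂ) • v → T' (boxOp k s P e f v) = kap n k s • T v
  grad : ∀ j v, contract e f v = (k : ℂ) • v →
    T' (gradOp k s P e f j v) = kap n k s • (x j • T v - T (X j v))
  sq : ∀ v, contract e f v = (k : ℂ) • v → (s * (s + n)) • T' v
    = -∑ j, (x j ^ 2 • T v - (2 * x j) • T (X j v) + T (X j (X j v)))

theorem commute_contract {e f : Fin n → M →ₗ[ℂ] M} {e' f' : Fin n → N →ₗ[ℂ] N} {T : M →ₗ[ℂ] N}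
    (he : ∀ j v, T (e j v) = e' j (T v)) (hf : ∀ j v, T (f j v) = f' j (T v)) (v : M) :
    T (contract e f v) = contract e' f' (T v) := by
  simp only [contract_apply, map_sum, he, hf]

/-- The reflection v ↦ y - v inside a convolution reverses all derivatives. Second-order operators
are unaffected, while the first-order gradients change sign. -/
theorem boxOp_neg (k : ℕ) (s : ℂ) (P e f : Fin n → M →ₗ[ℂ] M) :
    boxOp k s (-P) e f = boxOp k s P e f := by
  ext v
  simp only [boxOp, codOp, dOp, contract_apply, LinearMap.add_apply, LinearMap.smul_apply,
    LinearMap.comp_apply, LinearMap.neg_apply, Pi.neg_apply, map_neg, Finset.sum_neg_distrib,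
    neg_neg]

theorem gradOp_neg (k : ℕ) (s : ℂ) (P e f : Fin n → M →ₗ[ℂ] M) (j : Fin n) :
    gradOp k s (-P) e f j = -gradOp k s P e f j := by
  ext v
  simp only [gradOp, codOp, dOp, contract_apply, LinearMap.add_apply, LinearMap.sub_apply,
    LinearMap.smul_apply, LinearMap.comp_apply, LinearMap.neg_apply, Pi.neg_apply, map_neg,
    Finset.sum_neg_distrib]
  module

namespace RieszRule

/-- The rules are preserved by maps that intertwine the operators. -/
theorem comp {k : ℕ} {s : ℂ} {x : Fin n → ℂ} {X P e f : Fin n → M →ₗ[ℂ] M}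
    {X' P' e' f' : Fin n → N →ₗ[ℂ] N} {T T' : N →ₗ[ℂ] Y}
    (R : RieszRule k s x X' P' e' f' T T') {A : M →ₗ[ℂ] N}
    (hX : ∀ j v, A (X j v) = X' j (A v)) (hP : ∀ j v, A (P j v) = P' j (A v))
    (he : ∀ j v, A (e j v) = e' j (A v)) (hf : ∀ j v, A (f j v) = f' j (A v)) :
    RieszRule k s x X P e f (T ∘ₗ A) (T' ∘ₗ A) := by
  have h (v : M) (hv : contract e f v = (k : ℂ) • v) :
      contract e' f' (A v) = (k : ℂ) • A v := by
    rw [← commute_contract he hf, hv, map_smul]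
  refine ⟨fun v hv => ?_, fun j v hv => ?_, fun v hv => ?_⟩
  · rw [LinearMap.comp_apply, commute_boxOp hP he hf, R.box _ (h v hv)]
    rfl
  · rw [LinearMap.comp_apply, commute_gradOp hP he hf, R.grad _ _ (h v hv), ← hX]
    rfl
  · simp only [LinearMap.comp_apply, R.sq _ (h v hv), hX]

/-- The rules are preserved by linear maps of the values. -/
theorem map {k : ℕ} {s : ℂ} {x : Fin n → ℂ} {X P e f : Fin n → M →ₗ[ℂ] M} {T T' : M →ₗ[ℂ] Y}
    (R : RieszRule k s x X P e f T T') (q : Y →ₗ[ℂ] N) :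
    RieszRule k s x X P e f (q ∘ₗ T) (q ∘ₗ T') :=
  ⟨fun v hv => by simp [R.box v hv], fun j v hv => by simp [R.grad j v hv],
    fun v hv => by simp only [LinearMap.comp_apply, ← map_smul, R.sq v hv, map_neg, map_sum,
      map_add, map_sub]⟩

/-- The rules can be checked after a separating family of linear maps of the values. -/
theorem of_forall {ι : Type*} {k : ℕ} {s : ℂ} {x : Fin n → ℂ} {X P e f : Fin n → M →ₗ[ℂ] M}
    {T T' : M →ₗ[ℂ] Y} (q : ι → Y →ₗ[ℂ] N) (hq : ∀ y, (∀ i, q i y = 0) → y = 0)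
    (R : ∀ i, RieszRule k s x X P e f (q i ∘ₗ T) (q i ∘ₗ T')) :
    RieszRule k s x X P e f T T' := by
  have ext (y z : Y) (h : ∀ i, q i y = q i z) : y = z :=
    sub_eq_zero.1 (hq _ fun i => by rw [map_sub, h i, sub_self])
  refine ⟨fun v hv => ext _ _ fun i => ?_, fun j v hv => ext _ _ fun i => ?_,
    fun v hv => ext _ _ fun i => ?_⟩
  · simpa using (R i).box v hv
  · simpa using (R i).grad j v hv
  · simpa using (R i).sq v hv

end RieszRule

/-- The identity between the tensor products of the convolutions and the operator `opE`. -/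
theorem WeylCliffordPair.apply_opEOp {X P e f X' P' e' f' : Fin n → M →ₗ[ℂ] M}
    (W : WeylCliffordPair X P e f X' P' e' f') {k l : ℕ} {s t : ℂ} {x y : Fin n → ℂ}
    {T00 T01 T10 T11 : M →ₗ[ℂ] Y}
    (R0 : RieszRule k s x X P e f T00 T10) (R1 : RieszRule k s x X P e f T01 T11)
    (S0 : RieszRule l t y X' P' e' f' T00 T01) (S1 : RieszRule l t y X' P' e' f' T10 T11) {w : M}
    (hk : contract e f w = (k : ℂ) • w) (hl : contract e' f' w = (l : ℂ) • w) :
    T11 (opEOp k l s t X P e f X' P' e' f' w)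
      = -(kap n k s * kap n l t) • (∑ j, (x j - y j) ^ 2) • T00 w := by
  have dX := W.deg_gens 0
  have dP := W.deg_gens 1
  have de := W.deg_gens 2
  have df := W.deg_gens 3
  have dX' := W.symm.deg_gens 0
  have hXX (i j : Fin n) (v : M) : X i (X' j v) = X' j (X i v) := W.comm 0 0 i j v
  have hP' (j i : Fin n) (v : M) : X j (P' i v) = P' i (X j v) := W.comm 0 1 j i v
  have he' (j i : Fin n) (v : M) : X j (e' i v) = e' i (X j v) := W.comm 0 2 j i v
  have hf' (j i : Fin n) (v : M) : X j (f' i v) = f' i (X j v) := W.comm 0 3 j i v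
  simp only [gens, Matrix.cons_val_zero, Matrix.cons_val_one, Matrix.cons_val] at dX dP de df dX'
  have dB (v : M) (h : contract e f v = (k : ℂ) • v) :
      contract e f (boxOp l t P' e' f' v) = (k : ℂ) • boxOp l t P' e' f' v := by
    rw [commute_boxOp dP de df, h, map_smul]
  have dG (j : Fin n) (v : M) (h : contract e f v = (k : ℂ) • v) :
      contract e f (gradOp l t P' e' f' j v) = (k : ℂ) • gradOp l t P' e' f' j v := by
    rw [commute_gradOp dP de df, h, map_smul]
  have hXk (j : Fin n) (v : M) (h : contract e f v = (k : ℂ) • v) :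
      contract e f (X j v) = (k : ℂ) • X j v := by rw [W.left.deg_X, h, map_smul]
  have hXl (j : Fin n) (v : M) (h : contract e' f' v = (l : ℂ) • v) :
      contract e' f' (X j v) = (l : ℂ) • X j v := by rw [dX', h, map_smul]
  have hXk' (j : Fin n) (v : M) (h : contract e f v = (k : ℂ) • v) :
      contract e f (X' j v) = (k : ℂ) • X' j v := by rw [dX, h, map_smul]
  have hXl' (j : Fin n) (v : M) (h : contract e' f' v = (l : ℂ) • v) :
      contract e' f' (X' j v) = (l : ℂ) • X' j v := by rw [W.right.deg_X, h, map_smul]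
  have hZk (j : Fin n) (v : M) (h : contract e f v = (k : ℂ) • v) :
      contract e f ((X - X') j v) = (k : ℂ) • (X - X') j v := by
    simp only [Pi.sub_apply, LinearMap.sub_apply, map_sub, hXk j v h, hXk' j v h, smul_sub]
  have hZl (j : Fin n) (v : M) (h : contract e' f' v = (l : ℂ) • v) :
      contract e' f' ((X - X') j v) = (l : ℂ) • (X - X') j v := by
    simp only [Pi.sub_apply, LinearMap.sub_apply, map_sub, hXl j v h, hXl' j v h, smul_sub]
  have h1 (v : M) (h : contract e f v = (k : ℂ) • v) (h' : contract e' f' v = (l : ℂ) • v) :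
      T11 (boxOp k s P e f (boxOp l t P' e' f' v)) = (kap n k s * kap n l t) • T00 v := by
    rw [R1.box _ (dB v h), S0.box v h', smul_smul]
  have h2 (j : Fin n) (v : M) (h : contract e f v = (k : ℂ) • v)
      (h' : contract e' f' v = (l : ℂ) • v) :
      T11 (gradOp k s P e f j (boxOp l t P' e' f' v))
        = (kap n k s * kap n l t) • (x j • T00 v - T00 (X j v)) := by
    rw [R1.grad j _ (dB v h), S0.box v h', commute_boxOp (hP' j) (he' j) (hf' j),
      S0.box _ (hXl j v h')]
    module
  have h3 (j : Fin n) (v : M) (h : contract e f v = (k : ℂ) • v)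
      (h' : contract e' f' v = (l : ℂ) • v) :
      T11 (boxOp k s P e f (gradOp l t P' e' f' j v))
        = (kap n k s * kap n l t) • (y j • T00 v - T00 (X' j v)) := by
    rw [R1.box _ (dG j v h), S0.grad j v h', smul_smul]
  have h4 (j : Fin n) (v : M) (h : contract e f v = (k : ℂ) • v)
      (h' : contract e' f' v = (l : ℂ) • v) :
      T11 (gradOp k s P e f j (gradOp l t P' e' f' j v))
        = (kap n k s * kap n l t) • (x j • (y j • T00 v - T00 (X' j v))
          - (y j • T00 (X j v) - T00 (X' j (X j v)))) := by
    rw [R1.grad j _ (dG j v h), S0.grad j v h', commute_gradOp (hP' j) (he' j) (hf' j),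
      S0.grad j _ (hXl j v h')]
    module
  -- The scalar s(s + n) is traded for a double commutator in the first variable, after the operator
  -- in the second variable has been absorbed into κ.
  have h5 : (s * (s + n) * kap n k s) • T11 (boxOp l t P' e' f' w)
      = (kap n k s * kap n l t) •
        -∑ j, (x j ^ 2 • T00 w - (2 * x j) • T00 (X j w) + T00 (X j (X j w))) := by
    rw [← R0.sq w hk, S1.box w hl]
    module
  have h6 : (t * (t + n) * kap n l t) • T11 (boxOp k s P e f w)
      = (kap n k s * kap n l t) •
        -∑ j, (y j ^ 2 • T00 w - (2 * y j) • T00 (X' j w) + T00 (X' j (X' j w))) := by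
    rw [← S0.sq w hl, R1.box w hk]
    module
  simp only [opEOp, map_add, map_sub, map_neg, map_smul, contract_apply (X - X'), map_sum,
    h1 _ (hZk _ _ (hZk _ _ hk)) (hZl _ _ (hZl _ _ hl)), h2 _ _ (hZk _ _ hk) (hZl _ _ hl),
    h3 _ _ (hZk _ _ hk) (hZl _ _ hl), h4 _ _ hk hl, h5, h6]
  -- Coordinate by coordinate, what remains is the expansion of (x_j - y_j)² T00 in iterated
  -- commutators of T00 with the multiplication by x_j - y_j.
  simp only [Pi.sub_apply, LinearMap.sub_apply, map_sub, hXX, Finset.smul_sum, Finset.sum_smul,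
    ← Finset.sum_neg_distrib, ← Finset.sum_sub_distrib, ← Finset.sum_add_distrib]
  refine Finset.sum_congr rfl fun j _ => ?_
  module

end Rules

/-! ### Convolution with the Riesz distributions on Schwartz forms -/

section Convolution

variable {n : ℕ}

/-- The reflection `φ ↦ φ (y - ·)`. -/
def reflL (y : Euc n) : SForm n →L[ℂ] SForm n :=
  SchwartzMap.compCLMOfAntilipschitz ℂ (g := fun v => y - v) (K := 1) (by fun_prop)
    (fun _ _ => by simp [edist_dist, dist_eq_norm, norm_sub_rev])

@[simp] theorem reflL_apply (y v : Euc n) (φ : SForm n) : reflL y φ v = φ (y - v) := rfl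

theorem reflL_sX (y : Euc n) (j : Fin n) (φ : SForm n) :
    reflL y (sX j φ) = (y j : ℂ) • reflL y φ - sX j (reflL y φ) := by
  ext1 v
  have h (ψ : SForm n) (u : Euc n) : sX j ψ u = (u j : ℂ) • ψ u := schwX_apply (coord j) ψ u
  rw [reflL_apply, h, sub_apply, smul_apply, h, reflL_apply, ← sub_smul]
  simp

theorem reflL_sP (y : Euc n) (j : Fin n) (φ : SForm n) :
    reflL y (sP j φ) = -sP j (reflL y φ) := by
  ext1 v
  have h1 : HasFDerivAt (fun v : Euc n => y - v) (-ContinuousLinearMap.id ℝ (Euc n)) v :=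
    (hasFDerivAt_id v).const_sub y
  have h2 := (φ.hasFDerivAt (y - v)).comp v h1
  have h3 : fderiv ℝ (reflL y φ) v = _ := h2.fderiv
  have h (ψ : SForm n) (u : Euc n) : sP j ψ u = fderiv ℝ ψ u (dir j) := rfl
  rw [reflL_apply, neg_apply, h, h, h3]
  simp

variable [NeZero n]

/-- The rules are stated for φ(v) = w(y - v): multiplication of w by its j-th coordinate becomes
multiplication of φ by y_j - v_j, and derivatives change sign. -/
theorem rieszRule_rieszCLM (k : ℕ) {s : ℂ} (hs : s ≠ -n) (y : Euc n) :
    RieszRule k s (fun j => (y j : ℂ)) (fun j => (y j : ℂ) • LinearMap.id - sX j) (-sP) sE sI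
      (rieszCLM (-s - n)).toLinearMap (rieszCLM (-s - n + 2)).toLinearMap := by
  have h0 : -s - (n : ℂ) ≠ 0 := fun h => hs (by linear_combination -h)
  have e0 : -(-s - (n : ℂ)) - n = s := by ring
  refine ⟨fun v hv => ?_, fun j v hv => ?_, fun v hv => ?_⟩
  · have h := rieszCLM_boxOp hv h0
    rw [e0] at h
    rw [boxOp_neg]
    exact h
  · have h := rieszCLM_gradOp hv j h0
    rw [e0] at h
    rw [gradOp_neg]
    simp only [ContinuousLinearMap.coe_coe, LinearMap.neg_apply, map_neg, h, LinearMap.sub_apply,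
      LinearMap.smul_apply, LinearMap.id_apply, map_sub, map_smul]
    module
  · have h := rieszCLM_sq hv h0
    rw [e0, contract_apply, map_sum] at h
    -- The double commutator only sees the difference between y_j and the reflected coordinate,
    -- which is v_j itself.
    have e (j : Fin n) : (y j : ℂ) ^ 2 • rieszCLM (-s - n) v
        - (2 * (y j : ℂ)) • rieszCLM (-s - n) ((y j : ℂ) • v - sX j v)
        + rieszCLM (-s - n) ((y j : ℂ) • ((y j : ℂ) • v - sX j v)
          - sX j ((y j : ℂ) • v - sX j v)) = rieszCLM (-s - n) (sX j (sX j v)) := by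
      simp only [map_sub, map_smul]
      module
    simp only [ContinuousLinearMap.coe_coe, LinearMap.sub_apply,
      LinearMap.smul_apply, LinearMap.id_apply, e, h, ← neg_smul]
    congr 1
    ring

/-- The value at `y` of the convolution with the Riesz distribution. -/
def convAt (σ : ℂ) (y : Euc n) : SForm n →L[ℂ] ExtAlg n := (rieszCLM σ).comp (reflL y)

theorem rieszConv_eq {σ : ℂ} (hσ : ∀ m : ℕ, σ ≠ 2 * (m + 1)) (φ : SForm n) (y : Euc n) :
    rieszConv σ φ y = convAt σ y φ :=
  rieszPairing_eq hσ (reflL y φ)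

theorem rieszRule_convAt (k : ℕ) {s : ℂ} (hs : s ≠ -n) (y : Euc n) :
    RieszRule k s (fun j => (y j : ℂ)) sX sP sE sI
      (convAt (-s - n) y).toLinearMap (convAt (-s - n + 2) y).toLinearMap :=
  (rieszRule_rieszCLM k hs y).comp (A := (reflL y).toLinearMap) (fun j φ => reflL_sX y j φ)
    (fun j φ => reflL_sP y j φ) (fun _ _ => rfl) (fun _ _ => rfl)

/-- The form `v ↦ w (x, v) I`. -/
def sliceAt (x : Euc n) (I : Finset (Fin n)) : SBiForm n →L[ℂ] SForm n :=
  (SchwartzMap.postcompCLM (ContinuousLinearMap.proj I)).comp (slice x)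

omit [NeZero n] in
theorem sliceAt_apply (x : Euc n) (I : Finset (Fin n)) (w : SBiForm n) (y : Euc n) :
    sliceAt x I w y = w (x, y) I := rfl

/-- The convolution in the second variable of a form on the product, evaluated at `y`, as a
functional of a slice. -/
def sndConvL (τ : ℂ) (y : Euc n) (J : Finset (Fin n)) : 𝓢(Euc n, BiExtAlg n) →L[ℂ] ExtAlg n :=
  ContinuousLinearMap.pi fun I => (ContinuousLinearMap.proj J).comp
    ((convAt τ y).comp (SchwartzMap.postcompCLM (ContinuousLinearMap.proj I)))

/-- The convolution in the second variable of a form on the product, evaluated at `y`. -/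
def sndConv (τ : ℂ) (y : Euc n) (J : Finset (Fin n)) : SBiForm n →ₗ[ℂ] SForm n :=
  applySlice (sndConvL τ y J)

theorem sndConv_apply (τ : ℂ) (y : Euc n) (J : Finset (Fin n)) (w : SBiForm n) (x : Euc n)
    (I : Finset (Fin n)) : sndConv τ y J w x I = convAt τ y (sliceAt x I w) J := rfl

theorem onSnd_rieszConv {τ : ℂ} (hτ : ∀ m : ℕ, τ ≠ 2 * (m + 1)) (w : SBiForm n) (x y : Euc n)
    (I J : Finset (Fin n)) : onSnd (rieszConv τ) w (x, y) I J = sndConv τ y J w x I := by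
  rw [sndConv_apply, ← rieszConv_eq hτ]
  rfl

theorem tensor_rieszConv {σ τ : ℂ} (hσ : ∀ m : ℕ, σ ≠ 2 * (m + 1))
    (hτ : ∀ m : ℕ, τ ≠ 2 * (m + 1)) (w : SBiForm n) (x y : Euc n) (I J : Finset (Fin n)) :
    tensor (rieszConv σ) (rieszConv τ) w (x, y) I J = convAt σ x (sndConv τ y J w) I := by
  rw [← rieszConv_eq hσ, tensor, onFst]
  simp only [onSnd_rieszConv hτ]

/-- The inner convolution is again a Schwartz form in x, so the outer pairing is also against a
Schwartz form. -/
theorem tensorRieszDefined {σ τ : ℂ} (hσ : ∀ m : ℕ, σ ≠ 2 * (m + 1))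
    (hτ : ∀ m : ℕ, τ ≠ 2 * (m + 1)) (w : SBiForm n) : TensorRieszDefined σ τ w := by
  refine ⟨fun x y I => rieszDefined hτ (reflL y (sliceAt x I w)), fun x y J => ?_⟩
  simp only [onSnd_rieszConv hτ]
  exact rieszDefined hσ (reflL x (sndConv τ y J w))

theorem sndConv_bX (τ : ℂ) (y : Euc n) (J : Finset (Fin n)) (j : Fin n) (w : SBiForm n) :
    sndConv τ y J (bX j w) = sX j (sndConv τ y J w) := by
  ext1 x
  funext I
  have h : sliceAt x I (bX j w) = (x j : ℂ) • sliceAt x I w := by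
    ext1 v
    rw [sliceAt_apply, show bX j w (x, v) = _ from schwX_apply (fstCoord j) w (x, v)]
    rfl
  rw [sndConv_apply, h, map_smul,
    show sX j (sndConv τ y J w) x = _ from schwX_apply (coord j) _ x]
  rfl

theorem sndConv_bP (τ : ℂ) (y : Euc n) (J : Finset (Fin n)) (j : Fin n) (w : SBiForm n) :
    sndConv τ y J (bP j w) = sP j (sndConv τ y J w) :=
  (schwP_applySlice (sndConvL τ y J) w (dir j)).symm

/-- A component of ε_j w is a signed single component of w or zero, and the convolution is linear in
each component separately. -/
theorem sndConv_bE (τ : ℂ) (y : Euc n) (J : Finset (Fin n)) (j : Fin n) (w : SBiForm n) :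
    sndConv τ y J (bE j w) = sE j (sndConv τ y J w) := by
  ext1 x
  funext I
  have h : sliceAt x I (bE j w) = if j ∈ I then sgn j I • sliceAt x (I.erase j) w else 0 := by
    ext1 v
    funext J'
    have : sliceAt x I (bE j w) v J' = extMul j (fun I' => w (x, v) I' J') I := rfl
    rw [this, extMul]
    split_ifs <;> rfl
  have h' : sE j (sndConv τ y J w) x I = extMul j (sndConv τ y J w x) I := rfl
  rw [sndConv_apply, h, h', extMul]
  split_ifs
  · rw [map_smul, sndConv_apply]; rfl
  · rw [map_zero]; rfl

theorem sndConv_bI (τ : ℂ) (y : Euc n) (J : Finset (Fin n)) (j : Fin n) (w : SBiForm n) :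
    sndConv τ y J (bI j w) = sI j (sndConv τ y J w) := by
  ext1 x
  funext I
  have h : sliceAt x I (bI j w) = if j ∈ I then 0 else sgn j I • sliceAt x (insert j I) w := by
    ext1 v
    funext J'
    have : sliceAt x I (bI j w) v J' = intMul j (fun I' => w (x, v) I' J') I := rfl
    rw [this, intMul]
    split_ifs <;> rfl
  have h' : sI j (sndConv τ y J w) x I = intMul j (sndConv τ y J w x) I := rfl
  rw [sndConv_apply, h, h', intMul]
  split_ifs
  · rw [map_zero]; rfl
  · rw [map_smul, sndConv_apply]; rfl

/-- Evaluation at each point x and each index I separates Schwartz forms, and there the claim is the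
one-variable rule for the slice v ↦ w(x, v). -/
theorem rieszRule_sndConv (l : ℕ) {t : ℂ} (ht : t ≠ -n) (y : Euc n) (J : Finset (Fin n)) :
    RieszRule l t (fun j => (y j : ℂ)) cX cP cE cI
      (sndConv (-t - n) y J) (sndConv (-t - n + 2) y J) := by
  refine RieszRule.of_forall (N := ℂ) (ι := Euc n × Finset (Fin n))
    (fun p => LinearMap.proj p.2 ∘ₗ LinearMap.proj p.1 ∘ₗ schwCoe (Euc n) (ExtAlg n))
    (fun φ h => ?_) fun p => ?_
  · ext1 x
    funext I
    exact h (x, I)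
  · have h := ((rieszRule_convAt l ht y).comp (A := (sliceAt p.1 p.2).toLinearMap)
      (X := cX) (P := cP) (e := cE) (f := cI) (fun j w => ?_) (fun j w => ?_) (fun _ _ => rfl)
      (fun _ _ => rfl)).map (LinearMap.proj (R := ℂ) (φ := fun _ : Finset (Fin n) => ℂ) J)
    · exact h
    · ext1 v
      have e1 : sX j (sliceAt p.1 p.2 w) v = _ := schwX_apply (coord j) _ v
      have e2 : cX j w (p.1, v) = _ := schwX_apply (sndCoord j) w (p.1, v)
      refine Eq.trans ?_ e1.symm
      exact congrFun e2 p.2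
    · ext1 v
      let L : BiExtAlg n →L[ℝ] ExtAlg n :=
        ContinuousLinearMap.proj (R := ℝ) (φ := fun _ : Finset (Fin n) => ExtAlg n) p.2
      have h3 : HasFDerivAt (fun y : Euc n => (p.1, y))
          (ContinuousLinearMap.inr ℝ (Euc n) (Euc n)) v := hasFDerivAt_prodMk_right p.1 v
      have h4 := (L.hasFDerivAt.comp (p.1, v) (w.hasFDerivAt (p.1, v))).comp v h3
      exact (congrArg (fun T : Euc n →L[ℝ] ExtAlg n => T (dir j)) h4.fderiv).symm

theorem rieszRule_fst (k : ℕ) {s : ℂ} (hs : s ≠ -n) (τ : ℂ) (x y : Euc n)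
    (J : Finset (Fin n)) : RieszRule k s (fun j => (x j : ℂ)) bX bP bE bI
      ((convAt (-s - n) x).toLinearMap ∘ₗ sndConv τ y J)
      ((convAt (-s - n + 2) x).toLinearMap ∘ₗ sndConv τ y J) :=
  (rieszRule_convAt k hs x).comp (sndConv_bX τ y J) (sndConv_bP τ y J) (sndConv_bE τ y J)
    (sndConv_bI τ y J)

theorem opE_identity {k l : ℕ} {s t : ℂ} (hs : ∀ m : ℕ, s ≠ -(n : ℂ) - 2 * m)
    (ht : ∀ m : ℕ, t ≠ -(n : ℂ) - 2 * m) {w : SBiForm n} (hw : HasBidegree k l w) :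
    (∃ η : SBiForm n, HasBidegree k l η ∧ ⇑η = opE k l s t w) ∧
      TensorRieszDefined (-s - n) (-t - n) w ∧
      TensorRieszDefined (-s - n + 2) (-t - n + 2) (opE k l s t w) ∧
      (-(kap n k s * kap n l t)) •
          mulDistSq (tensor (rieszConv (-s - n)) (rieszConv (-t - n)) w) =
        tensor (rieszConv (-s - n + 2)) (rieszConv (-t - n + 2)) (opE k l s t w) := by
  -- The unshifted parameter meets a pole only for s = -n - 2(m + 1). The shifted one does so for s
  -- = -n - 2m, so it accounts for the whole exclusion.
  have p1 {s : ℂ} (hs : ∀ m : ℕ, s ≠ -(n : ℂ) - 2 * m) (m : ℕ) : -s - (n : ℂ) ≠ 2 * (m + 1) :=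
    fun h => hs (m + 1) (by push_cast; linear_combination -h)
  have p2 {s : ℂ} (hs : ∀ m : ℕ, s ≠ -(n : ℂ) - 2 * m) (m : ℕ) : -s - (n : ℂ) + 2 ≠ 2 * (m + 1) :=
    fun h => hs m (by linear_combination -h)
  have p3 {s : ℂ} (hs : ∀ m : ℕ, s ≠ -(n : ℂ) - 2 * m) : s ≠ -n := by simpa using hs 0
  rw [opE_schwartz]
  refine ⟨⟨sOpE k l s t w, biRep_schwartz.hasBidegree_opEOp (w := w) hw s t, rfl⟩,
    tensorRieszDefined (p1 hs) (p1 ht) w, tensorRieszDefined (p2 hs) (p2 ht) _, ?_⟩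
  funext p I J
  obtain ⟨x, y⟩ := p
  have hkl := (biRep_schwartz.hasBidegree_iff k l w).1 hw
  -- Each variable needs its rule twice, once for either parameter of the other variable, because
  -- the operators are removed one variable at a time.
  have h := biRep_schwartz.weylCliffordPair.apply_opEOp
    (rieszRule_fst k (p3 hs) (-t - n) x y J) (rieszRule_fst k (p3 hs) (-t - n + 2) x y J)
    ((rieszRule_sndConv l (p3 ht) y J).map (convAt (-s - n) x).toLinearMap)
    ((rieszRule_sndConv l (p3 ht) y J).map (convAt (-s - n + 2) x).toLinearMap) hkl.1 hkl.2
  have h' := congrFun h I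
  have e : ((‖x - y‖ ^ 2 : ℝ) : ℂ) = ∑ j, ((x j : ℂ) - y j) ^ 2 := by
    rw [EuclideanSpace.norm_sq_eq, Complex.ofReal_sum]
    refine Finset.sum_congr rfl fun j _ => ?_
    rw [Real.norm_eq_abs, sq_abs]
    simp
  rw [tensor_rieszConv (p2 hs) (p2 ht)]
  refine Eq.trans ?_ h'.symm
  simp only [Pi.smul_apply, mulDistSq, tensor_rieszConv (p1 hs) (p1 ht), e]
  rfl

theorem tensor_rieszConv_neg {σ τ : ℂ} (hσ : ∀ m : ℕ, σ ≠ 2 * (m + 1))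
    (hτ : ∀ m : ℕ, τ ≠ 2 * (m + 1)) (w : SBiForm n) :
    tensor (rieszConv σ) (rieszConv τ) ⇑(-w) = -tensor (rieszConv σ) (rieszConv τ) w := by
  funext ⟨x, y⟩ I J
  have h := tensor_rieszConv hσ hτ w x y I J
  rw [tensor_rieszConv hσ hτ, map_neg, map_neg]
  exact congrArg Neg.neg h.symm

/-- With s = n - 2λ one has -s - n = 2λ - 2n, the excluded values s = -n - 2m become λ = n + m, and
F = -E accounts for the change of sign of the constant. -/
theorem opF_identity {k l : ℕ} {lam mu : ℂ} (hs : ∀ m : ℕ, lam ≠ n + m)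
    (ht : ∀ m : ℕ, mu ≠ n + m) {w : SBiForm n} (hw : HasBidegree k l w) :
    (∃ η : SBiForm n, HasBidegree k l η ∧ ⇑η = opF k l lam mu w) ∧
      TensorRieszDefined (-2 * n + 2 * lam) (-2 * n + 2 * mu) w ∧
      TensorRieszDefined (-2 * n + 2 * (lam + 1)) (-2 * n + 2 * (mu + 1)) (opF k l lam mu w) ∧
      kapF n k l lam mu • mulDistSq (tensor (knappStein lam) (knappStein mu) w) =
        tensor (knappStein (lam + 1)) (knappStein (mu + 1)) (opF k l lam mu w) := by
  have e1 (lam : ℂ) : -(n - 2 * lam) - n = -2 * n + 2 * lam := by ring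
  have e2 (lam : ℂ) : -2 * n + 2 * lam + 2 = -2 * n + 2 * (lam + 1) := by ring
  have p {lam : ℂ} (h : ∀ m : ℕ, lam ≠ n + m) (m : ℕ) : n - 2 * lam ≠ -(n : ℂ) - 2 * m :=
    fun h1 => h m (by linear_combination (-1 / 2 : ℂ) * h1)
  have p2 {lam : ℂ} (h : ∀ m : ℕ, lam ≠ n + m) (m : ℕ) : -2 * n + 2 * (lam + 1) ≠ 2 * (m + 1) :=
    fun h1 => h m (by linear_combination (1 / 2 : ℂ) * h1)
  have hE := opE_identity (p hs) (p ht) hw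
  simp only [e1, e2] at hE
  obtain ⟨⟨η, h1, h2⟩, h3, -, h5⟩ := hE
  have hF : opF k l lam mu w = ⇑(-η) := by
    rw [show opF k l lam mu w = _ from biRep_schwartz.opF_eq (w := w) hw lam mu]
    exact congrArg _ h2.symm
  have hk : kap n k (n - 2 * lam) * kap n l (n - 2 * mu) = kapF n k l lam mu := by
    simp only [kap, kapF]
    ring
  rw [hF]
  refine ⟨⟨-η, h1.neg, rfl⟩, h3, tensorRieszDefined (p2 hs) (p2 ht) _, ?_⟩
  have h6 : tensor (knappStein (lam + 1)) (knappStein (mu + 1)) ⇑(-η) = _ :=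
    tensor_rieszConv_neg (p2 hs) (p2 ht) η
  rw [h6, h2, ← h5, hk, neg_smul, neg_neg]
  rfl

end Convolution

end Forms

end

open Forms in
theorem mainTheorem3 (n k l : ℕ) (hn : 1 ≤ n) (hk : k ≤ n) (hl : l ≤ n) :
    -- the identity for the convolution operators with the Riesz distributions
    (∀ s t : ℂ, (∀ m : ℕ, s ≠ -(n : ℂ) - 2 * m) → (∀ m : ℕ, t ≠ -(n : ℂ) - 2 * m) →
      ∀ w : 𝓢(Euc n × Euc n, BiExtAlg n), HasBidegree k l w →
        (∃ η : 𝓢(Euc n × Euc n, BiExtAlg n), HasBidegree k l η ∧ ⇑η = opE k l s t w) ∧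
        TensorRieszDefined (-s - n) (-t - n) w ∧
        TensorRieszDefined (-s - n + 2) (-t - n + 2) (opE k l s t w) ∧
        (-(kap n k s * kap n l t)) •
            mulDistSq (tensor (rieszConv (-s - n)) (rieszConv (-t - n)) w) =
          tensor (rieszConv (-s - n + 2)) (rieszConv (-t - n + 2)) (opE k l s t w)) ∧
    -- the source operator acts on smooth forms of bidegree `(k, l)`, and it is the operator `-E`
    -- with the parameters `n - 2 lam` and `n - 2 mu`
    (∀ lam mu : ℂ, ∀ w : Euc n × Euc n → BiExtAlg n, ContDiff ℝ (⊤ : ℕ∞) w → HasBidegree k l w →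
      ContDiff ℝ (⊤ : ℕ∞) (opF k l lam mu w) ∧ HasBidegree k l (opF k l lam mu w) ∧
        opF k l lam mu w = -opE k l (n - 2 * lam) (n - 2 * mu) w) ∧
    -- the identity for the Knapp-Stein operators
    (∀ lam mu : ℂ, (∀ m : ℕ, lam ≠ n + m) → (∀ m : ℕ, mu ≠ n + m) →
      ∀ w : 𝓢(Euc n × Euc n, BiExtAlg n), HasBidegree k l w →
        (∃ η : 𝓢(Euc n × Euc n, BiExtAlg n), HasBidegree k l η ∧ ⇑η = opF k l lam mu w) ∧
        TensorRieszDefined (-2 * n + 2 * lam) (-2 * n + 2 * mu) w ∧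
        TensorRieszDefined (-2 * n + 2 * (lam + 1)) (-2 * n + 2 * (mu + 1)) (opF k l lam mu w) ∧
        kapF n k l lam mu • mulDistSq (tensor (knappStein lam) (knappStein mu) w) =
          tensor (knappStein (lam + 1)) (knappStein (mu + 1)) (opF k l lam mu w)) := by
  have : NeZero n := ⟨by omega⟩
  exact ⟨fun s t hs ht w hw => opE_identity hs ht hw,
    fun lam mu w h hw => opF_smooth lam mu h hw,
    fun lam mu hs ht w hw => opF_identity hs ht hw⟩
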